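/- Let $\Gamma\subset\mathbb R^2$ be a simple closed $C^\infty$ curve (not necessarily convex), with arc-length element $d\sigma$, whose curvature vanishes at only finitely many points (possibly none), at each of them to order at most $\kappa-2$, where $\kappa\in(2,\infty)$. Let $n$ be the outward (or, throughout, the inward) unit normal of $\Gamma$. For $\varepsilon>0$ let $T_\varepsilon=\{x\in\mathbb R^2:\operatorname{dist}(x,\Gamma)\le\varepsilon\}$. Let $P_\Gamma(x)$ be the point of $\Gamma$ nearest to $x$, $d_\Gamma(x)=n(P_\Gamma(x))\cdot(x-P_\Gamma(x))$ the signed distance, and $J(x)=1-d_\Gamma(x)\,k(x)$, where $k(x)$ is the signed curvature at $x$ of the level curve of $d_\Gamma$ through $x$ (positive for a circle with outward normal). Let $q\ge 0$ be an integer and let $\theta:\mathbb R\to\mathbb R$ be a bounded function with $\operatorname{supp}\theta=[-1,1]$ and $\int_{-1}^1\theta=1$, which is of class $C^{q-1}$ if $q\ge1$, and whose $q$-th derivative is piecewise $C^1$ (finitely many break points, $C^1$ up to the end points on each piece). Put $\theta_\varepsilon(s)=\varepsilon^{-1}\theta(\varepsilon^{-1}s)$. For $f\in C^\infty(\Gamma)$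 and $h>0$ put $$\mathcal I(f)=\int_\Gamma f\,d\sigma,\qquad \mathcal I_h(f)=h^2\sum_{x\in(h\mathbb Z)^2\cap T_\varepsilon} f(P_\Gamma(x))\,\theta_\varepsilon(d_\Gamma(x))\,J(x).$$ For $\eta\in\mathrm{SO}(2)$ and $\xi\in[0,1]^2$ let $\mathcal I_h(f;\eta,\xi)$ be the same quadrature for the moved curve $\eta\Gamma+h\xi$, its normal, and the function $y\mapsto f(\eta^{-1}(y-h\xi))$ on it. Let $\alpha\in[0,1]$ and let the tube width be $\varepsilon=\varepsilon(h)>0$ with $\varepsilon(h)=\Theta(h^\alpha)$ as $h\to0^+$. Assume that there are $\rho'<\rho$ such that every point of $T_\rho$ has a unique nearest point on $\Gamma$ and $\varepsilon(h)\le\rho'$ for all small $h$. Then, for all sufficiently small $h>0$, $|\mathcal I_h(f;\eta,\xi)-\mathcal I(f)|^2$ is integrable in $(\xi,\eta)$, and $$\int_{[0,1]^2}\int_{\mathrm{SO}(2)}\bigl|\mathcal I_h(f;\eta,\xi)-\mathcal I(f)\bigr|^2\,d\eta\,d\xi=O\bigl(h^{1+2(q+1)(1-\alpha)}\bigr)\qquad(h\to0^+),$$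 where $d\eta$ is the normalized Haar measure on $\mathrm{SO}(2)$. -/

import Mathlib

open Set Filter Topology MeasureTheory Asymptotics
open scoped ContDiff

noncomputable section

namespace ImplicitBoundary

/-- The Euclidean plane. -/
abbrev Plane : Type := EuclideanSpace ℝ (Fin 2)

/-- The rotation group of the plane. -/
abbrev SO2 : Type := Matrix.specialOrthogonalGroup (Fin 2) ℝ

/-! ### The normalized Haar measure of the rotation group -/

instance instMeasurableSpaceSO2 : MeasurableSpace SO2 := borel SO2

instance instBorelSpaceSO2 : BorelSpace SO2 := ⟨rfl⟩

theorem SO2.coe_inv (A : SO2) :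
    ((A⁻¹ : SO2) : Matrix (Fin 2) (Fin 2) ℝ) = star (A : Matrix (Fin 2) (Fin 2) ℝ) := rfl

instance instIsTopologicalGroupSO2 : IsTopologicalGroup SO2 where
  continuous_inv := by
    refine continuous_induced_rng.2 ?_
    have h : Continuous fun A : SO2 => star (A : Matrix (Fin 2) (Fin 2) ℝ) :=
      continuous_subtype_val.star
    exact h

instance instCompactSpaceSO2 : CompactSpace SO2 := by
  refine isCompact_iff_compactSpace.1 ?_
  have hK : IsCompact (Set.pi Set.univ fun _ : Fin 2 => Set.pi Set.univ fun _ : Fin 2 =>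
      Set.Icc (-1 : ℝ) 1) :=
    isCompact_univ_pi fun _ => isCompact_univ_pi fun _ => isCompact_Icc
  refine IsCompact.of_isClosed_subset (s := (Set.pi Set.univ fun _ : Fin 2 =>
      Set.pi Set.univ fun _ : Fin 2 => Set.Icc (-1 : ℝ) 1 : Set (Matrix (Fin 2) (Fin 2) ℝ)))
      hK ?_ ?_
  · have : (Matrix.specialOrthogonalGroup (Fin 2) ℝ : Set (Matrix (Fin 2) (Fin 2) ℝ)) =
        {A | A * star A = 1} ∩ {A | A.det = 1} := by
      ext A
      simp [Matrix.mem_specialOrthogonalGroup_iff, Matrix.mem_orthogonalGroup_iff,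
        Matrix.star_eq_conjTranspose]
    rw [this]
    exact (isClosed_eq (continuous_id.mul continuous_id.star) continuous_const).inter
      (isClosed_eq (Continuous.matrix_det continuous_id) continuous_const)
  · intro A hA i _ j _
    have hA' := (Matrix.mem_specialOrthogonalGroup_iff.1 hA).1
    have := entry_norm_bound_of_unitary hA' i j
    rw [Real.norm_eq_abs, abs_le] at this
    exact this

/-- The normalized Haar measure on the rotation group (total mass one). -/
def haarSO2 : Measure SO2 := Measure.haarMeasure ⊤

/-! ### Closed plane curves -/

/-- `γ` is an arc-length parametrization, with period `L`, of a simple closed `C^∞` curve. -/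
structure IsSmoothClosedCurve (γ : ℝ → Plane) (L : ℝ) : Prop where
  length_pos : 0 < L
  smooth : ContDiff ℝ ∞ γ
  unit_speed : ∀ t, ‖deriv γ t‖ = 1
  periodic : Function.Periodic γ L
  simple : InjOn γ (Ico 0 L)

/-- The unit normal of a unit-speed curve: the unit tangent rotated clockwise by a right angle.
It is the outward normal if the curve is traversed counterclockwise, and the inward one if it is
traversed clockwise. -/
def normal (γ : ℝ → Plane) (t : ℝ) : Plane :=
  !₂[(deriv γ t) 1, -((deriv γ t) 0)]

/-- The signed curvature `det (c', c'') / |c'|³` of a regular curve in any parametrization. -/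
def signedCurvature (c : ℝ → Plane) (t : ℝ) : ℝ :=
  ((deriv c t) 0 * (deriv (deriv c) t) 1 - (deriv c t) 1 * (deriv (deriv c) t) 0) /
    ‖deriv c t‖ ^ 3

/-- The function `k` has a zero of order exactly `m` at `t`. -/
def VanishesToOrder (k : ℝ → ℝ) (m : ℕ) (t : ℝ) : Prop :=
  (∀ j < m, iteratedDeriv j k t = 0) ∧ iteratedDeriv m k t ≠ 0

/-- The curvature vanishes at finitely many points of the curve (possibly none), and at each of
them to an order at most `κ - 2`. -/
def HasFinitelyManyFlatPoints (γ : ℝ → Plane) (L κ : ℝ) : Prop :=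
  {t ∈ Ico 0 L | signedCurvature γ t = 0}.Finite ∧
    ∀ t, signedCurvature γ t = 0 →
      ∃ m : ℕ, VanishesToOrder (signedCurvature γ) m t ∧ (m : ℝ) ≤ κ - 2

/-! ### Weight functions -/

/-- `θ` is piecewise `C^n`: off a finite set `S` of break points it is `C^n`, and on each piece
it is `C^n` up to the end points, that is, the restriction of a `C^n` function on the line. -/
def PiecewiseContDiff (n : ℕ) (θ : ℝ → ℝ) : Prop :=
  ∃ S : Finset ℝ, ∀ a b : ℝ, a < b → (∀ s ∈ S, s ∉ Ioo a b) →
    ∃ G : ℝ → ℝ, ContDiff ℝ n G ∧ EqOn θ G (Ioo a b)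

/-- The class of weight profiles of regularity order `q`, for the support `[-1, 1]`:
bounded functions of integral one, of class `C^{q-1}` if `q ≥ 1`, and such that the `q`-th
derivative is piecewise `C^1` (that is, the function is piecewise `C^{q+1}`). -/
structure IsWeight (q : ℕ) (θ : ℝ → ℝ) : Prop where
  bounded : ∃ M, ∀ s, |θ s| ≤ M
  support_eq : tsupport θ = Icc (-1) 1
  integral_eq : ∫ s in (-1)..1, θ s = 1
  contDiff : ∀ k : ℕ, k < q → ContDiff ℝ k θ
  piecewise : PiecewiseContDiff (q + 1) θ

/-- The rescaled weight `θ_ε(s) = ε⁻¹ θ(ε⁻¹ s)`. -/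
def scaledWeight (θ : ℝ → ℝ) (ε s : ℝ) : ℝ := ε⁻¹ * θ (ε⁻¹ * s)

/-! ### The tube, the projection and the implicit boundary integral -/

/-- The closed tube of half-width `ε` around a set. -/
def tube (Γ : Set Plane) (ε : ℝ) : Set Plane := {x | Metric.infDist x Γ ≤ ε}

/-- `y` is a point of `Γ` nearest to `x`. -/
def IsNearest (Γ : Set Plane) (x y : Plane) : Prop := y ∈ Γ ∧ dist x y = Metric.infDist x Γ

/-- The projection onto `Γ` is well defined on the closed tube of half-width `ρ`. -/
def ProjectionWellDefined (Γ : Set Plane) (ρ : ℝ) : Prop :=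
  ∀ x ∈ tube Γ ρ, ∃! y, IsNearest Γ x y

/-- The projection `P_Γ`: the nearest point of `Γ` (an arbitrary value where there is none). -/
def proj (Γ : Set Plane) (x : Plane) : Plane := Classical.epsilon (IsNearest Γ x)

/-- A parameter of the projection of `x` onto the curve. Only quantities that are the same for
all parameters of a point are evaluated at it. -/
def footParam (γ : ℝ → Plane) (x : Plane) : ℝ :=
  Classical.epsilon fun t => γ t = proj (range γ) x

/-- The signed distance `n(P x) · (x - P x)`. -/
def signedDist (γ : ℝ → Plane) (x : Plane) : ℝ :=
  inner ℝ (normal γ (footParam γ x)) (x - proj (range γ) x)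

/-- The Jacobian `1 - η κ`, at the point `γ t + η n(t)`, where `κ` is the signed curvature of the
level curve `t ↦ γ t + η n(t)` of the signed distance. -/
def jacobian (γ : ℝ → Plane) (t η : ℝ) : ℝ :=
  1 - η * signedCurvature (fun s => γ s + η • normal γ s) t

/-- The integrand `f(P x) θ_ε(d(x)) J(x, d(x))`. -/
def tubeIntegrand (γ : ℝ → Plane) (f : Plane → ℝ) (θ : ℝ → ℝ) (ε : ℝ) (x : Plane) : ℝ :=
  f (proj (range γ) x) * scaledWeight θ ε (signedDist γ x) *
    jacobian γ (footParam γ x) (signedDist γ x)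

/-- The implicit boundary integral: `h²` times the sum of the integrand over the (finitely many)
points of the lattice `(hℤ)²` in the tube of half-width `ε`. -/
def quadrature (γ : ℝ → Plane) (f : Plane → ℝ) (θ : ℝ → ℝ) (h ε : ℝ) : ℝ :=
  h ^ 2 * ∑' w : Fin 2 → ℤ,
    (tube (range γ) ε).indicator (tubeIntegrand γ f θ ε) (WithLp.toLp 2 fun i => h * (w i : ℝ))

/-- The boundary integral `∫_Γ f dσ`, in the arc-length parametrization. -/
def boundaryIntegral (γ : ℝ → Plane) (L : ℝ) (f : Plane → ℝ) : ℝ := ∫ t in (0)..L, f (γ t)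

/-- The rigid motion `x ↦ η x + v`. -/
def rigid (η : SO2) (v x : Plane) : Plane :=
  Matrix.toEuclideanLin (η : Matrix (Fin 2) (Fin 2) ℝ) x + v

/-- The inverse rigid motion `y ↦ η⁻¹ (y - v)`. -/
def rigidInv (η : SO2) (v y : Plane) : Plane :=
  Matrix.toEuclideanLin ((η⁻¹ : SO2) : Matrix (Fin 2) (Fin 2) ℝ) (y - v)

/-- The implicit boundary integral on the moved boundary `η Γ + h ξ`, of the integrand carried
along by the motion. -/
def movedQuadrature (γ : ℝ → Plane) (f : Plane → ℝ) (θ : ℝ → ℝ) (h ε : ℝ) (η : SO2)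
    (ξ : Plane) : ℝ :=
  quadrature (fun t => rigid η (h • ξ) (γ t)) (fun y => f (rigidInv η (h • ξ) y)) θ h ε

/-- The unit square `[0, 1]²`. -/
def unitSquare : Set Plane := {ξ | ∀ i, ξ i ∈ Icc (0 : ℝ) 1}

end ImplicitBoundary

end

/-! Moving the curve by `η` and `h • ξ` amounts to sampling one fixed function `G`, the integrand
extended by zero off the tube, on the inversely moved lattice (`movedQuadrature_eq`). In `ξ` the
quadrature is therefore a periodization, whose mean is `∫ G`; this is exactly the boundary integral,
because `J = 1 / (1 + s k)` cancels the area element `1 + s k` of the tube coordinates `γ t + s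
n(t)`. Parseval (`hasSum_latticeCoeff`) turns the variance in `ξ` into the sum, over nonzero integer
vectors `n`, of the squared modulus of the Fourier transform of `G` at a rotated multiple of `n /
h`. The average over `η` turns each term into a mean over the circle of radius `R = 2π|n| / h`
(`integral_latticeCoeff`).

It remains to bound the circular mean square of the transform by `C / (R (εR) ^ (2(q+1)))`: the sum
over `n` then converges like `∑ ‖n‖⁻³` in dimension two and leaves `h (h/ε) ^ (2(q+1))`, and `ε =
Θ(h^α)` gives the exponent.

The factor `1/R` belongs to each parallel curve separately (`Arc.exists_bound`), and no stationary
phase is involved. Cut the curve into arcs whose tangent hardly turns. For directions far from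
normal to the arc, one integration by parts gives `O(1/R)` pointwise. For the others, insert a
smooth cutoff in the direction, expand the square and integrate over the direction first. The kernel
so obtained is the transform of a smooth cap at `R (γ t - γ s)`, a frequency nearly tangent to the
arc and so away from the stationary points of the phase on the cap. It decays like `(1 + (R (t -
s))²)⁻¹`, and its integral in `s` is `O(1/R)`.

The powers of `εR` come from integration by parts across the tube. For a unit vector `ω` the
exponential `E = exp(-iR ω·x)` satisfies `R E = i ∑ᵢ ωᵢ ∂ᵢ E`, and `∂ᵢ = nᵢ ∂ₛ + Tᵢ (1 + s k)⁻¹ ∂ₜ`.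
The `∂ₜ` part is integrated along the closed curve, the `∂ₛ` part falls on `θ` (`Frame.mul_H_eq`,
`Frame.integral_mul_H_by_parts`). A profile of order `q` allows this `q + 1` times; only the last
step produces boundary terms, at the break points, and these are integrals over single parallel
curves (`Frame.decays_integral_profile`).

The coordinates are legitimate because uniqueness of nearest points on `T_ρ` makes `γ t` the nearest
point of `γ t + s n(t)` for all `|s| < ρ` (`IsSmoothClosedCurve.isNearest_tubePoint`), and the
second-order condition, with the margin between `ρ'` and `ρ`, bounds `1 + s k` below
(`IsSmoothClosedCurve.exists_regular`). -/

noncomputable section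

namespace ImplicitBoundary

/-! ### Preliminaries on calculus -/

/-- The oscillating factor `e^{-ix}`. -/
def osc (x : ℝ) : ℂ := Complex.exp (((-x : ℝ) : ℂ) * Complex.I)

@[simp] theorem norm_osc (x : ℝ) : ‖osc x‖ = 1 := Complex.norm_exp_ofReal_mul_I _

theorem continuous_osc : Continuous osc := by unfold osc; fun_prop

theorem osc_add (x y : ℝ) : osc (x + y) = osc x * osc y := by
  unfold osc; rw [← Complex.exp_add]; push_cast; ring_nf

theorem conj_osc (x : ℝ) : (starRingEnd ℂ) (osc x) = osc (-x) := by
  unfold osc; rw [← Complex.exp_conj]; simp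

theorem HasDerivAt.osc {p : ℝ → ℝ} {p' t : ℝ} (hp : HasDerivAt p p' t) :
    HasDerivAt (fun s => osc (p s)) (-(Complex.I * p') * osc (p t)) t := by
  unfold ImplicitBoundary.osc
  have h := ((hp.neg.ofReal_comp).mul_const Complex.I).cexp
  have e : ((-p' : ℝ) : ℂ) * Complex.I = -(Complex.I * p') := by push_cast; ring
  rw [e, mul_comm] at h
  exact h

theorem exists_bound_of_periodic {E : Type*} [NormedAddCommGroup E] {f : ℝ → E} {c : ℝ}
    (hc : 0 < c) (hf : Continuous f) (hp : Function.Periodic f c) : ∃ C, ∀ x, ‖f x‖ ≤ C := by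
  obtain ⟨C, hC⟩ := isCompact_Icc.exists_bound_of_continuousOn (s := Icc 0 c) hf.continuousOn
  refine ⟨C, fun x => ?_⟩
  obtain ⟨y, hy, hxy⟩ := hp.exists_mem_Ico₀ hc x
  rw [hxy]
  exact hC y (Ico_subset_Icc_self hy)

theorem periodic_deriv {f : ℝ → ℝ} {c : ℝ} (hp : Function.Periodic f c) :
    Function.Periodic (deriv f) c := by
  intro x
  rw [← deriv_comp_add_const]
  congr 1
  exact funext hp

/-- A smooth function on the line that coincides with the reciprocal away from zero. -/
theorem exists_smooth_reciprocal {δ : ℝ} (hδ : 0 < δ) :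
    ∃ g : ℝ → ℝ, ContDiff ℝ ∞ g ∧ ∀ v, δ ≤ |v| → g v * v = 1 := by
  let B : ContDiffBump (0 : ℝ) := ⟨δ / 2, δ, by positivity, by linarith⟩
  -- The bump equals one at the origin, where `v ^ 2` vanishes, and is zero where the reciprocal is
  -- wanted.
  have hden : ∀ v : ℝ, v ^ 2 + B v ≠ 0 := by
    intro v
    have h0 : 0 ≤ B v := B.nonneg
    rcases eq_or_ne v 0 with rfl | hv
    · have : B (0 : ℝ) = 1 := B.one_of_mem_closedBall (by simp; exact B.rIn_pos.le)
      rw [this]; norm_num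
    · have := sq_pos_of_ne_zero hv
      positivity
  refine ⟨fun v => v / (v ^ 2 + B v), ?_, fun v hv => ?_⟩
  · exact contDiff_id.div ((contDiff_id.pow 2).add B.contDiff) hden
  · have hB : B v = 0 := B.zero_of_le_dist (by simpa [Real.dist_eq] using hv)
    have hv0 : v ≠ 0 := by
      rintro rfl; simp at hv; linarith
    simp only [hB, add_zero]
    field_simp

theorem integral_integral_swap_of_continuous {E : Type*} [NormedAddCommGroup E]
    [NormedSpace ℝ E] {F : ℝ → ℝ → E} (hF : Continuous (Function.uncurry F))
    (a b c d : ℝ) :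
    ∫ x in a..b, ∫ y in c..d, F x y = ∫ y in c..d, ∫ x in a..b, F x y := by
  simp only [intervalIntegral.intervalIntegral_eq_integral_uIoc, integral_smul]
  rw [smul_comm]
  congr 2
  apply integral_integral_swap
  rw [Measure.prod_restrict]
  apply IntegrableOn.mono_set (t := uIcc a b ×ˢ uIcc c d)
  · exact hF.continuousOn.integrableOn_compact (isCompact_uIcc.prod isCompact_uIcc)
  · exact prod_mono uIoc_subset_uIcc uIoc_subset_uIcc

/-- Integration by parts for weights that are continuous but fail to be differentiable at break
points. -/
theorem integral_mul_deriv_of_off_countable {u v u' v' : ℝ → ℂ} {a b : ℝ} {s : Set ℝ}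
    (hs : s.Countable) (hab : a ≤ b)
    (hu : ContinuousOn u (Icc a b)) (hv : ContinuousOn v (Icc a b))
    (hu' : ∀ x ∈ Ioo a b \ s, HasDerivAt u (u' x) x)
    (hv' : ∀ x ∈ Ioo a b \ s, HasDerivAt v (v' x) x)
    (hui : IntervalIntegrable u' volume a b) (hvi : IntervalIntegrable v' volume a b) :
    ∫ x in a..b, u x * v' x = u b * v b - u a * v a - ∫ x in a..b, u' x * v x := by
  rw [← uIcc_of_le hab] at hu hv
  have h1 := hui.mul_continuousOn hv
  have h2 := hvi.continuousOn_mul hu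
  have := integral_eq_of_hasDerivAt_off_countable_of_le (fun x => u x * v x)
    (fun x => u' x * v x + u x * v' x) hab hs
    ((hu.mul hv).mono (by rw [uIcc_of_le hab])) (fun x hx => (hu' x hx).mul (hv' x hx))
    (h1.add h2)
  rw [intervalIntegral.integral_add h1 h2] at this
  rw [← this]; ring

/-! ### Oscillatory integrals over the circle -/

/-- `S` stands for `1 / sin` on the support of `u`. Writing `u = (u S) sin` makes the integrand a
multiple of `u S` times the derivative of the exponential; periodicity removes the boundary terms.
-/
theorem integral_mul_osc_step {u S : ℝ → ℝ} (hu : ContDiff ℝ 1 u) (hS : ContDiff ℝ 1 S)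
    (hup : Function.Periodic u (2 * Real.pi)) (hSp : Function.Periodic S (2 * Real.pi))
    (hS1 : ∀ φ, u φ ≠ 0 → S φ * Real.sin φ = 1) {r : ℝ} (hr : r ≠ 0) :
    ∫ φ in (0)..(2 * Real.pi), (u φ : ℂ) * osc (r * Real.cos φ) =
      (Complex.I / r) * ∫ φ in (0)..(2 * Real.pi),
        ((deriv (fun ψ => u ψ * S ψ) φ : ℝ) : ℂ) * osc (r * Real.cos φ) := by
  set w : ℝ → ℝ := fun ψ => u ψ * S ψ
  have hw : ContDiff ℝ 1 w := hu.mul hS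
  have hwd : ∀ x, HasDerivAt (fun t => (w t : ℂ)) ((deriv w x : ℝ) : ℂ) x := fun x =>
    ((hw.differentiable one_ne_zero x).hasDerivAt).ofReal_comp
  have hod : ∀ x, HasDerivAt (fun t => osc (r * Real.cos t))
      (Complex.I * r * Real.sin x * osc (r * Real.cos x)) x := fun x => by
    convert HasDerivAt.osc ((Real.hasDerivAt_cos x).const_mul r) using 1
    push_cast; ring
  have hcd : Continuous (deriv w) := hw.continuous_deriv le_rfl
  have hco : Continuous fun t => osc (r * Real.cos t) := continuous_osc.comp (by fun_prop)
  have key := intervalIntegral.integral_mul_deriv_eq_deriv_mul (a := 0) (b := 2 * Real.pi)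
    (fun x _ => hwd x) (fun x _ => hod x)
    ((Complex.continuous_ofReal.comp hcd).intervalIntegrable _ _)
    (by apply Continuous.intervalIntegrable; fun_prop)
  have hb : w (2 * Real.pi) = w 0 := by
    have := (hup.mul hSp) 0
    simpa [w] using this
  rw [hb] at key
  simp only [Real.cos_two_pi, Real.cos_zero, sub_self, zero_sub] at key
  have h1 : ∀ x, (w x : ℂ) * (Complex.I * r * Real.sin x * osc (r * Real.cos x)) =
      (Complex.I * r) * ((u x : ℂ) * osc (r * Real.cos x)) := by
    intro x
    by_cases h : u x = 0
    · simp [w, h]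
    · have := hS1 x h
      have h2 : (S x : ℂ) * (Real.sin x : ℂ) = 1 := by exact_mod_cast this
      simp only [w]; push_cast at h2 ⊢
      linear_combination (Complex.I * r * u x * osc (r * Real.cos x)) * h2
  simp only [h1] at key
  rw [intervalIntegral.integral_const_mul] at key
  have hr' : (r : ℂ) ≠ 0 := by exact_mod_cast hr
  have hI := Complex.I_sq
  field_simp
  linear_combination (-Complex.I) * key + (r * ∫ φ in (0)..(2 * Real.pi), (u φ : ℂ) * osc (r * Real.cos φ)) * hI

/-- An amplitude supported away from the two stationary points of `cos` gives quadratic decay. -/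
theorem exists_bound_integral_mul_osc {h : ℝ → ℝ} (hh : ContDiff ℝ ∞ h)
    (hp : Function.Periodic h (2 * Real.pi)) :
    ∃ C, 0 ≤ C ∧ ∀ d : ℝ, (∀ φ, h (φ + d) ≠ 0 → 1 / 2 < |Real.sin φ|) → ∀ r : ℝ, 0 ≤ r →
      (1 + r ^ 2) * ‖∫ φ in (0)..(2 * Real.pi), (h (φ + d) : ℂ) * osc (r * Real.cos φ)‖ ≤ C := by
  obtain ⟨g, hg, hg1⟩ := exists_smooth_reciprocal (δ := 1 / 2) (by norm_num)
  set S : ℝ → ℝ := fun φ => g (Real.sin φ) with hSdef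
  have hS : ContDiff ℝ ∞ S := hg.comp Real.contDiff_sin
  have hSp : Function.Periodic S (2 * Real.pi) := fun x => by simp [S]
  have h2pi : (0 : ℝ) < 2 * Real.pi := by positivity
  have hh1 : ContDiff ℝ ∞ (deriv h) := hh.iterate_deriv 1
  have hh2 : ContDiff ℝ ∞ (deriv (deriv h)) := hh.iterate_deriv 2
  have hS1 : ContDiff ℝ ∞ (deriv S) := hS.iterate_deriv 1
  have hS2 : ContDiff ℝ ∞ (deriv (deriv S)) := hS.iterate_deriv 2
  obtain ⟨M, hM⟩ := exists_bound_of_periodic (f := fun x => (![h x, deriv h x, deriv (deriv h) x,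
      S x, deriv S x, deriv (deriv S) x] : Fin 6 → ℝ)) h2pi
    (by
      have := hh.continuous; have := hh1.continuous; have := hh2.continuous
      have := hS.continuous; have := hS1.continuous; have := hS2.continuous
      fun_prop)
    (fun x => by
      simp only [hp x, periodic_deriv hp x, periodic_deriv (periodic_deriv hp) x, hSp x,
        periodic_deriv hSp x, periodic_deriv (periodic_deriv hSp) x])
  have hM0 : 0 ≤ M := (norm_nonneg _).trans (hM 0)
  have hMi : ∀ x i, ‖(![h x, deriv h x, deriv (deriv h) x,
      S x, deriv S x, deriv (deriv S) x] : Fin 6 → ℝ) i‖ ≤ M := fun x i =>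
    (norm_le_pi_norm _ i).trans (hM x)
  have b0 : ∀ x, |h x| ≤ M := fun x => hMi x 0
  have b1 : ∀ x, |deriv h x| ≤ M := fun x => hMi x 1
  have b2 : ∀ x, |deriv (deriv h) x| ≤ M := fun x => hMi x 2
  have s0 : ∀ x, |S x| ≤ M := fun x => hMi x 3
  have s1 : ∀ x, |deriv S x| ≤ M := fun x => hMi x 4
  have s2 : ∀ x, |deriv (deriv S) x| ≤ M := fun x => hMi x 5
  -- The trivial bound supplies the `1` of `1 + r ^ 2`; two integrations by parts supply the `r ^
  -- 2`. The resulting amplitude is a sum of six triple products of derivatives of `h` and `S`.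
  -- Translation by `d` does not change their bounds.
  refine ⟨(M + 6 * M ^ 3) * (2 * Real.pi), by positivity, fun d hd r hr => ?_⟩
  set u : ℝ → ℝ := fun φ => h (φ + d) with hu_def
  have hu : ContDiff ℝ ∞ u := hh.comp (contDiff_id.add contDiff_const)
  have hup : Function.Periodic u (2 * Real.pi) := fun x => by
    simp only [u]; rw [add_right_comm]; exact hp _
  have bound : ∀ (w : ℝ → ℝ) (B : ℝ), (∀ x, |w x| ≤ B) →
      ‖∫ φ in (0)..(2 * Real.pi), (w φ : ℂ) * osc (r * Real.cos φ)‖ ≤ B * (2 * Real.pi) := by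
    intro w B hB
    have := intervalIntegral.norm_integral_le_of_norm_le_const (a := 0) (b := 2 * Real.pi)
      (f := fun φ => (w φ : ℂ) * osc (r * Real.cos φ)) (C := B) (fun x _ => by simpa using hB x)
    simpa [abs_of_pos Real.pi_pos] using this
  have hA := bound u M (fun x => b0 _)
  have hB : r ^ 2 * ‖∫ φ in (0)..(2 * Real.pi), (u φ : ℂ) * osc (r * Real.cos φ)‖ ≤
      (6 * M ^ 3) * (2 * Real.pi) := by
    rcases hr.eq_or_lt with rfl | hr
    · simp; positivity
    have hsin : ∀ φ, 1 / 2 < |Real.sin φ| → S φ * Real.sin φ = 1 := fun φ h => hg1 _ h.le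
    set u1 : ℝ → ℝ := deriv (fun ψ => u ψ * S ψ) with hu1_def
    have hu1 : ContDiff ℝ ∞ u1 := (hu.mul hS).iterate_deriv 1
    -- Where `|sin| < 1/2` the function `u` vanishes on a whole neighbourhood, hence so does the
    -- derivative. The support condition survives only with `≤`, which is all that the reciprocal
    -- requires.
    have hu1' : ∀ φ, u1 φ ≠ 0 → S φ * Real.sin φ = 1 := by
      intro φ hφ
      refine hg1 _ ?_
      by_contra! hlt
      apply hφ
      have hev : (fun ψ => u ψ * S ψ) =ᶠ[𝓝 φ] fun _ => 0 := by
        have : ∀ᶠ ψ in 𝓝 φ, |Real.sin ψ| < 1 / 2 :=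
          (Real.continuous_sin.abs.tendsto φ).eventually_lt_const hlt
        filter_upwards [this] with ψ hψ
        have : u ψ = 0 := by
          by_contra hne
          exact absurd (hd ψ hne) (not_lt.2 hψ.le)
        simp [this]
      rw [hu1_def, hev.deriv_eq]; simp
    have e1 := integral_mul_osc_step (hu.of_le (by simp)) (hS.of_le (by simp)) hup hSp
      (fun φ h => hsin φ (hd φ h)) hr.ne'
    have e2 := integral_mul_osc_step (hu1.of_le (by simp)) (hS.of_le (by simp))
      (periodic_deriv (hup.mul hSp)) hSp hu1' hr.ne'
    rw [e1, e2, norm_mul, norm_mul]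
    have hn : ‖Complex.I / (r : ℂ)‖ = 1 / r := by simp [abs_of_pos hr]
    rw [hn]
    have hd0 : ∀ x, HasDerivAt u (deriv h (x + d)) x := fun x =>
      ((hh.differentiable (by simp) _).hasDerivAt).comp_add_const x d
    have hd1 : ∀ x, HasDerivAt (fun x => deriv h (x + d)) (deriv (deriv h) (x + d)) x := fun x =>
      ((hh1.differentiable (by simp) _).hasDerivAt).comp_add_const x d
    have hs0 : ∀ x, HasDerivAt S (deriv S x) x := fun x =>
      (hS.differentiable (by simp) _).hasDerivAt
    have hs1 : ∀ x, HasDerivAt (deriv S) (deriv (deriv S) x) x := fun x =>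
      (hS1.differentiable (by simp) _).hasDerivAt
    have hu1e : u1 = fun x => deriv h (x + d) * S x + u x * deriv S x :=
      funext fun x => ((hd0 x).mul (hs0 x)).deriv
    have hu2 : ∀ x, deriv (fun ψ => u1 ψ * S ψ) x =
        ((deriv (deriv h) (x + d) * S x + deriv h (x + d) * deriv S x) +
          (deriv h (x + d) * deriv S x + u x * deriv (deriv S) x)) * S x +
        (deriv h (x + d) * S x + u x * deriv S x) * deriv S x := by
      intro x
      rw [hu1e]
      exact (((((hd1 x).mul (hs0 x)).add ((hd0 x).mul (hs1 x))).mul (hs0 x))).deriv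
    have hbd : ∀ x, |deriv (fun ψ => u1 ψ * S ψ) x| ≤ 6 * M ^ 3 := by
      intro x
      have t : ∀ a b c : ℝ, |a| ≤ M → |b| ≤ M → |c| ≤ M → |a * b * c| ≤ M ^ 3 := by
        intro a b c ha hb hc
        rw [abs_mul, abs_mul, pow_three']
        gcongr
      rw [hu2]
      have e : ∀ a b c d e f : ℝ, ((a * d + b * e) + (b * e + c * f)) * d + (b * d + c * e) * e =
          a * d * d + b * e * d + b * e * d + c * f * d + b * d * e + c * e * e := by
        intros; ring
      rw [e]
      have i1 := abs_le.1 (t _ _ _ (b2 (x + d)) (s0 x) (s0 x))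
      have i2 := abs_le.1 (t _ _ _ (b1 (x + d)) (s1 x) (s0 x))
      have i3 := abs_le.1 (t _ _ _ (b0 (x + d)) (s2 x) (s0 x))
      have i4 := abs_le.1 (t _ _ _ (b1 (x + d)) (s0 x) (s1 x))
      have i5 := abs_le.1 (t _ _ _ (b0 (x + d)) (s1 x) (s1 x))
      rw [abs_le]
      constructor <;> simp only [u] <;> linarith [i1.1, i1.2, i2.1, i2.2, i3.1, i3.2, i4.1, i4.2, i5.1, i5.2]
    have := bound _ _ hbd
    calc _ = ‖∫ φ in (0)..(2 * Real.pi), ((deriv (fun ψ => u1 ψ * S ψ) φ : ℝ) : ℂ) *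
            osc (r * Real.cos φ)‖ := by field_simp
      _ ≤ _ := this
  calc _ = _ := add_mul _ _ _
    _ ≤ M * (2 * Real.pi) + (6 * M ^ 3) * (2 * Real.pi) := by
        rw [one_mul]; exact add_le_add hA hB
    _ = _ := by ring


/-! ### The circular mean square of an oscillatory integral along a curve -/

/-- The phase `ω(φ) · (x, y)`, with `ω(φ) = (cos φ, sin φ)`. -/
def phase (φ x y : ℝ) : ℝ := Real.cos φ * x + Real.sin φ * y

theorem exists_polar (x y : ℝ) : ∃ r β : ℝ, 0 ≤ r ∧ x = r * Real.cos β ∧ y = r * Real.sin β := by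
  refine ⟨‖(⟨x, y⟩ : ℂ)‖, Complex.arg ⟨x, y⟩, norm_nonneg _, ?_, ?_⟩
  · rw [Complex.norm_mul_cos_arg]
  · rw [Complex.norm_mul_sin_arg]

/-- A smooth cutoff on the line. -/
def cutoff : ContDiffBump (0 : ℝ) := ⟨1 / 2, 3 / 4, by norm_num, by norm_num⟩

theorem cutoff_eq_one {x : ℝ} (hx : |x| ≤ 1 / 2) : cutoff x = 1 :=
  cutoff.one_of_mem_closedBall (by simpa [Real.dist_eq, cutoff] using hx)

theorem abs_lt_of_cutoff_ne_zero {x : ℝ} (hx : cutoff x ≠ 0) : |x| < 3 / 4 := by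
  by_contra! h
  exact hx (cutoff.zero_of_le_dist (by simpa [Real.dist_eq, cutoff] using h))

theorem continuous_cutoff : Continuous (cutoff : ℝ → ℝ) := cutoff.continuous

/-- Decay of the Fourier transform of a smooth cap on the circle at frequencies that are nearly
tangent to the circle at the centre of the cap. -/
theorem exists_bound_cap_kernel :
    ∃ C, 0 ≤ C ∧ ∀ τ₀ τ₁ m x y R : ℝ, τ₀ ^ 2 + τ₁ ^ 2 = 1 → 0 ≤ m → |x - m * τ₀| ≤ m / 100 →
      |y - m * τ₁| ≤ m / 100 → 0 ≤ R →
      (1 + (R * (m / 2)) ^ 2) *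
        ‖∫ φ in (0)..(2 * Real.pi), (cutoff (phase φ τ₀ τ₁) : ℂ) * osc (R * phase φ x y)‖ ≤ C := by
  have hh : ContDiff ℝ ∞ fun x => cutoff (Real.cos x) := cutoff.contDiff.comp Real.contDiff_cos
  obtain ⟨C, hC0, hC⟩ := exists_bound_integral_mul_osc hh (fun x => by simp)
  -- The extra `2π` covers the degenerate case `m = 0`, in which the frequency vanishes.
  refine ⟨C + 2 * Real.pi, by positivity, fun τ₀ τ₁ m x y R hτ hm hx hy hR => ?_⟩
  rcases hm.eq_or_lt with rfl | hm
  · have hx0 : x = 0 := by simpa using hx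
    have hy0 : y = 0 := by simpa using hy
    have := intervalIntegral.norm_integral_le_of_norm_le_const (a := 0) (b := 2 * Real.pi)
      (f := fun φ => (cutoff (phase φ τ₀ τ₁) : ℂ) * osc (R * phase φ x y)) (C := 1)
      (fun φ _ => by simpa [abs_of_nonneg cutoff.nonneg] using cutoff.le_one)
    simp only [sub_zero, abs_of_pos Real.two_pi_pos] at this
    simp only [zero_div, mul_zero]
    nlinarith
  obtain ⟨r, β, hr, rfl, rfl⟩ := exists_polar x y
  obtain ⟨ρ, a, hρ, rfl, rfl⟩ := exists_polar τ₀ τ₁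
  have hρ1 : ρ = 1 := by
    have : ρ ^ 2 = 1 := by
      rw [← hτ]; linear_combination (-ρ ^ 2) * Real.sin_sq_add_cos_sq a
    nlinarith
  subst hρ1
  simp only [one_mul] at hx hy
  rw [abs_le] at hx hy
  have cβ := Real.abs_cos_le_one β
  have sβ := Real.abs_sin_le_one β
  have ca := Real.abs_cos_le_one a
  have sa := Real.abs_sin_le_one a
  -- perturbation of a linear form
  have pert : ∀ c s u w e : ℝ, |c| ≤ 1 → |s| ≤ 1 → -e ≤ u → u ≤ e → -e ≤ w → w ≤ e →
      |c * u + s * w| ≤ 2 * e := by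
    intro c s u w e hc hs h1 h2 h3 h4
    have hu : |u| ≤ e := abs_le.2 ⟨h1, h2⟩
    have hw : |w| ≤ e := abs_le.2 ⟨h3, h4⟩
    calc |c * u + s * w| ≤ |c * u| + |s * w| := abs_add_le _ _
      _ = |c| * |u| + |s| * |w| := by rw [abs_mul, abs_mul]
      _ ≤ 1 * e + 1 * e := by gcongr
      _ = _ := by ring
  -- Pairing `(x, y) - m τ` with the unit vector of angle `β` bounds `r` above; pairing it with `τ`
  -- itself, below, bounds `r` from below.
  have hup : r ≤ m + 2 * (m / 100) := by
    have h := (abs_le.1 (pert _ _ _ _ _ cβ sβ hx.1 hx.2 hy.1 hy.2)).2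
    have e : Real.cos β * (r * Real.cos β - m * Real.cos a) +
        Real.sin β * (r * Real.sin β - m * Real.sin a) = r - m * Real.cos (β - a) := by
      rw [Real.cos_sub]; linear_combination r * Real.sin_sq_add_cos_sq β
    rw [e] at h
    nlinarith [Real.cos_le_one (β - a)]
  have hlow : m / 2 ≤ r := by
    have h := (abs_le.1 (pert _ _ _ _ _ ca sa hx.1 hx.2 hy.1 hy.2)).1
    have e : Real.cos a * (r * Real.cos β - m * Real.cos a) +
        Real.sin a * (r * Real.sin β - m * Real.sin a) = r * Real.cos (β - a) - m := by
      rw [Real.cos_sub]; linear_combination (-m) * Real.sin_sq_add_cos_sq a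
    rw [e] at h
    nlinarith [Real.cos_le_one (β - a)]
  -- On the cap `|cos| < 3/4`, so `|sin| ≥ 0.66`. Replacing the angle of `τ` by that of `(x, y)`
  -- costs at most `2m/100`, and `r ≤ 1.02 m`, so the sine stays above `1/2`: no stationary point
  -- lies on the cap.
  have hd : ∀ ψ, cutoff (Real.cos (ψ + (β - a))) ≠ 0 → 1 / 2 < |Real.sin ψ| := by
    intro ψ hψ
    have h1 := abs_lt_of_cutoff_ne_zero hψ
    have h2 : (66 / 100 : ℝ) ≤ |Real.sin (ψ + (β - a))| := by
      have h3 := Real.sin_sq_add_cos_sq (ψ + (β - a))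
      have h4 := sq_abs (Real.cos (ψ + (β - a)))
      have h5 := sq_abs (Real.sin (ψ + (β - a)))
      have h6 := abs_nonneg (Real.cos (ψ + (β - a)))
      by_contra! hlt
      have h7 := abs_nonneg (Real.sin (ψ + (β - a)))
      nlinarith
    have h := pert _ (-Real.cos (ψ + β)) _ _ _ (Real.abs_sin_le_one (ψ + β))
      (by rw [abs_neg]; exact Real.abs_cos_le_one _) hx.1 hx.2 hy.1 hy.2
    have e1 : Real.sin ψ = Real.sin (ψ + β) * Real.cos β - Real.cos (ψ + β) * Real.sin β := by
      rw [← Real.sin_sub]; congr 1; ring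
    have e2 : Real.sin (ψ + (β - a)) =
        Real.sin (ψ + β) * Real.cos a - Real.cos (ψ + β) * Real.sin a := by
      rw [← Real.sin_sub]; congr 1; ring
    have e : Real.sin (ψ + β) * (r * Real.cos β - m * Real.cos a) +
        -Real.cos (ψ + β) * (r * Real.sin β - m * Real.sin a) =
        r * Real.sin ψ - m * Real.sin (ψ + (β - a)) := by rw [e1, e2]; ring
    rw [e] at h
    have h8 : |m * Real.sin (ψ + (β - a))| - |r * Real.sin ψ| ≤ 2 * (m / 100) := by
      rw [abs_sub_comm] at h
      exact (abs_sub_abs_le_abs_sub _ _).trans h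
    rw [abs_mul, abs_mul, abs_of_pos hm, abs_of_nonneg hr] at h8
    by_contra! hlt
    nlinarith [abs_nonneg (Real.sin ψ)]
  -- Rotation by `β` turns the phase into a multiple of `cos`.
  have hint : ∫ φ in (0)..(2 * Real.pi), (cutoff (phase φ (1 * Real.cos a) (1 * Real.sin a)) : ℂ) *
        osc (R * phase φ (r * Real.cos β) (r * Real.sin β)) =
      ∫ φ in (0)..(2 * Real.pi), (cutoff (Real.cos (φ + (β - a))) : ℂ) *
        osc (R * r * Real.cos φ) := by
    set F : ℝ → ℂ := fun φ => (cutoff (Real.cos (φ + (β - a))) : ℂ) * osc (R * r * Real.cos φ)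
    have hF : Function.Periodic F (2 * Real.pi) := fun x => by
      simp only [F, add_right_comm x (2 * Real.pi), Real.cos_add_two_pi]
    have h1 : (fun φ => (cutoff (phase φ (1 * Real.cos a) (1 * Real.sin a)) : ℂ) *
        osc (R * phase φ (r * Real.cos β) (r * Real.sin β))) = fun φ => F (φ - β) := by
      funext φ
      have h2 : phase φ (1 * Real.cos a) (1 * Real.sin a) = Real.cos (φ - β + (β - a)) := by
        rw [sub_add_sub_cancel, Real.cos_sub]; simp [phase]
      have h3 : R * phase φ (r * Real.cos β) (r * Real.sin β) = R * r * Real.cos (φ - β) := by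
        rw [Real.cos_sub]; simp only [phase]; ring
      rw [h2, h3]
    rw [h1, intervalIntegral.integral_comp_sub_right F β]
    have := hF.intervalIntegral_add_eq (0 - β) 0
    rw [zero_add] at this
    rw [← this]
    congr 1; ring
  rw [hint]
  have h9 := hC (β - a) hd (R * r) (mul_nonneg hR hr)
  have h10 : (R * (m / 2)) ^ 2 ≤ (R * r) ^ 2 := by gcongr
  calc _ ≤ (1 + (R * r) ^ 2) * ‖∫ φ in (0)..(2 * Real.pi),
        (cutoff (Real.cos (φ + (β - a))) : ℂ) * osc (R * r * Real.cos φ)‖ := by gcongr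
    _ ≤ C := h9
    _ ≤ _ := by linarith [Real.two_pi_pos]

/-- The mass of the Cauchy kernel on the whole line, used as a bound on every interval: this is
where `1/R` comes from. -/
theorem integral_inv_one_add_sq_le {l : ℝ} (hl : 0 < l) (t a b : ℝ) :
    ∫ s in a..b, (1 + (l * (t - s)) ^ 2)⁻¹ ≤ Real.pi / l := by
  have h1 : (fun s => (1 + (l * (t - s)) ^ 2)⁻¹) = fun s => (fun x => (1 + x ^ 2)⁻¹) (l * s - l * t) := by
    funext s; simp only; congr 2; ring
  rw [h1, intervalIntegral.integral_comp_mul_sub (fun x => (1 + x ^ 2)⁻¹) hl.ne' (l * t),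
    integral_inv_one_add_sq, smul_eq_mul, div_eq_inv_mul]
  gcongr
  linarith [Real.arctan_lt_pi_div_two (l * b - l * t), Real.neg_pi_div_two_lt_arctan (l * a - l * t)]

/-- A regular parametrized plane curve, with tangent direction `(T₀, T₁)`, speed `v` and an
amplitude `b` along it. The constants `c` and `A` bound its data. -/
structure Arc (c A : ℝ) where
  (X Y T₀ T₁ k v v' b b' : ℝ → ℝ)
  hX : ∀ t, HasDerivAt X (v t * T₀ t) t
  hY : ∀ t, HasDerivAt Y (v t * T₁ t) t
  hT₀ : ∀ t, HasDerivAt T₀ (-(k t * T₁ t)) t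
  hT₁ : ∀ t, HasDerivAt T₁ (k t * T₀ t) t
  unit : ∀ t, T₀ t ^ 2 + T₁ t ^ 2 = 1
  hv : ∀ t, HasDerivAt v (v' t) t
  hb : ∀ t, HasDerivAt b (b' t) t
  k_cont : Continuous k
  v'_cont : Continuous v'
  b'_cont : Continuous b'
  v_ge : ∀ t, c ≤ v t
  v_le : ∀ t, v t ≤ A
  k_le : ∀ t, |k t| ≤ A
  v'_le : ∀ t, |v' t| ≤ A
  b_le : ∀ t, |b t| ≤ A
  b'_le : ∀ t, |b' t| ≤ A

namespace Arc

variable {c A : ℝ} (Γ : Arc c A)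

theorem continuous_X : Continuous Γ.X := continuous_iff_continuousAt.2 fun t => (Γ.hX t).continuousAt
theorem continuous_Y : Continuous Γ.Y := continuous_iff_continuousAt.2 fun t => (Γ.hY t).continuousAt
theorem continuous_T₀ : Continuous Γ.T₀ :=
  continuous_iff_continuousAt.2 fun t => (Γ.hT₀ t).continuousAt
theorem continuous_T₁ : Continuous Γ.T₁ :=
  continuous_iff_continuousAt.2 fun t => (Γ.hT₁ t).continuousAt
theorem continuous_v : Continuous Γ.v := continuous_iff_continuousAt.2 fun t => (Γ.hv t).continuousAt
theorem continuous_b : Continuous Γ.b := continuous_iff_continuousAt.2 fun t => (Γ.hb t).continuousAt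

/-- The oscillatory integral along the arc over the parameters in `[a, a']`. -/
def integral (R a a' φ : ℝ) : ℂ := ∫ t in a..a', (Γ.b t : ℂ) * osc (R * phase φ (Γ.X t) (Γ.Y t))

theorem abs_T₀_le (t : ℝ) : |Γ.T₀ t| ≤ 1 := by
  rw [abs_le]; constructor <;> nlinarith [Γ.unit t, sq_nonneg (Γ.T₁ t)]

theorem abs_T₁_le (t : ℝ) : |Γ.T₁ t| ≤ 1 := by
  rw [abs_le]; constructor <;> nlinarith [Γ.unit t, sq_nonneg (Γ.T₀ t)]

theorem continuous_integrand (R : ℝ) :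
    Continuous fun p : ℝ × ℝ => (Γ.b p.2 : ℂ) * osc (R * phase p.1 (Γ.X p.2) (Γ.Y p.2)) := by
  have := Γ.continuous_X; have := Γ.continuous_Y; have := Γ.continuous_b
  have := continuous_osc
  unfold phase
  fun_prop

theorem continuous_integral (R a a' : ℝ) : Continuous (Γ.integral R a a') :=
  intervalIntegral.continuous_parametric_intervalIntegral_of_continuous' (Γ.continuous_integrand R) a a'

theorem abs_phase_le (φ : ℝ) {x y e : ℝ} (hx : |x| ≤ e) (hy : |y| ≤ e) : |phase φ x y| ≤ 2 * e := by
  unfold phase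
  calc _ ≤ |Real.cos φ * x| + |Real.sin φ * y| := abs_add_le _ _
    _ = |Real.cos φ| * |x| + |Real.sin φ| * |y| := by rw [abs_mul, abs_mul]
    _ ≤ 1 * e + 1 * e := by
      have := Real.abs_cos_le_one φ
      have := Real.abs_sin_le_one φ
      gcongr
    _ = _ := by ring

/-- Where the direction `ω(φ)` is far from normal to the arc, one integration by parts applies. -/
theorem exists_bound_nonstationary {c : ℝ} (hc : 0 < c) (A l : ℝ) :
    ∃ C, 0 ≤ C ∧ ∀ (Γ : Arc c A) (a a' φ R : ℝ), a ≤ a' → a' - a ≤ l → 0 < R →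
      (∀ t ∈ Icc a a', 3 / 10 ≤ |phase φ (Γ.T₀ t) (Γ.T₁ t)|) → ‖Γ.integral R a a' φ‖ ≤ C / R := by
  -- `D` is the derivative of the phase divided by `R`, with `|D| ≥ 3c/10`. `W₀` bounds the quotient
  -- `b / D` in the boundary terms, `W₁` bounds its derivative.
  set W₀ : ℝ := |A| / (c * (3 / 10))
  set W₁ : ℝ := (|A| * (|A| * 2) + |A| * (|A| * 2 + |A| * (2 * |A|))) / (c * (3 / 10)) ^ 2
  refine ⟨2 * W₀ + W₁ * |l|, by positivity, fun Γ a a' φ R haa hl hR hφ => ?_⟩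
  have hA : 0 ≤ A := (abs_nonneg _).trans (Γ.k_le 0)
  set D : ℝ → ℝ := fun t => Γ.v t * phase φ (Γ.T₀ t) (Γ.T₁ t) with hD
  set D' : ℝ → ℝ := fun t => Γ.v' t * phase φ (Γ.T₀ t) (Γ.T₁ t) +
    Γ.v t * phase φ (-(Γ.k t * Γ.T₁ t)) (Γ.k t * Γ.T₀ t) with hD'
  have hDlow : ∀ t ∈ Icc a a', c * (3 / 10) ≤ |D t| := fun t ht => by
    simp only [hD, abs_mul]
    have hv := Γ.v_ge t
    rw [abs_of_pos (hc.trans_le hv)]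
    exact mul_le_mul hv (hφ t ht) (by norm_num) (hc.le.trans hv)
  have hDne : ∀ t ∈ Icc a a', D t ≠ 0 := fun t ht => by
    have := hDlow t ht
    intro h; rw [h, abs_zero] at this
    have : 0 < c * (3 / 10) := by positivity
    linarith
  have hph : ∀ t, |phase φ (Γ.T₀ t) (Γ.T₁ t)| ≤ 2 := fun t => by
    simpa using abs_phase_le φ (Γ.abs_T₀_le t) (Γ.abs_T₁_le t)
  have hv_abs : ∀ t, |Γ.v t| ≤ |A| := fun t => by
    rw [abs_of_nonneg hA, abs_of_pos (hc.trans_le (Γ.v_ge t))]; exact Γ.v_le t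
  have hDup : ∀ t, |D t| ≤ |A| * 2 := fun t => by
    simp only [hD, abs_mul]
    exact mul_le_mul (hv_abs t) (hph t) (abs_nonneg _) (abs_nonneg _)
  have hD'up : ∀ t, |D' t| ≤ |A| * 2 + |A| * (2 * |A|) := fun t => by
    have h1 : |-(Γ.k t * Γ.T₁ t)| ≤ |A| := by
      rw [abs_neg, abs_mul, abs_of_nonneg hA]
      exact (mul_le_mul (Γ.k_le t) (Γ.abs_T₁_le t) (abs_nonneg _) hA).trans_eq (mul_one _)
    have h2 : |Γ.k t * Γ.T₀ t| ≤ |A| := by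
      rw [abs_mul, abs_of_nonneg hA]
      exact (mul_le_mul (Γ.k_le t) (Γ.abs_T₀_le t) (abs_nonneg _) hA).trans_eq (mul_one _)
    have h3 := abs_phase_le φ h1 h2
    have h4 := (Γ.v'_le t).trans (le_abs_self A)
    refine (abs_add_le _ _).trans ?_
    rw [abs_mul, abs_mul]
    exact add_le_add (mul_le_mul h4 (hph t) (abs_nonneg _) (abs_nonneg _))
      (mul_le_mul (hv_abs t) h3 (abs_nonneg _) (abs_nonneg _))
  have hphd : ∀ t, HasDerivAt (fun s => phase φ (Γ.T₀ s) (Γ.T₁ s))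
      (phase φ (-(Γ.k t * Γ.T₁ t)) (Γ.k t * Γ.T₀ t)) t := fun t =>
    ((Γ.hT₀ t).const_mul _).add ((Γ.hT₁ t).const_mul _)
  have hDd : ∀ t, HasDerivAt D (D' t) t := fun t => (Γ.hv t).mul (hphd t)
  have hpd : ∀ t, HasDerivAt (fun s => R * phase φ (Γ.X s) (Γ.Y s)) (R * D t) t := fun t => by
    have h := (((Γ.hX t).const_mul (Real.cos φ)).add ((Γ.hY t).const_mul (Real.sin φ))).const_mul R
    have e : R * (Real.cos φ * (Γ.v t * Γ.T₀ t) + Real.sin φ * (Γ.v t * Γ.T₁ t)) = R * D t := by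
      simp only [hD, phase]; ring
    rw [e] at h
    exact h
  set w : ℝ → ℝ := fun t => Γ.b t / D t with hw
  set w' : ℝ → ℝ := fun t => (Γ.b' t * D t - Γ.b t * D' t) / D t ^ 2 with hw'
  have hwd : ∀ t ∈ Icc a a', HasDerivAt (fun t => (w t : ℂ)) (w' t : ℂ) t := fun t ht =>
    ((Γ.hb t).div (hDd t) (hDne t ht)).ofReal_comp
  have hcD : Continuous D := continuous_iff_continuousAt.2 fun t => (hDd t).continuousAt
  have hcD' : Continuous D' := by
    have := Γ.v'_cont; have := Γ.k_cont; have := Γ.continuous_T₀; have := Γ.continuous_T₁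
    have := Γ.continuous_v
    simp only [hD', phase]; fun_prop
  have hcw' : ContinuousOn w' (Icc a a') := by
    have := Γ.b'_cont; have := Γ.continuous_b
    refine ContinuousOn.div (by fun_prop) (by fun_prop) fun t ht => pow_ne_zero 2 (hDne t ht)
  have hosc : Continuous fun s => osc (R * phase φ (Γ.X s) (Γ.Y s)) :=
    continuous_iff_continuousAt.2 fun t => (HasDerivAt.osc (hpd t)).continuousAt
  have key := intervalIntegral.integral_mul_deriv_eq_deriv_mul (a := a) (b := a')
    (u := fun t => (w t : ℂ)) (u' := fun t => (w' t : ℂ))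
    (v := fun s => osc (R * phase φ (Γ.X s) (Γ.Y s)))
    (v' := fun t => -(Complex.I * ((R * D t : ℝ) : ℂ)) * osc (R * phase φ (Γ.X t) (Γ.Y t)))
    (fun t ht => hwd t (by rwa [uIcc_of_le haa] at ht))
    (fun t _ => HasDerivAt.osc (hpd t))
    (by
      apply ContinuousOn.intervalIntegrable
      rw [uIcc_of_le haa]
      exact Complex.continuous_ofReal.comp_continuousOn hcw')
    (by apply Continuous.intervalIntegrable; fun_prop)
  have e1 : ∫ t in a..a', (w t : ℂ) * (-(Complex.I * ((R * D t : ℝ) : ℂ)) *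
      osc (R * phase φ (Γ.X t) (Γ.Y t))) = (-(Complex.I * R)) * Γ.integral R a a' φ := by
    unfold integral
    rw [← intervalIntegral.integral_const_mul]
    apply intervalIntegral.integral_congr
    intro t ht
    rw [uIcc_of_le haa] at ht
    have hne : (D t : ℂ) ≠ 0 := by exact_mod_cast hDne t ht
    simp only [hw]
    push_cast
    field_simp
  rw [e1] at key
  have hnorm : R * ‖Γ.integral R a a' φ‖ = ‖-(Complex.I * R) * Γ.integral R a a' φ‖ := by
    rw [norm_mul, norm_neg, norm_mul, Complex.norm_I, one_mul, Complex.norm_real,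
      Real.norm_eq_abs, abs_of_pos hR]
  rw [le_div_iff₀' hR, hnorm, key]
  have hW₀ : ∀ t ∈ Icc a a', |w t| ≤ W₀ := fun t ht => by
    simp only [hw, abs_div, W₀]
    have := hDlow t ht
    have := (Γ.b_le t).trans (le_abs_self A)
    gcongr
  have hW₁ : ∀ t ∈ Icc a a', |w' t| ≤ W₁ := fun t ht => by
    simp only [hw', abs_div, W₁, abs_pow]
    have h1 := hDlow t ht
    have h2 := (Γ.b_le t).trans (le_abs_self A)
    have h3 := (Γ.b'_le t).trans (le_abs_self A)
    have h4 : |Γ.b' t * D t - Γ.b t * D' t| ≤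
        |A| * (|A| * 2) + |A| * (|A| * 2 + |A| * (2 * |A|)) := by
      refine (abs_sub _ _).trans ?_
      rw [abs_mul (Γ.b' t), abs_mul (Γ.b t)]
      exact add_le_add (mul_le_mul h3 (hDup t) (abs_nonneg _) (abs_nonneg _))
        (mul_le_mul h2 (hD'up t) (abs_nonneg _) (abs_nonneg _))
    gcongr
  have hi : ‖∫ t in a..a', (w' t : ℂ) * osc (R * phase φ (Γ.X t) (Γ.Y t))‖ ≤ W₁ * |l| := by
    refine (intervalIntegral.norm_integral_le_of_norm_le_const (C := W₁) fun t ht => ?_).trans ?_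
    · rw [uIoc_of_le haa] at ht
      simpa using hW₁ t (Ioc_subset_Icc_self ht)
    · have : |a' - a| ≤ |l| := by
        rw [abs_of_nonneg (sub_nonneg.2 haa)]; exact hl.trans (le_abs_self l)
      gcongr
  have h1 : ‖(w a' : ℂ) * osc (R * phase φ (Γ.X a') (Γ.Y a'))‖ ≤ W₀ := by
    simpa using hW₀ a' (right_mem_Icc.2 haa)
  have h2 : ‖(w a : ℂ) * osc (R * phase φ (Γ.X a) (Γ.Y a))‖ ≤ W₀ := by
    simpa using hW₀ a (left_mem_Icc.2 haa)
  refine (norm_sub_le _ _).trans ?_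
  refine (add_le_add (norm_sub_le _ _) le_rfl).trans ?_
  linarith

end Arc
-- Mean square over directions: short arcs by the kernel method, then the whole curve
namespace Arc

/-- If the tangent hardly turns, the chord from `s` to `t` is the length `m ≥ c |t - s|` of the arc
times the initial tangent, up to `m / 100`. The cap is centred at the normal directions, so the
frequency `R (γ t - γ s)` is of the kind covered by `exists_bound_cap_kernel`. -/
theorem exists_bound_kernel {c : ℝ} (hc : 0 < c) (A : ℝ) :
    ∃ C, 0 ≤ C ∧ ∀ (Γ : Arc c A) (a a' R : ℝ), 0 < R →
      (∀ t ∈ Icc a a', |Γ.T₀ t - Γ.T₀ a| ≤ 1 / 100 ∧ |Γ.T₁ t - Γ.T₁ a| ≤ 1 / 100) →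
      ∀ t ∈ Icc a a', ∀ s ∈ Icc a a',
      ‖∫ φ in (0)..(2 * Real.pi), (cutoff (phase φ (Γ.T₀ a) (Γ.T₁ a)) : ℂ) *
        osc (R * phase φ (Γ.X t - Γ.X s) (Γ.Y t - Γ.Y s))‖ ≤
        C * (1 + (R * (c / 2) * (t - s)) ^ 2)⁻¹ := by
  obtain ⟨C, hC0, hC⟩ := exists_bound_cap_kernel
  refine ⟨C, hC0, fun Γ a a' R hR hT => ?_⟩
  have main : ∀ t ∈ Icc a a', ∀ s ∈ Icc a a', s ≤ t →
      ‖∫ φ in (0)..(2 * Real.pi), (cutoff (phase φ (Γ.T₀ a) (Γ.T₁ a)) : ℂ) *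
        osc (R * phase φ (Γ.X t - Γ.X s) (Γ.Y t - Γ.Y s))‖ ≤
        C * (1 + (R * (c / 2) * (t - s)) ^ 2)⁻¹ := by
    intro t ht s hs hst
    have cv := Γ.continuous_v
    have c0 := Γ.continuous_T₀
    have c1 := Γ.continuous_T₁
    set m : ℝ := ∫ u in s..t, Γ.v u with hm
    have hmlow : c * (t - s) ≤ m := by
      have := intervalIntegral.integral_mono_on (μ := volume) hst (f := fun _ => c)
        (g := Γ.v) (continuous_const.intervalIntegrable _ _) (cv.intervalIntegrable _ _) (fun u _ => Γ.v_ge u)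
      simpa [mul_comm] using this
    have hm0 : 0 ≤ m := (mul_nonneg hc.le (sub_nonneg.2 hst)).trans hmlow
    have diff : ∀ (Z T : ℝ → ℝ), Continuous T → (∀ u, HasDerivAt Z (Γ.v u * T u) u) →
        (∀ u ∈ Icc a a', |T u - T a| ≤ 1 / 100) → |Z t - Z s - m * T a| ≤ m / 100 := by
      intro Z T hTc hZ hTa
      have e1 : Z t - Z s = ∫ u in s..t, Γ.v u * T u :=
        (intervalIntegral.integral_eq_sub_of_hasDerivAt (fun u _ => hZ u)
          ((cv.mul hTc).intervalIntegrable _ _)).symm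
      have e2 : Z t - Z s - m * T a = ∫ u in s..t, Γ.v u * (T u - T a) := by
        rw [e1, hm, ← intervalIntegral.integral_mul_const, ← intervalIntegral.integral_sub]
        · congr 1; funext u; ring
        · exact (cv.mul hTc).intervalIntegrable _ _
        · exact (cv.mul continuous_const).intervalIntegrable _ _
      rw [e2, ← Real.norm_eq_abs]
      calc _ ≤ ∫ u in s..t, Γ.v u * (1 / 100) := by
            refine intervalIntegral.norm_integral_le_of_norm_le hst
              (Eventually.of_forall fun u hu => ?_) ((cv.mul continuous_const).intervalIntegrable _ _)
            rw [norm_mul, Real.norm_eq_abs, Real.norm_eq_abs,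
              abs_of_pos (hc.trans_le (Γ.v_ge u))]
            have := hTa u ⟨hs.1.trans hu.1.le, hu.2.trans ht.2⟩
            have := (hc.trans_le (Γ.v_ge u)).le
            gcongr
        _ = m / 100 := by rw [intervalIntegral.integral_mul_const, hm]; ring
    have h := hC (Γ.T₀ a) (Γ.T₁ a) m (Γ.X t - Γ.X s) (Γ.Y t - Γ.Y s) R (Γ.unit a) hm0
      (diff Γ.X Γ.T₀ c0 Γ.hX fun u hu => (hT u hu).1)
      (diff Γ.Y Γ.T₁ c1 Γ.hY fun u hu => (hT u hu).2) hR.le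
    rw [← div_eq_mul_inv, le_div_iff₀' (by positivity)]
    refine le_trans ?_ h
    gcongr 1
    have h1 : 0 ≤ R * (c / 2) * (t - s) := by
      have := sub_nonneg.2 hst
      positivity
    have h2 : R * (c / 2) * (t - s) ≤ R * (m / 2) := by nlinarith
    gcongr
  intro t ht s hs
  rcases le_total s t with hst | hts
  · exact main t ht s hs hst
  -- Exchanging `s` and `t` conjugates the integral, which leaves its norm unchanged.
  · have h := main s hs t ht hts
    have e : (R * (c / 2) * (t - s)) ^ 2 = (R * (c / 2) * (s - t)) ^ 2 := by ring
    rw [e]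
    refine le_trans (le_of_eq ?_) h
    rw [← Complex.norm_conj, intervalIntegral.intervalIntegral_eq_integral_uIoc,
      intervalIntegral.intervalIntegral_eq_integral_uIoc]
    simp only [if_pos Real.two_pi_pos.le, one_smul]
    rw [← integral_conj]
    congr 2
    funext φ
    rw [map_mul, Complex.conj_ofReal, conj_osc]
    congr 2
    simp only [phase]; ring

/-- The `T T*` step: the square is written as a double integral along the arc and the direction is
integrated first, which is where the oscillation can be exploited without any information on the
curvature. -/
theorem integral_cutoff_eq {c A : ℝ} (Γ : Arc c A) (a a' R : ℝ) :
    ((∫ φ in (0)..(2 * Real.pi), cutoff (phase φ (Γ.T₀ a) (Γ.T₁ a)) *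
        ‖Γ.integral R a a' φ‖ ^ 2 : ℝ) : ℂ) =
      ∫ t in a..a', ∫ s in a..a', (Γ.b t : ℂ) * (Γ.b s : ℂ) *
        ∫ φ in (0)..(2 * Real.pi), (cutoff (phase φ (Γ.T₀ a) (Γ.T₁ a)) : ℂ) *
          osc (R * phase φ (Γ.X t - Γ.X s) (Γ.Y t - Γ.Y s)) := by
  have cX := Γ.continuous_X
  have cY := Γ.continuous_Y
  have cb := Γ.continuous_b
  have co := continuous_osc
  have cG := Γ.continuous_integral R a a'
  have cc : Continuous fun φ => cutoff (phase φ (Γ.T₀ a) (Γ.T₁ a)) :=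
    continuous_cutoff.comp (by unfold phase; fun_prop)
  have conjG : ∀ φ, (starRingEnd ℂ) (Γ.integral R a a' φ) =
      ∫ s in a..a', (Γ.b s : ℂ) * osc (-(R * phase φ (Γ.X s) (Γ.Y s))) := by
    intro φ
    unfold integral
    rw [intervalIntegral.intervalIntegral_eq_integral_uIoc,
      intervalIntegral.intervalIntegral_eq_integral_uIoc, Complex.real_smul, map_mul,
      Complex.conj_ofReal, ← integral_conj, Complex.real_smul]
    simp only [map_mul, Complex.conj_ofReal, conj_osc]
  rw [← intervalIntegral.integral_ofReal]
  calc ∫ φ in (0)..(2 * Real.pi), ((cutoff (phase φ (Γ.T₀ a) (Γ.T₁ a)) *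
        ‖Γ.integral R a a' φ‖ ^ 2 : ℝ) : ℂ)
      = ∫ φ in (0)..(2 * Real.pi), ∫ t in a..a', (cutoff (phase φ (Γ.T₀ a) (Γ.T₁ a)) : ℂ) *
          (starRingEnd ℂ) (Γ.integral R a a' φ) *
            ((Γ.b t : ℂ) * osc (R * phase φ (Γ.X t) (Γ.Y t))) := by
        congr 1
        funext φ
        rw [intervalIntegral.integral_const_mul]
        push_cast
        rw [← Complex.conj_mul' (Γ.integral R a a' φ)]
        rw [mul_assoc]
        rfl
    _ = ∫ t in a..a', ∫ φ in (0)..(2 * Real.pi), (cutoff (phase φ (Γ.T₀ a) (Γ.T₁ a)) : ℂ) *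
          (starRingEnd ℂ) (Γ.integral R a a' φ) *
            ((Γ.b t : ℂ) * osc (R * phase φ (Γ.X t) (Γ.Y t))) := by
        apply integral_integral_swap_of_continuous
        have := Γ.continuous_integrand R
        have h2 : Continuous fun φ => (starRingEnd ℂ) (Γ.integral R a a' φ) :=
          Complex.continuous_conj.comp cG
        exact ((Complex.continuous_ofReal.comp (cc.comp continuous_fst)).mul
          (h2.comp continuous_fst)).mul this
    _ = ∫ t in a..a', ∫ φ in (0)..(2 * Real.pi), ∫ s in a..a', (Γ.b t : ℂ) * (Γ.b s : ℂ) *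
          ((cutoff (phase φ (Γ.T₀ a) (Γ.T₁ a)) : ℂ) *
          osc (R * phase φ (Γ.X t - Γ.X s) (Γ.Y t - Γ.Y s))) := by
        congr 1; funext t; congr 1; funext φ
        rw [conjG, mul_right_comm, ← intervalIntegral.integral_const_mul]
        congr 1; funext s
        have e : R * phase φ (Γ.X t - Γ.X s) (Γ.Y t - Γ.Y s) =
            R * phase φ (Γ.X t) (Γ.Y t) + -(R * phase φ (Γ.X s) (Γ.Y s)) := by
          simp only [phase]; ring
        rw [e, osc_add]; ring
    _ = _ := by
        congr 1; funext t
        rw [integral_integral_swap_of_continuous]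
        · congr 1; funext s
          rw [intervalIntegral.integral_const_mul]
        · have : Continuous fun p : ℝ × ℝ => cutoff (phase p.1 (Γ.T₀ a) (Γ.T₁ a)) :=
            cc.comp continuous_fst
          unfold Function.uncurry
          simp only [phase] at this ⊢
          fun_prop

/-- Directions are split by the cutoff: near the normals of the arc the kernel bound applies,
integrated in one variable; elsewhere the pointwise `O(1/R)` squares to `O(1/R²)`, more than enough
for `R ≥ 1`. -/
theorem exists_bound_short {c : ℝ} (hc : 0 < c) (A l : ℝ) :
    ∃ C, 0 ≤ C ∧ ∀ (Γ : Arc c A) (a a' R : ℝ), a ≤ a' → a' - a ≤ l → 1 ≤ R →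
      (∀ t ∈ Icc a a', |Γ.T₀ t - Γ.T₀ a| ≤ 1 / 100 ∧ |Γ.T₁ t - Γ.T₁ a| ≤ 1 / 100) →
      ∫ φ in (0)..(2 * Real.pi), ‖Γ.integral R a a' φ‖ ^ 2 ≤ C / R := by
  obtain ⟨C₁, hC₁, h₁⟩ := exists_bound_nonstationary hc A l
  obtain ⟨C₂, hC₂, h₂⟩ := exists_bound_kernel hc A
  refine ⟨2 * Real.pi * C₁ ^ 2 + A ^ 2 * C₂ * (2 * Real.pi / c) * |l|, by positivity,
    fun Γ a a' R haa hl hR hT => ?_⟩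
  have hR0 : 0 < R := by linarith
  have cG := Γ.continuous_integral R a a'
  have cc : Continuous fun φ => cutoff (phase φ (Γ.T₀ a) (Γ.T₁ a)) :=
    continuous_cutoff.comp (by unfold phase; fun_prop)
  have cap : ∫ φ in (0)..(2 * Real.pi), cutoff (phase φ (Γ.T₀ a) (Γ.T₁ a)) *
        ‖Γ.integral R a a' φ‖ ^ 2 ≤ A ^ 2 * C₂ * (2 * Real.pi / c) * |l| / R := by
    refine (le_abs_self _).trans ?_
    rw [← Real.norm_eq_abs, ← Complex.norm_real, integral_cutoff_eq]
    have inner : ∀ t ∈ uIoc a a', ‖∫ s in a..a', (Γ.b t : ℂ) * (Γ.b s : ℂ) *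
        ∫ φ in (0)..(2 * Real.pi), (cutoff (phase φ (Γ.T₀ a) (Γ.T₁ a)) : ℂ) *
          osc (R * phase φ (Γ.X t - Γ.X s) (Γ.Y t - Γ.Y s))‖ ≤
        A ^ 2 * C₂ * (Real.pi / (R * (c / 2))) := by
      intro t ht
      rw [uIoc_of_le haa] at ht
      calc _ ≤ ∫ s in a..a', A ^ 2 * C₂ * (1 + (R * (c / 2) * (t - s)) ^ 2)⁻¹ := by
            refine intervalIntegral.norm_integral_le_of_norm_le haa
              (Eventually.of_forall fun s hs => ?_) ?_
            · have hk := h₂ Γ a a' R hR0 hT t (Ioc_subset_Icc_self ht) s (Ioc_subset_Icc_self hs)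
              have hbt := Γ.b_le t
              have hbs := Γ.b_le s
              have hA : 0 ≤ A := (abs_nonneg _).trans hbt
              rw [norm_mul, norm_mul, Complex.norm_real, Complex.norm_real, mul_assoc (A ^ 2), sq]
              simp only [Real.norm_eq_abs]
              gcongr
            · apply Continuous.intervalIntegrable
              have : ∀ s, 1 + (R * (c / 2) * (t - s)) ^ 2 ≠ 0 := fun s => by positivity
              fun_prop (disch := assumption)
        _ ≤ _ := by
            rw [intervalIntegral.integral_const_mul]
            have := integral_inv_one_add_sq_le (l := R * (c / 2)) (by positivity) t a a'
            gcongr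
    refine (intervalIntegral.norm_integral_le_of_norm_le_const inner).trans ?_
    have : |a' - a| ≤ |l| := by
      rw [abs_of_nonneg (sub_nonneg.2 haa)]; exact hl.trans (le_abs_self l)
    calc _ ≤ A ^ 2 * C₂ * (Real.pi / (R * (c / 2))) * |l| := by gcongr
      _ = _ := by field_simp
  have pt : ∀ φ, ‖Γ.integral R a a' φ‖ ^ 2 ≤ cutoff (phase φ (Γ.T₀ a) (Γ.T₁ a)) *
        ‖Γ.integral R a a' φ‖ ^ 2 + C₁ ^ 2 / R := by
    intro φ
    -- If the tangential component exceeds `1/2` at the start of the arc, it stays above `1/2 -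
    -- 2/100 ≥ 3/10` along it.
    by_cases hφ : |phase φ (Γ.T₀ a) (Γ.T₁ a)| ≤ 1 / 2
    · rw [cutoff_eq_one hφ, one_mul]
      have : 0 ≤ C₁ ^ 2 / R := by positivity
      linarith
    · push Not at hφ
      have h := h₁ Γ a a' φ R haa hl hR0 fun t ht => by
        have h3 := abs_phase_le φ (hT t ht).1 (hT t ht).2
        have e : phase φ (Γ.T₀ t - Γ.T₀ a) (Γ.T₁ t - Γ.T₁ a) =
          phase φ (Γ.T₀ t) (Γ.T₁ t) - phase φ (Γ.T₀ a) (Γ.T₁ a) := by simp only [phase]; ring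
        rw [e] at h3
        have := abs_sub_abs_le_abs_sub (phase φ (Γ.T₀ a) (Γ.T₁ a)) (phase φ (Γ.T₀ t) (Γ.T₁ t))
        rw [abs_sub_comm] at this
        linarith
      have h5 : ‖Γ.integral R a a' φ‖ ^ 2 ≤ C₁ ^ 2 / R := by
        calc _ ≤ (C₁ / R) ^ 2 := by gcongr
          _ = C₁ ^ 2 / R / R := by rw [div_pow, sq R, div_div]
          _ ≤ C₁ ^ 2 / R := div_le_self (by positivity) hR
      have : 0 ≤ cutoff (phase φ (Γ.T₀ a) (Γ.T₁ a)) * ‖Γ.integral R a a' φ‖ ^ 2 :=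
        mul_nonneg cutoff.nonneg (by positivity)
      linarith
  calc _ ≤ ∫ φ in (0)..(2 * Real.pi), (cutoff (phase φ (Γ.T₀ a) (Γ.T₁ a)) *
        ‖Γ.integral R a a' φ‖ ^ 2 + C₁ ^ 2 / R) := by
        refine intervalIntegral.integral_mono_on Real.two_pi_pos.le
          (by apply Continuous.intervalIntegrable; fun_prop)
          (by apply Continuous.intervalIntegrable; fun_prop) fun φ _ => pt φ
    _ ≤ A ^ 2 * C₂ * (2 * Real.pi / c) * |l| / R + 2 * Real.pi * (C₁ ^ 2 / R) := by
        rw [intervalIntegral.integral_add (by apply Continuous.intervalIntegrable; fun_prop)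
          (by simp)]
        refine add_le_add cap (le_of_eq ?_)
        rw [intervalIntegral.integral_const, smul_eq_mul, sub_zero]
    _ = _ := by ring

/-- The circular mean square of an oscillatory integral along a curve is `O(1 / R)`, whatever the
curvature. -/
theorem exists_bound {c : ℝ} (hc : 0 < c) (A : ℝ) {L : ℝ} (hL : 0 ≤ L) :
    ∃ C, 0 ≤ C ∧ ∀ (Γ : Arc c A) (R : ℝ), 1 ≤ R →
      ∫ φ in (0)..(2 * Real.pi), ‖Γ.integral R 0 L φ‖ ^ 2 ≤ C / R := by
  -- With this many pieces the tangent, which turns at rate at most `|A|`, varies by at most `1/100`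
  -- on each. The number depends only on `A` and `L`, so the constant is uniform over arcs.
  obtain ⟨N, hN⟩ := exists_nat_gt (100 * (|A| * L))
  have hN0 : (0 : ℝ) < N := lt_of_le_of_lt (by positivity) hN
  obtain ⟨C, hC0, hC⟩ := exists_bound_short hc A (L / N)
  refine ⟨N * (N * C), by positivity, fun Γ R hR => ?_⟩
  set p : ℕ → ℝ := fun j => j * (L / N) with hp
  have hstep : ∀ j, p (j + 1) - p j = L / N := fun j => by simp only [hp]; push_cast; ring
  have hLN : 0 ≤ L / N := by positivity
  have hint : ∀ φ, Γ.integral R 0 L φ = ∑ j ∈ Finset.range N, Γ.integral R (p j) (p (j + 1)) φ := by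
    intro φ
    unfold integral
    rw [intervalIntegral.sum_integral_adjacent_intervals]
    · congr 1
      · simp [hp]
      · simp only [hp]; field_simp
    · intro j _
      exact Continuous.intervalIntegrable
        ((Γ.continuous_integrand R).comp (Continuous.prodMk_right φ)) _ _
  have hlip : ∀ (T T' : ℝ → ℝ), (∀ t, HasDerivAt T (T' t) t) → (∀ t, |T' t| ≤ |A|) → ∀ j,
      ∀ t ∈ Icc (p j) (p (j + 1)), |T t - T (p j)| ≤ 1 / 100 := by
    intro T T' hT hT' j t ht
    have h := (convex_univ (𝕜 := ℝ) (E := ℝ)).norm_image_sub_le_of_norm_hasDerivWithin_le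
      (f := T) (f' := T') (C := |A|) (fun x _ => (hT x).hasDerivWithinAt) (fun x _ => hT' x)
      (mem_univ (p j)) (mem_univ t)
    rw [Real.norm_eq_abs, Real.norm_eq_abs, abs_of_nonneg (sub_nonneg.2 ht.1)] at h
    have h2 : t - p j ≤ L / N := by rw [← hstep j]; linarith [ht.2]
    calc _ ≤ |A| * (t - p j) := h
      _ ≤ |A| * (L / N) := by gcongr
      _ ≤ 1 / 100 := by
        rw [← mul_div_assoc, div_le_iff₀ hN0]; linarith
  have hk : ∀ t, |Γ.k t| ≤ |A| := fun t => (Γ.k_le t).trans (le_abs_self A)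
  have hb : ∀ j, ∫ φ in (0)..(2 * Real.pi), ‖Γ.integral R (p j) (p (j + 1)) φ‖ ^ 2 ≤ C / R := by
    intro j
    refine hC Γ _ _ R (by linarith [hstep j]) (hstep j).le hR fun t ht => ⟨?_, ?_⟩
    · refine hlip Γ.T₀ _ Γ.hT₀ (fun t => ?_) j t ht
      rw [abs_neg, abs_mul]
      exact (mul_le_mul (hk t) (Γ.abs_T₁_le t) (abs_nonneg _) (abs_nonneg _)).trans_eq (mul_one _)
    · refine hlip Γ.T₁ _ Γ.hT₁ (fun t => ?_) j t ht
      rw [abs_mul]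
      exact (mul_le_mul (hk t) (Γ.abs_T₀_le t) (abs_nonneg _) (abs_nonneg _)).trans_eq (mul_one _)
  have cG : ∀ j, Continuous (Γ.integral R (p j) (p (j + 1))) := fun j => Γ.continuous_integral R _ _
  calc _ ≤ ∫ φ in (0)..(2 * Real.pi), N * ∑ j ∈ Finset.range N,
        ‖Γ.integral R (p j) (p (j + 1)) φ‖ ^ 2 := by
        refine intervalIntegral.integral_mono_on Real.two_pi_pos.le
          (((Γ.continuous_integral R 0 L).norm.pow 2).intervalIntegrable _ _)
          (by
            apply Continuous.intervalIntegrable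
            exact continuous_const.mul (continuous_finsetSum _ fun j _ => (cG j).norm.pow 2))
          fun φ _ => ?_
        rw [hint]
        calc _ ≤ (∑ j ∈ Finset.range N, ‖Γ.integral R (p j) (p (j + 1)) φ‖) ^ 2 := by
              gcongr; exact norm_sum_le _ _
          _ ≤ _ := by
              have := sq_sum_le_card_mul_sum_sq (s := Finset.range N)
                (f := fun j => ‖Γ.integral R (p j) (p (j + 1)) φ‖)
              rwa [Finset.card_range] at this
    _ = N * ∑ j ∈ Finset.range N, ∫ φ in (0)..(2 * Real.pi),
        ‖Γ.integral R (p j) (p (j + 1)) φ‖ ^ 2 := by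
        rw [intervalIntegral.integral_const_mul, intervalIntegral.integral_finsetSum]
        exact fun j _ => ((cG j).norm.pow 2).intervalIntegrable _ _
    _ ≤ N * ∑ j ∈ Finset.range N, C / R := by
        gcongr with j _
        exact hb j
    _ = _ := by rw [Finset.sum_const, Finset.card_range, nsmul_eq_mul]; ring

end Arc

/-! ### Parametric integrals -/

theorem hasDerivAt_integral_of_continuous {F F' : ℝ → ℝ → ℂ}
    (hF : Continuous (Function.uncurry F)) (hF' : Continuous (Function.uncurry F'))
    (hd : ∀ s t, HasDerivAt (fun x => F x t) (F' s t) s) (a b s₀ : ℝ) :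
    HasDerivAt (fun s => ∫ t in a..b, F s t) (∫ t in a..b, F' s₀ t) s₀ := by
  obtain ⟨C, hC⟩ := ((isCompact_closedBall s₀ 1).prod (isCompact_uIcc (a := a) (b := b))
    ).exists_bound_of_continuousOn hF'.continuousOn
  refine (intervalIntegral.hasDerivAt_integral_of_dominated_loc_of_deriv_le
    (s := Metric.closedBall s₀ 1) (bound := fun _ => C) (μ := volume) (F := F) (F' := F')
    (Metric.closedBall_mem_nhds s₀ one_pos) (Eventually.of_forall fun s => ?_) ?_ ?_ ?_ ?_ ?_).2
  · exact (hF.comp (Continuous.prodMk_right s)).aestronglyMeasurable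
  · exact (hF.comp (Continuous.prodMk_right s₀)).intervalIntegrable _ _
  · exact (hF'.comp (Continuous.prodMk_right s₀)).aestronglyMeasurable
  · exact Eventually.of_forall fun t ht s hs => hC (s, t) ⟨hs, uIoc_subset_uIcc ht⟩
  · exact continuous_const.intervalIntegrable _ _
  · exact Eventually.of_forall fun t _ s _ => hd s t

/-- Cauchy–Schwarz, obtained from nonnegativity of the variance of `‖F‖`. -/
theorem sq_norm_integral_le {F : ℝ → ℂ} (hF : Continuous F) {a b : ℝ} (hab : a ≤ b) :
    ‖∫ x in a..b, F x‖ ^ 2 ≤ (b - a) * ∫ x in a..b, ‖F x‖ ^ 2 := by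
  rcases hab.eq_or_lt with rfl | hlt
  · simp
  set m : ℝ := ∫ x in a..b, ‖F x‖
  have h1 : ‖∫ x in a..b, F x‖ ≤ m := intervalIntegral.norm_integral_le_integral_norm hab
  have h2 : 0 ≤ ∫ x in a..b, (‖F x‖ - m / (b - a)) ^ 2 :=
    intervalIntegral.integral_nonneg hab fun _ _ => sq_nonneg _
  have hl : 0 < b - a := sub_pos.2 hlt
  have e : ∫ x in a..b, (‖F x‖ - m / (b - a)) ^ 2 = (∫ x in a..b, ‖F x‖ ^ 2) - m ^ 2 / (b - a) := by
    have : (fun x => (‖F x‖ - m / (b - a)) ^ 2) = fun x =>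
        ‖F x‖ ^ 2 - (2 * (m / (b - a)) * ‖F x‖ - (m / (b - a)) ^ 2) := by funext x; ring
    rw [this, intervalIntegral.integral_sub, intervalIntegral.integral_sub,
      intervalIntegral.integral_const_mul, intervalIntegral.integral_const, smul_eq_mul]
    · change _ - (2 * (m / (b - a)) * m - _) = _
      field_simp; ring
    all_goals apply Continuous.intervalIntegrable; fun_prop
  rw [e] at h2
  have h3 : m ^ 2 ≤ (b - a) * ∫ x in a..b, ‖F x‖ ^ 2 := by
    rw [sub_nonneg, div_le_iff₀' hl] at h2; exact h2
  exact (by gcongr : ‖∫ x in a..b, F x‖ ^ 2 ≤ m ^ 2).trans h3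

/-! ### Smooth amplitudes on the tube -/

/-- Smooth functions on the plane of tube coordinates, periodic in the first variable. -/
structure IsAmplitude (L : ℝ) (a : ℝ × ℝ → ℝ) : Prop where
  smooth : ContDiff ℝ ∞ a
  periodic : ∀ t s, a (t + L, s) = a (t, s)

/-- The derivative in the first variable. -/
def dFst (a : ℝ × ℝ → ℝ) (z : ℝ × ℝ) : ℝ := fderiv ℝ a z (1, 0)

/-- The derivative in the second variable. -/
def dSnd (a : ℝ × ℝ → ℝ) (z : ℝ × ℝ) : ℝ := fderiv ℝ a z (0, 1)

namespace IsAmplitude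

variable {L : ℝ} {a b : ℝ × ℝ → ℝ}

theorem hasDerivAt_fst (ha : IsAmplitude L a) (t s : ℝ) :
    HasDerivAt (fun t => a (t, s)) (dFst a (t, s)) t :=
  ((ha.smooth.differentiable (by simp) (t, s)).hasFDerivAt).comp_hasDerivAt t
    ((hasDerivAt_id t).prodMk (hasDerivAt_const t s))

theorem hasDerivAt_snd (ha : IsAmplitude L a) (t s : ℝ) :
    HasDerivAt (fun s => a (t, s)) (dSnd a (t, s)) s :=
  ((ha.smooth.differentiable (by simp) (t, s)).hasFDerivAt).comp_hasDerivAt s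
    ((hasDerivAt_const s t).prodMk (hasDerivAt_id s))

theorem mul (ha : IsAmplitude L a) (hb : IsAmplitude L b) : IsAmplitude L fun z => a z * b z :=
  ⟨ha.smooth.mul hb.smooth, fun t s => by simp only [ha.periodic, hb.periodic]⟩

theorem add (ha : IsAmplitude L a) (hb : IsAmplitude L b) : IsAmplitude L fun z => a z + b z :=
  ⟨ha.smooth.add hb.smooth, fun t s => by simp only [ha.periodic, hb.periodic]⟩

theorem neg (ha : IsAmplitude L a) : IsAmplitude L fun z => -a z :=
  ⟨ha.smooth.neg, fun t s => by simp only [ha.periodic]⟩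

theorem of_fst {g : ℝ → ℝ} (hg : ContDiff ℝ ∞ g) (hp : Function.Periodic g L) :
    IsAmplitude L fun z => g z.1 :=
  ⟨hg.comp contDiff_fst, fun t _ => hp t⟩

theorem fderiv_periodic (ha : IsAmplitude L a) (t s : ℝ) :
    fderiv ℝ a (t + L, s) = fderiv ℝ a (t, s) := by
  have h : (fun z => a (z + (L, 0))) = a := by
    funext ⟨t, s⟩; simpa using ha.periodic t s
  have := fderiv_comp_add_right (𝕜 := ℝ) (f := a) (x := (t, s)) (L, 0)
  rw [h] at this
  simpa using this.symm

theorem dFst (ha : IsAmplitude L a) : IsAmplitude L (dFst a) :=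
  ⟨(ha.smooth.fderiv_right (m := ∞) (by simp)).clm_apply contDiff_const,
    fun t s => by simp only [ImplicitBoundary.dFst, ha.fderiv_periodic]⟩

theorem dSnd (ha : IsAmplitude L a) : IsAmplitude L (dSnd a) :=
  ⟨(ha.smooth.fderiv_right (m := ∞) (by simp)).clm_apply contDiff_const,
    fun t s => by simp only [ImplicitBoundary.dSnd, ha.fderiv_periodic]⟩

theorem exists_bound (hL : 0 < L) (ha : IsAmplitude L a) (r : ℝ) :
    ∃ C, 0 ≤ C ∧ ∀ t s, |s| ≤ r → |a (t, s)| ≤ C := by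
  obtain ⟨C, hC⟩ := ((isCompact_Icc (a := (0 : ℝ)) (b := L)).prod
    (isCompact_Icc (a := -r) (b := r))).exists_bound_of_continuousOn ha.smooth.continuous.continuousOn
  refine ⟨|C|, abs_nonneg _, fun t s hs => ?_⟩
  have hp : Function.Periodic (fun t => a (t, s)) L := fun t => ha.periodic t s
  obtain ⟨y, hy, hxy⟩ := hp.exists_mem_Ico₀ hL t
  rw [show a (t, s) = a (y, s) from hxy]
  exact (hC (y, s) ⟨Ico_subset_Icc_self hy, abs_le.1 hs⟩).trans (le_abs_self C)

end IsAmplitude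

/-! ### The moving frame -/

/-- A unit-speed closed plane curve `(X, Y)` with its tangent `(T₀, T₁)` and curvature `k`. -/
structure Frame (L : ℝ) where
  (X Y T₀ T₁ k : ℝ → ℝ)
  sX : ContDiff ℝ ∞ X
  sY : ContDiff ℝ ∞ Y
  sT₀ : ContDiff ℝ ∞ T₀
  sT₁ : ContDiff ℝ ∞ T₁
  sk : ContDiff ℝ ∞ k
  hX : ∀ t, HasDerivAt X (T₀ t) t
  hY : ∀ t, HasDerivAt Y (T₁ t) t
  hT₀ : ∀ t, HasDerivAt T₀ (-(k t * T₁ t)) t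
  hT₁ : ∀ t, HasDerivAt T₁ (k t * T₀ t) t
  unit : ∀ t, T₀ t ^ 2 + T₁ t ^ 2 = 1
  pX : Function.Periodic X L
  pY : Function.Periodic Y L
  pT₀ : Function.Periodic T₀ L
  pT₁ : Function.Periodic T₁ L
  pk : Function.Periodic k L

namespace Frame

variable {L : ℝ} (F : Frame L)

/-- The phase at the point of tube coordinates `(t, s)`. -/
def tubePhase (φ t s : ℝ) : ℝ := phase φ (F.X t + s * F.T₁ t) (F.Y t - s * F.T₀ t)

/-- The oscillatory integral along the parallel curve at signed distance `s`. -/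
def H (a : ℝ × ℝ → ℝ) (R φ s : ℝ) : ℂ :=
  ∫ t in (0)..L, (a (t, s) : ℂ) * osc (R * F.tubePhase φ t s)

theorem isAmplitude_T₀ : IsAmplitude L fun z => F.T₀ z.1 := .of_fst F.sT₀ F.pT₀
theorem isAmplitude_T₁ : IsAmplitude L fun z => F.T₁ z.1 := .of_fst F.sT₁ F.pT₁

theorem continuous_tubePhase : Continuous fun p : ℝ × ℝ × ℝ => F.tubePhase p.1 p.2.1 p.2.2 := by
  have := F.sX.continuous; have := F.sY.continuous
  have := F.sT₀.continuous; have := F.sT₁.continuous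
  unfold tubePhase phase
  fun_prop

theorem continuous_integrand {a : ℝ × ℝ → ℝ} (ha : Continuous a) (R : ℝ) :
    Continuous fun p : (ℝ × ℝ) × ℝ => (a (p.2, p.1.2) : ℂ) * osc (R * F.tubePhase p.1.1 p.2 p.1.2) := by
  have h := F.continuous_tubePhase.comp
    (f := fun p : (ℝ × ℝ) × ℝ => (p.1.1, p.2, p.1.2)) (by fun_prop)
  have := continuous_osc
  have h2 : Continuous fun p : (ℝ × ℝ) × ℝ => F.tubePhase p.1.1 p.2 p.1.2 := h
  fun_prop

theorem continuous_H {a : ℝ × ℝ → ℝ} (ha : Continuous a) (R : ℝ) :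
    Continuous fun p : ℝ × ℝ => F.H a R p.1 p.2 :=
  intervalIntegral.continuous_parametric_intervalIntegral_of_continuous'
    (F.continuous_integrand ha R) 0 L

theorem hasDerivAt_tubePhase_fst (φ t s : ℝ) : HasDerivAt (fun t => F.tubePhase φ t s)
    ((1 + s * F.k t) * phase φ (F.T₀ t) (F.T₁ t)) t := by
  have h := (((F.hX t).add ((F.hT₁ t).const_mul s)).const_mul (Real.cos φ)).add
    (((F.hY t).sub ((F.hT₀ t).const_mul s)).const_mul (Real.sin φ))
  have e : Real.cos φ * (F.T₀ t + s * (F.k t * F.T₀ t)) +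
      Real.sin φ * (F.T₁ t - s * -(F.k t * F.T₁ t)) =
      (1 + s * F.k t) * phase φ (F.T₀ t) (F.T₁ t) := by simp only [phase]; ring
  rw [e] at h
  exact h

theorem hasDerivAt_tubePhase_snd (φ t s : ℝ) : HasDerivAt (fun s => F.tubePhase φ t s)
    (phase φ (F.T₁ t) (-F.T₀ t)) s := by
  have h := ((((hasDerivAt_id s).mul_const (F.T₁ t)).const_add (F.X t)).const_mul (Real.cos φ)).add
    ((((hasDerivAt_id s).mul_const (F.T₀ t)).const_sub (F.Y t)).const_mul (Real.sin φ))
  have e : Real.cos φ * (1 * F.T₁ t) + Real.sin φ * -(1 * F.T₀ t) =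
      phase φ (F.T₁ t) (-F.T₀ t) := by simp only [phase]; ring
  rw [e] at h
  exact h

/-- The derivative of `H` in `s`. -/
def Hd (a : ℝ × ℝ → ℝ) (R φ s : ℝ) : ℂ :=
  ∫ t in (0)..L, ((dSnd a (t, s) : ℂ) - Complex.I * R * phase φ (F.T₁ t) (-F.T₀ t) * a (t, s)) *
    osc (R * F.tubePhase φ t s)

theorem continuous_Hd_integrand {a : ℝ × ℝ → ℝ} (ha : IsAmplitude L a) (R φ : ℝ) :
    Continuous fun p : ℝ × ℝ => ((dSnd a (p.2, p.1) : ℂ) -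
      Complex.I * R * phase φ (F.T₁ p.2) (-F.T₀ p.2) * a (p.2, p.1)) *
        osc (R * F.tubePhase φ p.2 p.1) := by
  have h : Continuous fun p : ℝ × ℝ => F.tubePhase φ p.2 p.1 := F.continuous_tubePhase.comp
    (f := fun p : ℝ × ℝ => (φ, p.2, p.1)) (by fun_prop)
  have := continuous_osc
  have := ha.smooth.continuous; have := ha.dSnd.smooth.continuous
  have := F.sT₀.continuous; have := F.sT₁.continuous
  unfold phase
  fun_prop

theorem continuous_Hd {a : ℝ × ℝ → ℝ} (ha : IsAmplitude L a) (R φ : ℝ) :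
    Continuous fun s => F.Hd a R φ s :=
  intervalIntegral.continuous_parametric_intervalIntegral_of_continuous'
    (F.continuous_Hd_integrand ha R φ) 0 L

theorem hasDerivAt_H {a : ℝ × ℝ → ℝ} (ha : IsAmplitude L a) (R φ s : ℝ) :
    HasDerivAt (F.H a R φ) (F.Hd a R φ s) s := by
  refine hasDerivAt_integral_of_continuous
    (F := fun s t => (a (t, s) : ℂ) * osc (R * F.tubePhase φ t s))
    (F' := fun s t => ((dSnd a (t, s) : ℂ) -
      Complex.I * R * phase φ (F.T₁ t) (-F.T₀ t) * a (t, s)) * osc (R * F.tubePhase φ t s))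
    ((F.continuous_integrand ha.smooth.continuous R).comp
      (f := fun p : ℝ × ℝ => ((φ, p.1), p.2)) (by fun_prop))
    (F.continuous_Hd_integrand ha R φ) (fun s t => ?_) 0 L s
  have h := ((ha.hasDerivAt_snd t s).ofReal_comp).mul
    (HasDerivAt.osc ((F.hasDerivAt_tubePhase_snd φ t s).const_mul R))
  have e : ∀ x y z w : ℂ, x * w + y * (-(Complex.I * (R * z)) * w) =
      (x - Complex.I * R * z * y) * w := by intros; ring
  simp only [Complex.ofReal_mul] at h
  rw [e] at h
  exact h

/-- Subtracting the derivative of the amplitude isolates the part of the `s`-derivative that falls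
on the exponential, with the normal component of the direction as a factor. -/
theorem Hd_sub_H {a : ℝ × ℝ → ℝ} (ha : IsAmplitude L a) (R φ s : ℝ) :
    F.Hd a R φ s - F.H (dSnd a) R φ s = -(Complex.I * R) *
      ∫ t in (0)..L, ((phase φ (F.T₁ t) (-F.T₀ t) * a (t, s) : ℝ) : ℂ) *
        osc (R * F.tubePhase φ t s) := by
  unfold Hd H
  rw [← intervalIntegral.integral_const_mul, ← intervalIntegral.integral_sub]
  · congr 1; funext t; push_cast; ring
  · exact ((F.continuous_Hd_integrand ha R φ).comp
      (f := fun t : ℝ => (s, t)) (by fun_prop)).intervalIntegrable _ _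
  · exact ((F.continuous_integrand ha.dSnd.smooth.continuous R).comp
      (f := fun t : ℝ => ((φ, s), t)) (by fun_prop)).intervalIntegrable _ _

/-- Integration by parts along the parallel curve, which is closed, so that boundary terms cancel.
The tangential component of the direction appears, with the speed `1 + s k`. -/
theorem H_dFst {a : ℝ × ℝ → ℝ} (ha : IsAmplitude L a) (R φ s : ℝ) :
    F.H (dFst a) R φ s = (Complex.I * R) *
      ∫ t in (0)..L, ((a (t, s) * (1 + s * F.k t) * phase φ (F.T₀ t) (F.T₁ t) : ℝ) : ℂ) *
        osc (R * F.tubePhase φ t s) := by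
  have hph := fun t => HasDerivAt.osc ((F.hasDerivAt_tubePhase_fst φ t s).const_mul R)
  have ha' := fun t => (ha.hasDerivAt_fst t s).ofReal_comp
  have c1 : Continuous fun t => osc (R * F.tubePhase φ t s) :=
    continuous_iff_continuousAt.2 fun t => (hph t).continuousAt
  have c2 : Continuous fun t => ((dFst a (t, s) : ℝ) : ℂ) := by
    have := ha.dFst.smooth.continuous
    fun_prop
  have key := intervalIntegral.integral_mul_deriv_eq_deriv_mul (a := 0) (b := L)
    (fun t _ => ha' t) (fun t _ => hph t) (c2.intervalIntegrable _ _)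
    (by
      apply Continuous.intervalIntegrable
      have := F.sk.continuous; have := F.sT₀.continuous; have := F.sT₁.continuous
      unfold phase
      fun_prop)
  have hper : F.tubePhase φ L s = F.tubePhase φ 0 s := by
    have h1 := F.pX 0; have h2 := F.pY 0; have h3 := F.pT₀ 0; have h4 := F.pT₁ 0
    simp only [zero_add] at h1 h2 h3 h4
    simp only [tubePhase, h1, h2, h3, h4]
  have hpa : a (L, s) = a (0, s) := by simpa using ha.periodic 0 s
  rw [hper, hpa, sub_self, zero_sub] at key
  unfold H
  rw [← neg_eq_iff_eq_neg.2 key, ← intervalIntegral.integral_neg,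
    ← intervalIntegral.integral_const_mul]
  congr 1; funext t; push_cast; ring

end Frame
-- Trading a factor `R` for a derivative across the tube
namespace Frame

variable {L : ℝ} (F : Frame L)

/-- A frame with a bound `r` for the half-width of a tube in which the tube coordinates are
regular, uniformly with constant `c`. -/
def Regular (c r : ℝ) : Prop := ∀ t s, |s| ≤ r → c ≤ 1 + s * F.k t

/-- Dividing by the speed must yield a globally smooth amplitude, whereas `1 + s k` may vanish
outside the tube; a smooth substitute for the reciprocal agrees with it where `|s| ≤ r`. -/
theorem exists_amplitude_reciprocal {c r : ℝ} (hc : 0 < c) (hF : F.Regular c r) :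
    ∃ g : ℝ × ℝ → ℝ, IsAmplitude L g ∧ ∀ t s, |s| ≤ r → g (t, s) * (1 + s * F.k t) = 1 := by
  obtain ⟨g, hg, hg1⟩ := exists_smooth_reciprocal hc
  refine ⟨fun z => g (1 + z.2 * F.k z.1), ⟨hg.comp ?_, fun t s => ?_⟩, fun t s hs => hg1 _ ?_⟩
  · exact contDiff_const.add (contDiff_snd.mul (F.sk.comp contDiff_fst))
  · simp only [F.pk t]
  · exact (hF t s hs).trans (le_abs_self _)

/-- The normal-derivative part of the transport of an amplitude. -/
def normalPart (i : Fin 2) (a : ℝ × ℝ → ℝ) (z : ℝ × ℝ) : ℝ :=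
  a z * (![F.T₁ z.1, -F.T₀ z.1] i)

/-- The lower-order part of the transport of an amplitude. -/
def lowerPart (g : ℝ × ℝ → ℝ) (i : Fin 2) (a : ℝ × ℝ → ℝ) (z : ℝ × ℝ) : ℝ :=
  dSnd (F.normalPart i a) z + dFst (fun z => a z * (![F.T₀ z.1, F.T₁ z.1] i) * g z) z

theorem isAmplitude_normalPart {a : ℝ × ℝ → ℝ} (ha : IsAmplitude L a) (i : Fin 2) :
    IsAmplitude L (F.normalPart i a) := by
  fin_cases i
  · exact ha.mul F.isAmplitude_T₁
  · exact ha.mul F.isAmplitude_T₀.neg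

theorem isAmplitude_tangentPart {a g : ℝ × ℝ → ℝ} (ha : IsAmplitude L a) (hg : IsAmplitude L g)
    (i : Fin 2) : IsAmplitude L (fun z => a z * (![F.T₀ z.1, F.T₁ z.1] i) * g z) := by
  fin_cases i
  · exact (ha.mul F.isAmplitude_T₀).mul hg
  · exact (ha.mul F.isAmplitude_T₁).mul hg

theorem isAmplitude_lowerPart {a g : ℝ × ℝ → ℝ} (ha : IsAmplitude L a) (hg : IsAmplitude L g)
    (i : Fin 2) : IsAmplitude L (F.lowerPart g i a) :=
  (F.isAmplitude_normalPart ha i).dSnd.add (F.isAmplitude_tangentPart ha hg i).dFst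

/-- The components of `ω(φ)`. -/
def direction (φ : ℝ) (i : Fin 2) : ℝ := ![Real.cos φ, Real.sin φ] i

theorem abs_direction_le (φ : ℝ) (i : Fin 2) : |direction φ i| ≤ 1 := by
  fin_cases i
  · exact Real.abs_cos_le_one φ
  · exact Real.abs_sin_le_one φ

theorem continuous_direction (i : Fin 2) : Continuous fun φ => direction φ i := by
  fin_cases i
  · exact Real.continuous_cos
  · exact Real.continuous_sin

theorem H_add {a b : ℝ × ℝ → ℝ} (ha : Continuous a) (hb : Continuous b) (R φ s : ℝ) :
    F.H (fun z => a z + b z) R φ s = F.H a R φ s + F.H b R φ s := by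
  unfold H
  rw [← intervalIntegral.integral_add]
  · congr 1; funext t; push_cast; ring
  · exact ((F.continuous_integrand ha R).comp
      (f := fun t : ℝ => ((φ, s), t)) (by fun_prop)).intervalIntegrable _ _
  · exact ((F.continuous_integrand hb R).comp
      (f := fun t : ℝ => ((φ, s), t)) (by fun_prop)).intervalIntegrable _ _

/-- The identity `R E = i ∑ᵢ ωᵢ ∂ᵢ E` for the exponential `E`, with the gradient split into its
normal and tangential parts. The normal part is a derivative in `s` of an integral over the parallel
curve; the tangential part, after integration along the curve, is absorbed in the lower-order
amplitude, whose integral carries no factor `R`. -/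
theorem mul_H_eq {a g : ℝ × ℝ → ℝ} (ha : IsAmplitude L a) (hg : IsAmplitude L g) {s : ℝ}
    (hgs : ∀ t, g (t, s) * (1 + s * F.k t) = 1) (R φ : ℝ) :
    R * F.H a R φ s = Complex.I * ∑ i : Fin 2, direction φ i *
      (F.Hd (F.normalPart i a) R φ s - F.H (F.lowerPart g i a) R φ s) := by
  have e : ∀ i, F.Hd (F.normalPart i a) R φ s - F.H (F.lowerPart g i a) R φ s =
      -(Complex.I * R) * ∫ t in (0)..L,
        ((phase φ (F.T₁ t) (-F.T₀ t) * F.normalPart i a (t, s) +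
          a (t, s) * (![F.T₀ t, F.T₁ t] i) * phase φ (F.T₀ t) (F.T₁ t) : ℝ) : ℂ) *
            osc (R * F.tubePhase φ t s) := by
    intro i
    have hn := F.isAmplitude_normalPart ha i
    have ht := F.isAmplitude_tangentPart ha hg i
    unfold lowerPart
    rw [F.H_add hn.dSnd.smooth.continuous ht.dFst.smooth.continuous, ← sub_sub, F.Hd_sub_H hn,
      F.H_dFst ht, neg_mul, neg_mul, neg_sub_left, ← mul_add, neg_inj, add_comm,
      ← intervalIntegral.integral_add]
    · congr 2
      funext t
      have h1 : a (t, s) * (![F.T₀ t, F.T₁ t] i) * g (t, s) * (1 + s * F.k t) =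
          a (t, s) * (![F.T₀ t, F.T₁ t] i) := by rw [mul_assoc, hgs, mul_one]
      simp only [h1]
      push_cast
      ring
    · apply Continuous.intervalIntegrable
      have h := F.continuous_integrand hn.smooth.continuous R
      have h2 := h.comp (f := fun t : ℝ => ((φ, s), t)) (by fun_prop)
      have h3 : Continuous fun t => phase φ (F.T₁ t) (-F.T₀ t) := by
        have := F.sT₀.continuous; have := F.sT₁.continuous
        unfold phase; fun_prop
      refine ((Complex.continuous_ofReal.comp h3).mul h2).congr fun t => ?_
      simp only [Pi.mul_apply, Function.comp_apply]; push_cast; ring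
    · apply Continuous.intervalIntegrable
      have h := F.continuous_integrand ht.smooth.continuous R
      have h2 := h.comp (f := fun t : ℝ => ((φ, s), t)) (by fun_prop)
      have h3 : Continuous fun t => (1 + s * F.k t) * phase φ (F.T₀ t) (F.T₁ t) := by
        have := F.sT₀.continuous; have := F.sT₁.continuous; have := F.sk.continuous
        unfold phase; fun_prop
      refine ((Complex.continuous_ofReal.comp h3).mul h2).congr fun t => ?_
      simp only [Pi.mul_apply, Function.comp_apply]; push_cast; ring
  have hcont : ∀ i : Fin 2, IntervalIntegrable (fun t =>
        ((phase φ (F.T₁ t) (-F.T₀ t) * F.normalPart i a (t, s) +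
          a (t, s) * (![F.T₀ t, F.T₁ t] i) * phase φ (F.T₀ t) (F.T₁ t) : ℝ) : ℂ) *
            osc (R * F.tubePhase φ t s)) volume 0 L := by
    intro i
    apply Continuous.intervalIntegrable
    have := (F.isAmplitude_normalPart ha i).smooth.continuous
    have := ha.smooth.continuous
    have h0 := F.sT₀.continuous
    have h1 := F.sT₁.continuous
    have h3 : Continuous fun t => ![F.T₀ t, F.T₁ t] i := by fin_cases i <;> assumption
    have h4 := F.continuous_tubePhase.comp (f := fun t : ℝ => (φ, t, s)) (by fun_prop)
    have h5 : Continuous fun t => F.tubePhase φ t s := h4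
    have := continuous_osc
    unfold phase
    fun_prop
  rw [Fin.sum_univ_two, e, e]
  -- The amplitudes recombine through `(ω·n)² + (ω·T)² = 1`, a consequence of `|ω| = |T| = 1`.
  have comb : F.H a R φ s = direction φ 0 * (∫ t in (0)..L,
        ((phase φ (F.T₁ t) (-F.T₀ t) * F.normalPart 0 a (t, s) +
          a (t, s) * (![F.T₀ t, F.T₁ t] 0) * phase φ (F.T₀ t) (F.T₁ t) : ℝ) : ℂ) *
            osc (R * F.tubePhase φ t s)) + direction φ 1 * (∫ t in (0)..L,
        ((phase φ (F.T₁ t) (-F.T₀ t) * F.normalPart 1 a (t, s) +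
          a (t, s) * (![F.T₀ t, F.T₁ t] 1) * phase φ (F.T₀ t) (F.T₁ t) : ℝ) : ℂ) *
            osc (R * F.tubePhase φ t s)) := by
    rw [← intervalIntegral.integral_const_mul, ← intervalIntegral.integral_const_mul,
      ← intervalIntegral.integral_add ((hcont 0).const_mul _) ((hcont 1).const_mul _)]
    unfold H
    congr 1
    funext t
    rw [← mul_assoc, ← mul_assoc, ← add_mul, ← Complex.ofReal_mul, ← Complex.ofReal_mul,
      ← Complex.ofReal_add]
    congr 2
    simp only [direction, normalPart, phase, Matrix.cons_val_zero, Matrix.cons_val_one]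
    linear_combination (-a (t, s)) * Real.sin_sq_add_cos_sq φ
      - a (t, s) * (Real.cos φ ^ 2 + Real.sin φ ^ 2) * F.unit t
  rw [comb]
  linear_combination (R * (direction φ 0 * (∫ t in (0)..L,
        ((phase φ (F.T₁ t) (-F.T₀ t) * F.normalPart 0 a (t, s) +
          a (t, s) * (![F.T₀ t, F.T₁ t] 0) * phase φ (F.T₀ t) (F.T₁ t) : ℝ) : ℂ) *
            osc (R * F.tubePhase φ t s)) + direction φ 1 * (∫ t in (0)..L,
        ((phase φ (F.T₁ t) (-F.T₀ t) * F.normalPart 1 a (t, s) +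
          a (t, s) * (![F.T₀ t, F.T₁ t] 1) * phase φ (F.T₀ t) (F.T₁ t) : ℝ) : ℂ) *
            osc (R * F.tubePhase φ t s)))) * Complex.I_sq

/-- Integration by parts across the tube. -/
theorem integral_mul_H_by_parts {a g : ℝ × ℝ → ℝ} (ha : IsAmplitude L a) (hg : IsAmplitude L g)
    {r : ℝ} (hgr : ∀ t s, |s| ≤ r → g (t, s) * (1 + s * F.k t) = 1)
    {θ θ' : ℝ → ℝ} {S : Set ℝ} (hS : S.Countable) {α β e : ℝ} (hαβ : α ≤ β)
    (he : ∀ σ ∈ Icc α β, |e * σ| ≤ r) (hθ : ContinuousOn θ (Icc α β))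
    (hd : ∀ x ∈ Ioo α β \ S, HasDerivAt θ (θ' x) x) (hi : IntervalIntegrable θ' volume α β)
    (R φ : ℝ) :
    ((e * R : ℝ) : ℂ) * ∫ σ in α..β, (θ σ : ℂ) * F.H a R φ (e * σ) =
      Complex.I * ∑ i : Fin 2, direction φ i *
        (θ β * F.H (F.normalPart i a) R φ (e * β) - θ α * F.H (F.normalPart i a) R φ (e * α) -
          (∫ σ in α..β, (θ' σ : ℂ) * F.H (F.normalPart i a) R φ (e * σ)) -
          e * ∫ σ in α..β, (θ σ : ℂ) * F.H (F.lowerPart g i a) R φ (e * σ)) := by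
  have hn := fun i => F.isAmplitude_normalPart ha i
  have hl := fun i => F.isAmplitude_lowerPart ha hg i
  have hder : ∀ i σ, HasDerivAt (fun σ => F.H (F.normalPart i a) R φ (e * σ))
      (e * F.Hd (F.normalPart i a) R φ (e * σ)) σ := fun i σ => by
    have h := (F.hasDerivAt_H (hn i) R φ (e * σ)).scomp σ ((hasDerivAt_id σ).const_mul e)
    rw [mul_one, Complex.real_smul] at h
    exact h
  have cHd : ∀ i, Continuous fun σ => F.Hd (F.normalPart i a) R φ (e * σ) := fun i =>
    (F.continuous_Hd (hn i) R φ).comp (by fun_prop)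
  have cH : ∀ b : ℝ × ℝ → ℝ, IsAmplitude L b → Continuous fun σ => F.H b R φ (e * σ) :=
    fun b hb => (F.continuous_H hb.smooth.continuous R).comp
      (f := fun σ : ℝ => (φ, e * σ)) (by fun_prop)
  have hθi : IntervalIntegrable (fun σ => (θ σ : ℂ)) volume α β := by
    apply ContinuousOn.intervalIntegrable
    rw [uIcc_of_le hαβ]
    exact Complex.continuous_ofReal.comp_continuousOn hθ
  have hi' : IntervalIntegrable (fun σ => (θ' σ : ℂ)) volume α β := ⟨hi.1.ofReal, hi.2.ofReal⟩
  -- With `s = e σ`, a derivative in `σ` is `e` times one in `s`; hence the gain is a power of `e R`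
  -- and not of `R`.
  have parts : ∀ i, e * ∫ σ in α..β, (θ σ : ℂ) * F.Hd (F.normalPart i a) R φ (e * σ) =
      θ β * F.H (F.normalPart i a) R φ (e * β) - θ α * F.H (F.normalPart i a) R φ (e * α) -
          ∫ σ in α..β, (θ' σ : ℂ) * F.H (F.normalPart i a) R φ (e * σ) := by
    intro i
    rw [← integral_mul_deriv_of_off_countable hS hαβ
      (u := fun σ => (θ σ : ℂ)) (u' := fun σ => (θ' σ : ℂ))
      (v := fun σ => F.H (F.normalPart i a) R φ (e * σ))
      (v' := fun σ => e * F.Hd (F.normalPart i a) R φ (e * σ))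
      (Complex.continuous_ofReal.comp_continuousOn hθ) (cH _ (hn i)).continuousOn
      (fun x hx => (hd x hx).ofReal_comp) (fun x _ => hder i x) hi'
      ((continuous_const.mul (cHd i)).intervalIntegrable _ _),
      ← intervalIntegral.integral_const_mul]
    congr 1; funext σ; ring
  have hpt : ∫ σ in α..β, (θ σ : ℂ) * (R * F.H a R φ (e * σ)) =
      ∫ σ in α..β, Complex.I * ∑ i : Fin 2, direction φ i *
      ((θ σ : ℂ) * F.Hd (F.normalPart i a) R φ (e * σ) -
        (θ σ : ℂ) * F.H (F.lowerPart g i a) R φ (e * σ)) := by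
    apply intervalIntegral.integral_congr
    intro σ hσ
    rw [uIcc_of_le hαβ] at hσ
    simp only
    rw [F.mul_H_eq ha hg (fun t => hgr t _ (he σ hσ)), Fin.sum_univ_two, Fin.sum_univ_two]
    ring
  have i1 := fun i => hθi.mul_continuousOn (cHd i).continuousOn
  have i2 := fun i => hθi.mul_continuousOn (cH _ (hl i)).continuousOn
  have e1 : (R : ℂ) * ∫ σ in α..β, (θ σ : ℂ) * F.H a R φ (e * σ) =
      ∫ σ in α..β, (θ σ : ℂ) * (R * F.H a R φ (e * σ)) := by
    rw [← intervalIntegral.integral_const_mul]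
    congr 1; funext σ; ring
  rw [Complex.ofReal_mul, mul_assoc, e1, hpt, intervalIntegral.integral_const_mul,
    intervalIntegral.integral_finsetSum]
  · simp only [intervalIntegral.integral_const_mul,
      intervalIntegral.integral_sub (i1 _) (i2 _), ← parts, Fin.sum_univ_two]
    ring
  · exact fun i _ => ((i1 i).sub (i2 i)).const_mul _

end Frame
-- Uniform decay on parallel curves and the calculus of decay orders
namespace Frame

variable {L : ℝ} (F : Frame L)

/-- Parallel curves share the tangent `T` and the rate `k` at which it turns; only the speed
changes, to `1 + s k`. They are thus arcs with data bounded uniformly in `|s| ≤ r`, and one constant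
serves all of them. -/
theorem exists_bound_H (hL : 0 < L) {c r : ℝ} (hc : 0 < c) (hr : 0 < r) (hF : F.Regular c r)
    {a : ℝ × ℝ → ℝ} (ha : IsAmplitude L a) :
    ∃ C, 0 ≤ C ∧ ∀ R s : ℝ, 1 ≤ R → |s| ≤ r →
      ∫ φ in (0)..(2 * Real.pi), ‖F.H a R φ s‖ ^ 2 ≤ C / R := by
  have sk' : ContDiff ℝ ∞ (deriv F.k) := F.sk.iterate_deriv 1
  obtain ⟨A₁, hA₁, h₁⟩ := (IsAmplitude.of_fst F.sk F.pk).exists_bound hL r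
  obtain ⟨A₂, hA₂, h₂⟩ := (IsAmplitude.of_fst sk' (periodic_deriv F.pk)).exists_bound hL r
  obtain ⟨A₃, hA₃, h₃⟩ := ha.exists_bound hL r
  obtain ⟨A₄, hA₄, h₄⟩ := ha.dFst.exists_bound hL r
  have hrA₁ := mul_nonneg hr.le hA₁
  have hrA₂ := mul_nonneg hr.le hA₂
  obtain ⟨C, hC0, hC⟩ := Arc.exists_bound hc (1 + r * A₁ + r * A₂ + A₁ + A₃ + A₄) hL.le
  refine ⟨C, hC0, fun R s hR hs => ?_⟩
  have hsk : ∀ t, |s * F.k t| ≤ r * A₁ := fun t => by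
    rw [abs_mul]; exact mul_le_mul hs (h₁ t s hs) (abs_nonneg _) hr.le
  let Γ : Arc c (1 + r * A₁ + r * A₂ + A₁ + A₃ + A₄) :=
    { X := fun t => F.X t + s * F.T₁ t
      Y := fun t => F.Y t - s * F.T₀ t
      T₀ := F.T₀
      T₁ := F.T₁
      k := F.k
      v := fun t => 1 + s * F.k t
      v' := fun t => s * deriv F.k t
      b := fun t => a (t, s)
      b' := fun t => dFst a (t, s)
      hX := fun t => by
        have h := (F.hX t).add ((F.hT₁ t).const_mul s)
        rw [show F.T₀ t + s * (F.k t * F.T₀ t) = (1 + s * F.k t) * F.T₀ t by ring] at h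
        exact h
      hY := fun t => by
        have h := (F.hY t).sub ((F.hT₀ t).const_mul s)
        rw [show F.T₁ t - s * -(F.k t * F.T₁ t) = (1 + s * F.k t) * F.T₁ t by ring] at h
        exact h
      hT₀ := F.hT₀
      hT₁ := F.hT₁
      unit := F.unit
      hv := fun t => (((F.sk.differentiable (by simp) t).hasDerivAt).const_mul s).const_add 1
      hb := fun t => ha.hasDerivAt_fst t s
      k_cont := F.sk.continuous
      v'_cont := continuous_const.mul sk'.continuous
      b'_cont := by have := ha.dFst.smooth.continuous; fun_prop
      v_ge := fun t => hF t s hs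
      v_le := fun t => by linarith [(abs_le.1 (hsk t)).2]
      k_le := fun t => by have := h₁ t s hs; simp only at this; linarith
      v'_le := fun t => by
        have : |s * deriv F.k t| ≤ r * A₂ := by
          rw [abs_mul]; exact mul_le_mul hs (h₂ t s hs) (abs_nonneg _) hr.le
        linarith
      b_le := fun t => by linarith [h₃ t s hs]
      b'_le := fun t => by linarith [h₄ t s hs] }
  exact hC Γ R hR

/-! ### Mean-square decay -/

/-- Mean-square decay of order `j` on the circle, of a family of functions of the angle indexed by
the width `e ≤ r` and the frequency `R`. -/
def Decays (r : ℝ) (j : ℕ) (G : ℝ → ℝ → ℝ → ℂ) : Prop :=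
  ∃ C, 0 ≤ C ∧ ∀ e R : ℝ, 0 < e → e ≤ r → 1 ≤ R → Continuous (G e R) ∧
    ∫ φ in (0)..(2 * Real.pi), ‖G e R φ‖ ^ 2 ≤ C / (R * (e * R) ^ (2 * j))

namespace Decays

variable {r : ℝ} {j : ℕ} {G G' : ℝ → ℝ → ℝ → ℂ}

theorem add (hG : Decays r j G) (hG' : Decays r j G') :
    Decays r j fun e R φ => G e R φ + G' e R φ := by
  obtain ⟨C, hC, h⟩ := hG
  obtain ⟨C', hC', h'⟩ := hG'
  refine ⟨2 * C + 2 * C', by positivity, fun e R he her hR => ?_⟩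
  obtain ⟨c1, b1⟩ := h e R he her hR
  obtain ⟨c2, b2⟩ := h' e R he her hR
  refine ⟨c1.add c2, ?_⟩
  calc _ ≤ ∫ φ in (0)..(2 * Real.pi), (2 * ‖G e R φ‖ ^ 2 + 2 * ‖G' e R φ‖ ^ 2) := by
        refine intervalIntegral.integral_mono_on Real.two_pi_pos.le
          (by apply Continuous.intervalIntegrable; fun_prop)
          (by apply Continuous.intervalIntegrable; fun_prop) fun φ _ => ?_
        have h3 := norm_add_le (G e R φ) (G' e R φ)
        calc _ ≤ (‖G e R φ‖ + ‖G' e R φ‖) ^ 2 := by gcongr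
          _ ≤ _ := by nlinarith [sq_nonneg (‖G e R φ‖ - ‖G' e R φ‖)]
    _ = 2 * (∫ φ in (0)..(2 * Real.pi), ‖G e R φ‖ ^ 2) +
          2 * ∫ φ in (0)..(2 * Real.pi), ‖G' e R φ‖ ^ 2 := by
        rw [intervalIntegral.integral_add, intervalIntegral.integral_const_mul,
          intervalIntegral.integral_const_mul]
        all_goals apply Continuous.intervalIntegrable; fun_prop
    _ ≤ 2 * (C / (R * (e * R) ^ (2 * j))) + 2 * (C' / (R * (e * R) ^ (2 * j))) := by gcongr
    _ = _ := by ring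

theorem bounded_mul {m : ℝ → ℝ → ℝ → ℂ} {M : ℝ}
    (hm : ∀ e R, 0 < e → e ≤ r → Continuous (m e R) ∧ ∀ φ, ‖m e R φ‖ ≤ M) (hG : Decays r j G) :
    Decays r j fun e R φ => m e R φ * G e R φ := by
  obtain ⟨C, hC, h⟩ := hG
  refine ⟨M ^ 2 * C, by positivity, fun e R he her hR => ?_⟩
  obtain ⟨c1, b1⟩ := h e R he her hR
  obtain ⟨c2, b2⟩ := hm e R he her
  refine ⟨c2.mul c1, ?_⟩
  calc _ ≤ ∫ φ in (0)..(2 * Real.pi), M ^ 2 * ‖G e R φ‖ ^ 2 := by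
        refine intervalIntegral.integral_mono_on Real.two_pi_pos.le
          (by apply Continuous.intervalIntegrable; fun_prop)
          (by apply Continuous.intervalIntegrable; fun_prop) fun φ _ => ?_
        rw [norm_mul, mul_pow]
        have := b2 φ
        gcongr
    _ = M ^ 2 * ∫ φ in (0)..(2 * Real.pi), ‖G e R φ‖ ^ 2 := intervalIntegral.integral_const_mul _ _
    _ ≤ M ^ 2 * (C / (R * (e * R) ^ (2 * j))) := by gcongr
    _ = _ := by ring

theorem const_mul (z : ℂ) (hG : Decays r j G) : Decays r j fun e R φ => z * G e R φ :=
  hG.bounded_mul (m := fun _ _ _ => z) fun _ _ _ _ => ⟨continuous_const, fun _ => le_rfl⟩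

theorem sub (hG : Decays r j G) (hG' : Decays r j G') :
    Decays r j fun e R φ => G e R φ - G' e R φ := by
  have h := hG.add (hG'.const_mul (-1))
  simpa only [neg_one_mul, ← sub_eq_add_neg] using h

/-- The factor `e ≤ r` in front of the lower-order terms is merely bounded; no smallness is drawn
from it. -/
theorem width_mul (hG : Decays r j G) : Decays r j fun e R φ => (e : ℂ) * G e R φ := by
  refine hG.bounded_mul (m := fun e _ _ => (e : ℂ)) (M := r)
    fun e _ he her => ⟨continuous_const, fun _ => ?_⟩
  rwa [Complex.norm_real, Real.norm_eq_abs, abs_of_pos he]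

/-- Each integration by parts bounds `e R` times the quantity; dividing by `(e R)²` in mean square
raises the order by one. -/
theorem of_mul (hG : Decays r j fun e R φ => ((e * R : ℝ) : ℂ) * G e R φ) :
    Decays r (j + 1) G := by
  obtain ⟨C, hC, h⟩ := hG
  refine ⟨C, hC, fun e R he her hR => ?_⟩
  have hR0 : 0 < R := by linarith
  have heR : 0 < e * R := mul_pos he hR0
  obtain ⟨c1, b1⟩ := h e R he her hR
  have hne : ((e * R : ℝ) : ℂ) ≠ 0 := by exact_mod_cast heR.ne'
  refine ⟨?_, ?_⟩
  · have := c1.const_smul (((e * R : ℝ) : ℂ)⁻¹)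
    refine this.congr fun φ => ?_
    change (((e * R : ℝ) : ℂ)⁻¹) * (((e * R : ℝ) : ℂ) * G e R φ) = G e R φ
    rw [← mul_assoc, inv_mul_cancel₀ hne, one_mul]
  · simp only [norm_mul, mul_pow, Complex.norm_real, Real.norm_eq_abs, sq_abs,
      intervalIntegral.integral_const_mul] at b1
    rw [← mul_pow] at b1
    rw [← mul_pow] at b1
    rw [mul_add, pow_add, ← mul_assoc, ← div_div, mul_one, le_div_iff₀' (by positivity)]
    exact b1

theorem congr (hG : Decays r j G) (h : ∀ e R φ, 0 < e → e ≤ r → G e R φ = G' e R φ) :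
    Decays r j G' := by
  obtain ⟨C, hC, h'⟩ := hG
  refine ⟨C, hC, fun e R he her hR => ?_⟩
  rw [show G' e R = G e R from funext fun φ => (h e R φ he her).symm]
  exact h' e R he her hR

theorem zero : Decays r j fun _ _ _ => 0 :=
  ⟨0, le_rfl, fun _ _ _ _ _ => ⟨continuous_const, by simp⟩⟩

end Decays

variable {c r : ℝ}

theorem abs_mul_le_of_mem {e α β r σ : ℝ} (he : 0 < e) (her : e ≤ r) (hα : -1 ≤ α) (hβ : β ≤ 1)
    (hσ : σ ∈ Icc α β) : |e * σ| ≤ r := by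
  rw [abs_mul, abs_of_pos he]
  have : |σ| ≤ 1 := abs_le.2 ⟨hα.trans hσ.1, hσ.2.trans hβ⟩
  nlinarith

theorem decays_H (hL : 0 < L) (hc : 0 < c) (hr : 0 < r) (hF : F.Regular c r)
    {a : ℝ × ℝ → ℝ} (ha : IsAmplitude L a) {σ : ℝ} (hσ : σ ∈ Icc (-1 : ℝ) 1) :
    Decays r 0 fun e R φ => F.H a R φ (e * σ) := by
  obtain ⟨C, hC, h⟩ := F.exists_bound_H hL hc hr hF ha
  refine ⟨C, hC, fun e R he her hR => ⟨?_, ?_⟩⟩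
  · exact (F.continuous_H ha.smooth.continuous R).comp (f := fun φ : ℝ => (φ, e * σ)) (by fun_prop)
  · simpa using h R (e * σ) hR (abs_mul_le_of_mem he her le_rfl le_rfl hσ)

/-- Cauchy–Schwarz in `σ` and Fubini reduce the average over the layer to its parallel curves, on
which the bound is uniform. -/
theorem decays_integral_H (hL : 0 < L) (hc : 0 < c) (hr : 0 < r) (hF : F.Regular c r)
    {a : ℝ × ℝ → ℝ} (ha : IsAmplitude L a) {θ : ℝ → ℝ} (hθ : Continuous θ)
    {α β : ℝ} (hα : -1 ≤ α) (hαβ : α ≤ β) (hβ : β ≤ 1) :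
    Decays r 0 fun e R φ => ∫ σ in α..β, (θ σ : ℂ) * F.H a R φ (e * σ) := by
  obtain ⟨C, hC, h⟩ := F.exists_bound_H hL hc hr hF ha
  obtain ⟨M, hM⟩ := isCompact_Icc.exists_bound_of_continuousOn (s := Icc α β) hθ.continuousOn
  refine ⟨(β - α) * ((β - α) * (M ^ 2 * C)), by
    have := sub_nonneg.2 hαβ; positivity, fun e R he her hR => ?_⟩
  have cH : Continuous fun p : ℝ × ℝ => F.H a R p.1 (e * p.2) :=
    (F.continuous_H ha.smooth.continuous R).comp
      (f := fun p : ℝ × ℝ => (p.1, e * p.2)) (by fun_prop)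
  have cI : Continuous fun p : ℝ × ℝ => (θ p.2 : ℂ) * F.H a R p.1 (e * p.2) := by fun_prop
  have cφ : ∀ φ, Continuous fun σ => (θ σ : ℂ) * F.H a R φ (e * σ) := fun φ =>
    cI.comp (Continuous.prodMk_right φ)
  have cont : Continuous fun φ => ∫ σ in α..β, (θ σ : ℂ) * F.H a R φ (e * σ) :=
    intervalIntegral.continuous_parametric_intervalIntegral_of_continuous' cI α β
  have cN : Continuous fun p : ℝ × ℝ => ‖(θ p.2 : ℂ) * F.H a R p.1 (e * p.2)‖ ^ 2 :=
    cI.norm.pow 2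
  have cN1 : Continuous fun φ => ∫ σ in α..β, ‖(θ σ : ℂ) * F.H a R φ (e * σ)‖ ^ 2 :=
    intervalIntegral.continuous_parametric_intervalIntegral_of_continuous' cN α β
  have hβα := sub_nonneg.2 hαβ
  refine ⟨cont, ?_⟩
  calc _ ≤ ∫ φ in (0)..(2 * Real.pi), (β - α) * ∫ σ in α..β, ‖(θ σ : ℂ) * F.H a R φ (e * σ)‖ ^ 2 :=
        intervalIntegral.integral_mono_on Real.two_pi_pos.le
          ((cont.norm.pow 2).intervalIntegrable _ _)
          ((continuous_const.mul cN1).intervalIntegrable _ _)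
          fun φ _ => sq_norm_integral_le (cφ φ) hαβ
    _ = (β - α) * ∫ σ in α..β, ∫ φ in (0)..(2 * Real.pi), ‖(θ σ : ℂ) * F.H a R φ (e * σ)‖ ^ 2 := by
        rw [intervalIntegral.integral_const_mul, integral_integral_swap_of_continuous
          (F := fun φ σ => ‖(θ σ : ℂ) * F.H a R φ (e * σ)‖ ^ 2) cN]
    _ ≤ (β - α) * ∫ σ in α..β, M ^ 2 * (C / R) := by
        gcongr
        have cs : Continuous fun σ => ∫ φ in (0)..(2 * Real.pi), ‖(θ σ : ℂ) * F.H a R φ (e * σ)‖ ^ 2 :=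
          intervalIntegral.continuous_parametric_intervalIntegral_of_continuous'
            (f := fun σ φ => ‖(θ σ : ℂ) * F.H a R φ (e * σ)‖ ^ 2)
            (cN.comp continuous_swap) 0 (2 * Real.pi)
        refine intervalIntegral.integral_mono_on hαβ (cs.intervalIntegrable _ _)
          (continuous_const.intervalIntegrable _ _) fun σ hσ => ?_
        simp only [norm_mul, mul_pow, intervalIntegral.integral_const_mul, Complex.norm_real]
        have h1 := hM σ hσ
        have h2 := h R (e * σ) hR (abs_mul_le_of_mem he her hα hβ hσ)
        have h3 : 0 ≤ ∫ φ in (0)..(2 * Real.pi), ‖F.H a R φ (e * σ)‖ ^ 2 :=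
          intervalIntegral.integral_nonneg Real.two_pi_pos.le fun _ _ => by positivity
        gcongr
    _ = _ := by
        rw [intervalIntegral.integral_const, smul_eq_mul]
        simp only [mul_zero, pow_zero, mul_one]
        ring

end Frame

/-! ### Piecewise smooth weights -/

/-- Induction on the number of break points in the open interval: cutting at one of them leaves
fewer on either side. -/
theorem interval_induction {P : ℝ → ℝ → Prop} (S : Finset ℝ) (refl : ∀ a, P a a)
    (piece : ∀ a b, a < b → (∀ s ∈ S, s ∉ Ioo a b) → P a b)
    (trans : ∀ a x b, a ≤ x → x ≤ b → P a x → P x b → P a b) : ∀ a b, a ≤ b → P a b := by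
  have main : ∀ n : ℕ, ∀ a b, a ≤ b → (S.filter (· ∈ Ioo a b)).card ≤ n → P a b := by
    intro n
    induction n with
    | zero =>
      intro a b hab h
      rcases hab.eq_or_lt with rfl | hlt
      · exact refl a
      · refine piece a b hlt fun s hs hsab => ?_
        have : s ∈ S.filter (· ∈ Ioo a b) := Finset.mem_filter.2 ⟨hs, hsab⟩
        rw [Finset.card_eq_zero.1 (Nat.le_zero.1 h)] at this
        simp at this
    | succ n ih =>
      intro a b hab h
      rcases hab.eq_or_lt with rfl | hlt
      · exact refl a
      by_cases hS : ∀ s ∈ S, s ∉ Ioo a b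
      · exact piece a b hlt hS
      push Not at hS
      obtain ⟨x, hxS, hx⟩ := hS
      have hmem : x ∈ S.filter (· ∈ Ioo a b) := Finset.mem_filter.2 ⟨hxS, hx⟩
      have sub : ∀ T : Finset ℝ, T ⊆ S.filter (· ∈ Ioo a b) → x ∉ T → T.card ≤ n := by
        intro T hT hxT
        have : T.card < (S.filter (· ∈ Ioo a b)).card :=
          Finset.card_lt_card ⟨hT, fun h' => hxT (h' hmem)⟩
        omega
      refine trans a x b hx.1.le hx.2.le (ih a x hx.1.le (sub _ ?_ ?_)) (ih x b hx.2.le (sub _ ?_ ?_))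
      · intro y hy
        rw [Finset.mem_filter] at hy ⊢
        exact ⟨hy.1, hy.2.1, hy.2.2.trans hx.2⟩
      · simp
      · intro y hy
        rw [Finset.mem_filter] at hy ⊢
        exact ⟨hy.1, hx.1.trans hy.2.1, hy.2.2⟩
      · simp
  exact fun a b hab => main _ a b hab le_rfl

theorem intervalIntegrable_congr_Ioo {E : Type*} [NormedAddCommGroup E] {f g : ℝ → E} {a b : ℝ}
    (hab : a ≤ b) (h : EqOn f g (Ioo a b)) (hg : IntervalIntegrable g volume a b) :
    IntervalIntegrable f volume a b := by
  rw [intervalIntegrable_iff_integrableOn_Ioo_of_le hab] at hg ⊢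
  exact hg.congr_fun h.symm measurableSet_Ioo

theorem integral_congr_Ioo {E : Type*} [NormedAddCommGroup E] [NormedSpace ℝ E] {f g : ℝ → E}
    {a b : ℝ} (hab : a ≤ b) (h : EqOn f g (Ioo a b)) :
    ∫ x in a..b, f x = ∫ x in a..b, g x := by
  rw [intervalIntegral.integral_of_le hab, intervalIntegral.integral_of_le hab,
    integral_Ioc_eq_integral_Ioo, integral_Ioc_eq_integral_Ioo]
  exact setIntegral_congr_fun measurableSet_Ioo h

namespace PiecewiseContDiff

variable {n : ℕ} {θ : ℝ → ℝ}

theorem intervalIntegrable (h : PiecewiseContDiff n θ) {a b : ℝ} (hab : a ≤ b) :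
    IntervalIntegrable θ volume a b := by
  obtain ⟨S, hS⟩ := h
  refine interval_induction (P := fun a b => IntervalIntegrable θ volume a b) S
    (fun a => IntervalIntegrable.refl) (fun a b hab hSab => ?_)
    (fun a x b _ _ h1 h2 => h1.trans h2) a b hab
  obtain ⟨G, hG, hGθ⟩ := hS a b hab hSab
  exact intervalIntegrable_congr_Ioo hab.le hGθ (hG.continuous.intervalIntegrable _ _)

theorem of_le {m : ℕ} (h : PiecewiseContDiff n θ) (hmn : m ≤ n) : PiecewiseContDiff m θ := by
  obtain ⟨S, hS⟩ := h
  refine ⟨S, fun a b hab hSab => ?_⟩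
  obtain ⟨G, hG, hGθ⟩ := hS a b hab hSab
  exact ⟨G, hG.of_le (by exact_mod_cast hmn), hGθ⟩

theorem deriv (h : PiecewiseContDiff (n + 1) θ) : PiecewiseContDiff n (deriv θ) := by
  obtain ⟨S, hS⟩ := h
  refine ⟨S, fun a b hab hSab => ?_⟩
  obtain ⟨G, hG, hGθ⟩ := hS a b hab hSab
  refine ⟨_root_.deriv G, ?_, fun x hx => ?_⟩
  · push_cast at hG
    exact (contDiff_succ_iff_deriv.1 hG).2.2
  · exact (hGθ.eventuallyEq_of_mem (Ioo_mem_nhds hx.1 hx.2)).deriv_eq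

theorem exists_finite_hasDerivAt (h : PiecewiseContDiff (n + 1) θ) :
    ∃ S : Finset ℝ, ∀ x ∉ S, HasDerivAt θ (_root_.deriv θ x) x := by
  obtain ⟨S, hS⟩ := h
  refine ⟨S, fun x hx => ?_⟩
  have : ((S : Set ℝ)ᶜ) ∈ 𝓝 x := S.finite_toSet.isClosed.isOpen_compl.mem_nhds hx
  obtain ⟨δ, hδ, hball⟩ := Metric.mem_nhds_iff.1 this
  rw [Real.ball_eq_Ioo] at hball
  obtain ⟨G, hG, hGθ⟩ := hS (x - δ) (x + δ) (by linarith) fun s hs hsx => hball hsx hs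
  have hev : θ =ᶠ[𝓝 x] G :=
    hGθ.eventuallyEq_of_mem (Ioo_mem_nhds (by linarith) (by linarith))
  have hd : DifferentiableAt ℝ G x := hG.differentiable (by exact_mod_cast n.succ_ne_zero) x
  exact (hd.congr_of_eventuallyEq hev).hasDerivAt

end PiecewiseContDiff

/-- Weight profiles of regularity order `q`, without normalization. -/
structure IsProfile (q : ℕ) (θ : ℝ → ℝ) : Prop where
  zero : ∀ s ∉ Icc (-1 : ℝ) 1, θ s = 0
  contDiff : ∀ k : ℕ, k < q → ContDiff ℝ k θ
  piecewise : PiecewiseContDiff (q + 1) θ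

theorem IsWeight.isProfile {q : ℕ} {θ : ℝ → ℝ} (h : IsWeight q θ) : IsProfile q θ :=
  ⟨fun s hs => by
    by_contra hne
    exact hs (h.support_eq ▸ subset_tsupport θ hne), h.contDiff, h.piecewise⟩

namespace IsProfile

variable {q : ℕ} {θ : ℝ → ℝ}

theorem of_succ (h : IsProfile (q + 1) θ) : IsProfile q θ :=
  ⟨h.zero, fun k hk => h.contDiff k (hk.trans q.lt_succ_self), h.piecewise.of_le (by omega)⟩

theorem deriv (h : IsProfile (q + 1) θ) : IsProfile q (deriv θ) where
  zero s hs := by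
    have : θ =ᶠ[𝓝 s] fun _ => 0 := by
      filter_upwards [isClosed_Icc.isOpen_compl.mem_nhds hs] with x hx using h.zero x hx
    rw [this.deriv_eq]; simp
  contDiff k hk := by
    have := h.contDiff (k + 1) (by omega)
    push_cast at this
    exact (contDiff_succ_iff_deriv.1 this).2.2
  piecewise := h.piecewise.deriv

theorem continuous (h : IsProfile (q + 1) θ) : Continuous θ := (h.contDiff 0 (by omega)).continuous

/-- Continuity and vanishing beyond the end point; this suppresses the boundary terms of every
integration by parts but the last. -/
theorem eq_zero_of_one (h : IsProfile (q + 1) θ) : θ 1 = 0 := by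
  have h1 : Tendsto θ (𝓝[>] 1) (𝓝 (θ 1)) := h.continuous.continuousWithinAt
  refine tendsto_nhds_unique h1 (tendsto_const_nhds.congr' ?_)
  filter_upwards [self_mem_nhdsWithin] with x hx
  exact (h.zero x fun h' => absurd h'.2 (not_le.2 hx)).symm

theorem eq_zero_of_neg_one (h : IsProfile (q + 1) θ) : θ (-1) = 0 := by
  have h1 : Tendsto θ (𝓝[<] (-1)) (𝓝 (θ (-1))) := h.continuous.continuousWithinAt
  refine tendsto_nhds_unique h1 (tendsto_const_nhds.congr' ?_)
  filter_upwards [self_mem_nhdsWithin] with x hx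
  exact (h.zero x fun h' => absurd h'.1 (not_le.2 hx)).symm

end IsProfile

/-! ### Decay of layers: induction on the regularity of the profile -/

namespace Frame

variable {L : ℝ} (F : Frame L) {c r : ℝ}

theorem Decays.sum_direction {j : ℕ} {G : Fin 2 → ℝ → ℝ → ℝ → ℂ} (hG : ∀ i, Decays r j (G i)) :
    Decays r j fun e R φ => Complex.I * ∑ i : Fin 2, direction φ i * G i e R φ := by
  have h : ∀ i, Decays r j fun e R φ => (direction φ i : ℂ) * G i e R φ := fun i =>
    (hG i).bounded_mul (m := fun _ _ φ => (direction φ i : ℂ)) (M := 1) fun _ _ _ _ =>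
      ⟨Complex.continuous_ofReal.comp (continuous_direction i),
        fun φ => by simpa using abs_direction_le φ i⟩
  simp only [Fin.sum_univ_two]
  exact ((h 0).add (h 1)).const_mul _

/-- One integration by parts on each smooth piece. Jumps are allowed: the boundary terms are
integrals over single parallel curves, which already decay at order zero, and there are finitely
many of them. -/
theorem decays_integral_profile_zero (hL : 0 < L) (hc : 0 < c) (hr : 0 < r) (hF : F.Regular c r)
    {a : ℝ × ℝ → ℝ} (ha : IsAmplitude L a) {θ : ℝ → ℝ} (hθ : PiecewiseContDiff 1 θ) :
    Decays r 1 fun e R φ => ∫ σ in (-1)..1, (θ σ : ℂ) * F.H a R φ (e * σ) := by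
  obtain ⟨g, hg, hgr⟩ := F.exists_amplitude_reciprocal hc hF
  have hint := fun a b (hab : a ≤ b) => hθ.intervalIntegrable hab
  obtain ⟨S, hS⟩ := hθ
  refine interval_induction (P := fun α β => -1 ≤ α → β ≤ 1 →
    Decays r 1 fun e R φ => ∫ σ in α..β, (θ σ : ℂ) * F.H a R φ (e * σ)) S ?_ ?_ ?_ (-1) 1
    (by norm_num) le_rfl le_rfl
  · intro α _ _
    simpa using Decays.zero
  · intro α β hαβ hSαβ hα hβ
    obtain ⟨G, hG, hGθ⟩ := hS α β hαβ hSαβ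
    have hG' : Continuous (deriv G) := hG.continuous_deriv (by simp)
    have hGd : ∀ x, HasDerivAt G (deriv G x) x := fun x =>
      (hG.differentiable (by simp) x).hasDerivAt
    have hn := fun i => F.isAmplitude_normalPart ha i
    have hl := fun i => F.isAmplitude_lowerPart ha hg i
    refine Decays.of_mul ?_
    have key : Decays r 0 fun e R φ => Complex.I * ∑ i : Fin 2, direction φ i *
        (G β * F.H (F.normalPart i a) R φ (e * β) - G α * F.H (F.normalPart i a) R φ (e * α) -
          (∫ σ in α..β, ((deriv G σ : ℝ) : ℂ) * F.H (F.normalPart i a) R φ (e * σ)) -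
          e * ∫ σ in α..β, (G σ : ℂ) * F.H (F.lowerPart g i a) R φ (e * σ)) := by
      refine Decays.sum_direction (G := fun i e R φ =>
        (G β * F.H (F.normalPart i a) R φ (e * β) - G α * F.H (F.normalPart i a) R φ (e * α) -
          (∫ σ in α..β, ((deriv G σ : ℝ) : ℂ) * F.H (F.normalPart i a) R φ (e * σ)) -
          e * ∫ σ in α..β, (G σ : ℂ) * F.H (F.lowerPart g i a) R φ (e * σ))) fun i => ?_
      refine ((Decays.sub ?_ ?_).sub ?_).sub ?_
      · exact (F.decays_H hL hc hr hF (hn i) ⟨by linarith, hβ⟩).const_mul _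
      · exact (F.decays_H hL hc hr hF (hn i) ⟨hα, by linarith⟩).const_mul _
      · exact F.decays_integral_H hL hc hr hF (hn i) hG' hα hαβ.le hβ
      · exact (F.decays_integral_H hL hc hr hF (hl i) hG.continuous hα hαβ.le hβ).width_mul
    refine key.congr fun e R φ he her => ?_
    -- On the open piece `θ` coincides with a `C¹` function on the line; the values of `θ` at the
    -- break points themselves play no role.
    rw [integral_congr_Ioo (g := fun σ => (G σ : ℂ) * F.H a R φ (e * σ)) hαβ.le fun σ hσ => by
      simp only [hGθ hσ]]
    exact (F.integral_mul_H_by_parts ha hg hgr countable_empty hαβ.le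
      (fun σ hσ => abs_mul_le_of_mem he her hα hβ hσ) hG.continuous.continuousOn
      (fun x _ => hGd x) (hG'.intervalIntegrable _ _) R φ).symm
  · intro α x β hαx hxβ h1 h2 hα hβ
    refine ((h1 hα (hxβ.trans hβ)).add (h2 (hα.trans hαx) hβ)).congr fun e R φ he her => ?_
    have cH : Continuous fun σ => F.H a R φ (e * σ) :=
      (F.continuous_H ha.smooth.continuous R).comp (f := fun σ : ℝ => (φ, e * σ)) (by fun_prop)
    have hi : ∀ a b, a ≤ b → IntervalIntegrable (fun σ => (θ σ : ℂ) * F.H _ R φ (e * σ)) volume a b :=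
      fun a b hab => IntervalIntegrable.mul_continuousOn
        ⟨(hint a b hab).1.ofReal, (hint a b hab).2.ofReal⟩ cH.continuousOn
    exact intervalIntegral.integral_add_adjacent_intervals (hi _ _ hαx) (hi _ _ hxβ)

/-- Mean-square decay of the Fourier transform of a layer with profile of order `q`. -/
theorem decays_integral_profile (hL : 0 < L) (hc : 0 < c) (hr : 0 < r) (hF : F.Regular c r)
    (q : ℕ) : ∀ {a : ℝ × ℝ → ℝ} (_ : IsAmplitude L a) {θ : ℝ → ℝ} (_ : IsProfile q θ),
    Decays r (q + 1) fun e R φ => ∫ σ in (-1)..1, (θ σ : ℂ) * F.H a R φ (e * σ) := by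
  obtain ⟨g, hg, hgr⟩ := F.exists_amplitude_reciprocal hc hF
  -- Amplitudes and profiles stay quantified in the induction, since integration by parts changes
  -- both: `θ'` appears with the normal part of the amplitude, `θ` with the lower-order part.
  induction q with
  | zero => exact fun ha θ hθ => F.decays_integral_profile_zero hL hc hr hF ha hθ.piecewise
  | succ q ih =>
    intro a ha θ hθ
    have hn := fun i => F.isAmplitude_normalPart ha i
    have hl := fun i => F.isAmplitude_lowerPart ha hg i
    obtain ⟨S, hS⟩ := hθ.piecewise.exists_finite_hasDerivAt
    refine Decays.of_mul ?_
    have key : Decays r (q + 1) fun e R φ => Complex.I * ∑ i : Fin 2, direction φ i *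
        (-1 * (∫ σ in (-1)..1, ((deriv θ σ : ℝ) : ℂ) * F.H (F.normalPart i a) R φ (e * σ)) -
          e * ∫ σ in (-1)..1, (θ σ : ℂ) * F.H (F.lowerPart g i a) R φ (e * σ)) := by
      refine Decays.sum_direction (G := fun i e R φ =>
        (-1 * (∫ σ in (-1)..1, ((deriv θ σ : ℝ) : ℂ) * F.H (F.normalPart i a) R φ (e * σ)) -
          e * ∫ σ in (-1)..1, (θ σ : ℂ) * F.H (F.lowerPart g i a) R φ (e * σ))) fun i => ?_
      exact ((ih (hn i) hθ.deriv).const_mul (-1)).sub (ih (hl i) hθ.of_succ).width_mul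
    refine key.congr fun e R φ he her => ?_
    rw [F.integral_mul_H_by_parts ha hg hgr S.countable_toSet (by norm_num)
      (fun σ hσ => abs_mul_le_of_mem he her le_rfl le_rfl hσ) hθ.continuous.continuousOn
      (fun x hx => hS x hx.2) (hθ.deriv.piecewise.intervalIntegrable (by norm_num)) R φ,
      hθ.eq_zero_of_one, hθ.eq_zero_of_neg_one]
    simp

end Frame

/-! ### Coordinates in the plane -/

theorem inner_plane (x y : Plane) : inner ℝ x y = x 0 * y 0 + x 1 * y 1 := by
  simp [PiLp.inner_apply, Fin.sum_univ_two, mul_comm]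

theorem norm_sq_plane (x : Plane) : ‖x‖ ^ 2 = x 0 ^ 2 + x 1 ^ 2 := by
  rw [← real_inner_self_eq_norm_sq, inner_plane]; ring

theorem hasDerivAt_coord {c : ℝ → Plane} {c' : Plane} {t : ℝ} (h : HasDerivAt c c' t) (i : Fin 2) :
    HasDerivAt (fun t => c t i) (c' i) t :=
  ((EuclideanSpace.proj (𝕜 := ℝ) i : Plane →L[ℝ] ℝ).hasFDerivAt (x := c t)).comp_hasDerivAt t h

theorem contDiff_coord {c : ℝ → Plane} (h : ContDiff ℝ ∞ c) (i : Fin 2) :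
    ContDiff ℝ ∞ fun t => c t i :=
  (EuclideanSpace.proj (𝕜 := ℝ) i : Plane →L[ℝ] ℝ).contDiff.comp h

/-! ### The Frenet frame of a closed curve -/

namespace IsSmoothClosedCurve

variable {γ : ℝ → Plane} {L : ℝ} (h : IsSmoothClosedCurve γ L)
include h

theorem contDiff_deriv : ContDiff ℝ ∞ (deriv γ) := h.smooth.iterate_deriv 1

theorem hasDerivAt (t : ℝ) : HasDerivAt γ (deriv γ t) t :=
  (h.smooth.differentiable (by simp) t).hasDerivAt

theorem hasDerivAt_deriv (t : ℝ) : HasDerivAt (deriv γ) (deriv (deriv γ) t) t :=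
  (h.contDiff_deriv.differentiable (by simp) t).hasDerivAt

theorem sq_add_sq (t : ℝ) : deriv γ t 0 ^ 2 + deriv γ t 1 ^ 2 = 1 := by
  rw [← norm_sq_plane, h.unit_speed, one_pow]

theorem signedCurvature_eq (t : ℝ) : signedCurvature γ t =
    deriv γ t 0 * deriv (deriv γ) t 1 - deriv γ t 1 * deriv (deriv γ) t 0 := by
  unfold signedCurvature; rw [h.unit_speed]; simp

theorem deriv_mul_deriv (t : ℝ) :
    deriv γ t 0 * deriv (deriv γ) t 0 + deriv γ t 1 * deriv (deriv γ) t 1 = 0 := by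
  have h0 := (hasDerivAt_coord (h.hasDerivAt_deriv t) 0).pow 2
  have h1 := (hasDerivAt_coord (h.hasDerivAt_deriv t) 1).pow 2
  have h2 := h0.add h1
  have e : (fun t => deriv γ t 0 ^ 2 + deriv γ t 1 ^ 2) = fun _ => (1 : ℝ) :=
    funext h.sq_add_sq
  have h3 := h2.unique (by
    have := hasDerivAt_const t (1 : ℝ)
    rw [← e] at this
    exact this)
  norm_num at h3
  linarith

theorem deriv_deriv_zero (t : ℝ) :
    deriv (deriv γ) t 0 = -(signedCurvature γ t * deriv γ t 1) := by
  rw [h.signedCurvature_eq]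
  linear_combination (-deriv (deriv γ) t 0) * h.sq_add_sq t + deriv γ t 0 * h.deriv_mul_deriv t

theorem deriv_deriv_one (t : ℝ) :
    deriv (deriv γ) t 1 = signedCurvature γ t * deriv γ t 0 := by
  rw [h.signedCurvature_eq]
  linear_combination (-deriv (deriv γ) t 1) * h.sq_add_sq t + deriv γ t 1 * h.deriv_mul_deriv t

theorem deriv_periodic : Function.Periodic (deriv γ) L := by
  intro x
  rw [← deriv_comp_add_const]
  congr 1
  exact funext h.periodic

theorem deriv_deriv_periodic : Function.Periodic (deriv (deriv γ)) L := by
  intro x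
  rw [← deriv_comp_add_const]
  congr 1
  exact funext h.deriv_periodic

theorem signedCurvature_periodic : Function.Periodic (signedCurvature γ) L := fun t => by
  unfold signedCurvature
  rw [h.deriv_periodic, h.deriv_deriv_periodic]

/-- The moving frame of a closed curve. -/
def frame : Frame L where
  X t := γ t 0
  Y t := γ t 1
  T₀ t := deriv γ t 0
  T₁ t := deriv γ t 1
  k := signedCurvature γ
  sX := contDiff_coord h.smooth 0
  sY := contDiff_coord h.smooth 1
  sT₀ := contDiff_coord h.contDiff_deriv 0
  sT₁ := contDiff_coord h.contDiff_deriv 1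
  sk := by
    have h2 : ContDiff ℝ ∞ (deriv (deriv γ)) := h.smooth.iterate_deriv 2
    rw [funext h.signedCurvature_eq]
    exact ((contDiff_coord h.contDiff_deriv 0).mul (contDiff_coord h2 1)).sub
      ((contDiff_coord h.contDiff_deriv 1).mul (contDiff_coord h2 0))
  hX t := hasDerivAt_coord (h.hasDerivAt t) 0
  hY t := hasDerivAt_coord (h.hasDerivAt t) 1
  hT₀ t := h.deriv_deriv_zero t ▸ hasDerivAt_coord (h.hasDerivAt_deriv t) 0
  hT₁ t := h.deriv_deriv_one t ▸ hasDerivAt_coord (h.hasDerivAt_deriv t) 1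
  unit := h.sq_add_sq
  pX t := by simp only [h.periodic t]
  pY t := by simp only [h.periodic t]
  pT₀ t := by simp only [h.deriv_periodic t]
  pT₁ t := by simp only [h.deriv_periodic t]
  pk := h.signedCurvature_periodic

theorem normal_periodic : Function.Periodic (normal γ) L := fun t => by
  unfold normal; rw [h.deriv_periodic]

theorem norm_normal (t : ℝ) : ‖normal γ t‖ = 1 := by
  have : ‖normal γ t‖ ^ 2 = 1 := by
    rw [norm_sq_plane, ← h.sq_add_sq t]; simp [normal]; ring
  nlinarith [norm_nonneg (normal γ t)]

omit h in
theorem inner_normal_deriv (t : ℝ) : inner ℝ (normal γ t) (deriv γ t) = 0 := by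
  rw [inner_plane]; simp [normal]; ring

theorem inner_normal_deriv_deriv (t : ℝ) :
    inner ℝ (normal γ t) (deriv (deriv γ) t) = -signedCurvature γ t := by
  rw [inner_plane, h.deriv_deriv_zero, h.deriv_deriv_one]
  simp only [normal, Fin.isValue, PiLp.toLp_apply, Matrix.cons_val_zero, Matrix.cons_val_one]
  linear_combination (-signedCurvature γ t) * h.sq_add_sq t

theorem eq_smul_normal {x : Plane} {t : ℝ} (hx : inner ℝ x (deriv γ t) = 0) :
    x = (inner ℝ (normal γ t) x : ℝ) • normal γ t := by
  rw [inner_plane] at hx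
  ext i
  rw [inner_plane]
  fin_cases i
  · simp [normal]
    linear_combination (-x 0) * h.sq_add_sq t + deriv γ t 0 * hx
  · simp [normal]
    linear_combination (-x 1) * h.sq_add_sq t + deriv γ t 1 * hx

/-- Two parameters of a point differ by periods. Hence periodic quantities, such as the normal and
the curvature, do not depend on the choice made in `footParam`. -/
theorem exists_eq_add_int_mul {a b : ℝ} (hab : γ a = γ b) : ∃ n : ℤ, a = b + n * L := by
  have hL := h.length_pos
  have key : ∀ x, ∃ n : ℤ, x - n * L ∈ Ico 0 L ∧ γ (x - n * L) = γ x := fun x => by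
    refine ⟨⌊x / L⌋, ⟨?_, ?_⟩, ?_⟩
    · have := Int.floor_le (x / L)
      rw [le_div_iff₀ hL] at this; linarith
    · have := Int.lt_floor_add_one (x / L)
      rw [div_lt_iff₀ hL] at this; linarith
    · exact h.periodic.sub_int_mul_eq _
  obtain ⟨n, hn, en⟩ := key a
  obtain ⟨m, hm, em⟩ := key b
  have := h.simple hn hm (by rw [en, em, hab])
  refine ⟨n - m, ?_⟩
  push_cast; linarith

theorem isCompact_range : IsCompact (range γ) := by
  have : range γ = γ '' Icc 0 L := by
    refine subset_antisymm ?_ (image_subset_range _ _)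
    rintro _ ⟨t, rfl⟩
    obtain ⟨y, hy, hty⟩ := h.periodic.exists_mem_Ico₀ h.length_pos t
    exact ⟨y, Ico_subset_Icc_self hy, hty.symm⟩
  rw [this]
  exact isCompact_Icc.image h.smooth.continuous

end IsSmoothClosedCurve

/-! ### Nearest points -/

section Nearest

variable {K : Set Plane} {ρ : ℝ}

theorem isNearest_proj (hK : ProjectionWellDefined K ρ) {x : Plane} (hx : Metric.infDist x K ≤ ρ) :
    IsNearest K x (proj K x) := Classical.epsilon_spec (hK x hx).exists

theorem IsNearest.eq_proj (hK : ProjectionWellDefined K ρ) {x y : Plane} (h : IsNearest K x y)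
    (hx : Metric.infDist x K ≤ ρ) : proj K x = y :=
  (hK x hx).unique (isNearest_proj hK hx) h

/-- Continuity of the projection at a point of uniqueness: by compactness the part of `K` away from
`p` is strictly farther from `z`, and moving by less than half of this gap cannot bring it closer
than the rest. -/
theorem exists_nearest_close (hc : IsCompact K) (hK : ProjectionWellDefined K ρ) {z p : Plane}
    (hz : Metric.infDist z K ≤ ρ) (hp : IsNearest K z p) {η : ℝ} (hη : 0 < η) :
    ∃ d, 0 < d ∧ ∀ y q, dist y z < d → IsNearest K y q → dist q p < η := by
  set K' : Set Plane := K \ Metric.ball p η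
  have hK'c : IsCompact K' := hc.diff Metric.isOpen_ball
  rcases K'.eq_empty_or_nonempty with he | hne
  · refine ⟨1, one_pos, fun y q _ hq => ?_⟩
    by_contra hlt
    have : q ∈ K' := ⟨hq.1, fun h => hlt h⟩
    rw [he] at this; exact this
  obtain ⟨p', hp', hd'⟩ := hK'c.exists_infDist_eq_dist hne z
  have hlt : Metric.infDist z K < Metric.infDist z K' := by
    have hle : Metric.infDist z K ≤ Metric.infDist z K' :=
      Metric.infDist_le_infDist_of_subset sdiff_subset hne
    refine lt_of_le_of_ne hle fun heq => ?_
    have h1 : IsNearest K z p' := ⟨hp'.1, by rw [heq, hd']⟩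
    have := (hK z hz).unique hp h1
    exact hp'.2 (by rw [← this]; exact Metric.mem_ball_self hη)
  refine ⟨(Metric.infDist z K' - Metric.infDist z K) / 2, by linarith, fun y q hy hq => ?_⟩
  by_contra hge
  have hq' : q ∈ K' := ⟨hq.1, hge⟩
  have h1 : Metric.infDist z K' ≤ Metric.infDist y K' + dist z y :=
    Metric.infDist_le_infDist_add_dist
  have h2 : Metric.infDist y K ≤ Metric.infDist z K + dist y z :=
    Metric.infDist_le_infDist_add_dist
  have h3 : Metric.infDist y K' ≤ dist y q := Metric.infDist_le_dist_of_mem hq'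
  rw [hq.2] at h3
  rw [dist_comm] at h1
  linarith

/-- Moving away from the nearest point increases the distance at nearly unit rate. -/
theorem exists_infDist_step (hc : IsCompact K) (hne : K.Nonempty)
    (hK : ProjectionWellDefined K ρ) {z p : Plane}
    (hz : Metric.infDist z K ≤ ρ) (hp : IsNearest K z p) (hd : 0 < dist z p) {e : ℝ} (he : 0 < e)
    (he1 : e < 1) : ∃ d, 0 < d ∧ ∀ τ, 0 < τ → τ < d →
      dist z p + τ * (1 - e) ≤ Metric.infDist (z + (τ / dist z p) • (z - p)) K := by
  -- With nearest points within `D e` of `p`, the inner product of `z - q` with the unit direction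
  -- of motion is at least `D (1 - e)`. Expanding the square then gives at least `(D + τ (1 - e))²`.
  obtain ⟨d, hd0, h⟩ := exists_nearest_close hc hK hz hp (mul_pos hd he)
  refine ⟨d, hd0, fun τ hτ hτd => ?_⟩
  set D := dist z p with hD
  set w : Plane := (1 / D) • (z - p) with hw
  have hDn : ‖z - p‖ = D := (dist_eq_norm z p).symm
  have hwn : ‖w‖ = 1 := by
    rw [hw, norm_smul, hDn, Real.norm_of_nonneg (by positivity)]; field_simp
  have hy : z + (τ / D) • (z - p) = z + τ • w := by
    rw [hw, smul_smul]; congr 2; ring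
  rw [hy]
  obtain ⟨q, hqK, hq⟩ := hc.exists_infDist_eq_dist hne (z + τ • w)
  have hyz : dist (z + τ • w) z < d := by
    rw [dist_eq_norm, add_sub_cancel_left, norm_smul, hwn, Real.norm_of_nonneg hτ.le, mul_one]
    exact hτd
  have hqp := h _ q hyz ⟨hqK, hq.symm⟩
  rw [hq]
  have h1 : D ≤ ‖z - q‖ := by
    rw [← dist_eq_norm, hD, hp.2]
    exact Metric.infDist_le_dist_of_mem hqK
  have h2 : D - D * e ≤ inner ℝ (z - q) w := by
    have e1 : inner ℝ (z - q) w = inner ℝ (z - p) w + inner ℝ (p - q) w := by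
      rw [← inner_add_left]; congr 1; abel
    have e2 : inner ℝ (z - p) w = D := by
      rw [hw, inner_smul_right, real_inner_self_eq_norm_sq, hDn]; field_simp
    have e3 : |inner ℝ (p - q) w| ≤ dist q p := by
      have := abs_real_inner_le_norm (p - q) w
      rwa [hwn, mul_one, ← dist_eq_norm, dist_comm] at this
    rw [e1, e2]
    linarith [(abs_le.1 e3).1]
  have h3 : dist (z + τ • w) q ^ 2 = ‖z - q‖ ^ 2 + 2 * τ * inner ℝ (z - q) w + τ ^ 2 := by
    rw [dist_eq_norm, show z + τ • w - q = (z - q) + τ • w by abel, norm_add_sq_real,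
      inner_smul_right, norm_smul, hwn, mul_one, Real.norm_of_nonneg hτ.le]
    ring
  have h4 : D ^ 2 ≤ ‖z - q‖ ^ 2 := by gcongr
  refine le_of_sq_le_sq ?_ dist_nonneg
  rw [h3]
  have h5 : τ * (D - D * e) ≤ τ * inner ℝ (z - q) w := by gcongr
  have h6 : (1 - e) ^ 2 ≤ 1 := by nlinarith
  nlinarith [mul_le_mul_of_nonneg_left h6 (sq_nonneg τ)]

/-- The nearest point stays the same along the normal ray as long as nearest points are unique. -/
theorem IsNearest.ray (hc : IsCompact K) (hne : K.Nonempty) (hK : ProjectionWellDefined K ρ)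
    {x p : Plane} (hp : IsNearest K x p) (hd : 0 < dist x p) {r : ℝ} (hr : 0 < r)
    (hrρ : dist x p + r < ρ) : IsNearest K (x + (r / dist x p) • (x - p)) p := by
  set D := dist x p with hD
  have hcomp : IsCompact (Metric.closedBall x r) := isCompact_closedBall x r
  have hbne : (Metric.closedBall x r).Nonempty := ⟨x, Metric.mem_closedBall_self hr.le⟩
  have hup : ∀ z ∈ Metric.closedBall x r, Metric.infDist z K ≤ D + r := fun z hz => by
    have h1 : Metric.infDist z K ≤ Metric.infDist x K + dist z x :=
      Metric.infDist_le_infDist_add_dist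
    rw [← hp.2] at h1
    have := Metric.mem_closedBall.1 hz
    linarith
  -- A variational argument: maximize the distance to `K` minus `1 - e` times the distance to `x`
  -- over the ball. At a maximizer inside the ball, a small step away from its nearest point gains
  -- `τ (1 - e/2)` and costs at most `τ (1 - e)`, a contradiction. So the maximizer lies on the
  -- sphere, and comparison with the centre gives the estimate.
  have reach : ∀ e : ℝ, 0 < e → e < 1 →
      ∃ z ∈ Metric.closedBall x r, D + (1 - e) * r ≤ Metric.infDist z K := by
    intro e he he1
    obtain ⟨z, hz, hmax⟩ := hcomp.exists_isMaxOn hbne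
      (f := fun z => Metric.infDist z K - (1 - e) * dist z x)
      (by
        have := Metric.continuous_infDist_pt K
        fun_prop)
    have hx0 := hmax (Metric.mem_closedBall_self hr.le)
    simp only [dist_self, mul_zero, sub_zero, mem_ofPred_eq, ← hp.2] at hx0
    change D ≤ _ at hx0
    have hzr := Metric.mem_closedBall.1 hz
    rcases hzr.eq_or_lt with heq | hlt
    · exact ⟨z, hz, by rw [heq] at hx0; linarith⟩
    exfalso
    obtain ⟨q, hqK, hq⟩ := hc.exists_infDist_eq_dist hne z
    have hdz : 0 ≤ (1 - e) * dist z x := mul_nonneg (by linarith) dist_nonneg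
    have hzpos : 0 < dist z q := by rw [← hq]; linarith
    obtain ⟨d, hd0, hstep⟩ := exists_infDist_step hc hne hK (z := z) (p := q)
      ((hup z hz).trans hrρ.le) ⟨hqK, hq.symm⟩ hzpos (e := e / 2) (by linarith) (by linarith)
    obtain ⟨τ, hτ0, hτ⟩ := exists_between (lt_min hd0 (sub_pos.2 hlt))
    have hτd := hτ.trans_le (min_le_left _ _)
    have hτr := hτ.trans_le (min_le_right _ _)
    have h1 := hstep τ hτ0 hτd
    set y := z + (τ / dist z q) • (z - q)
    have hyz : dist y z = τ := by
      rw [dist_eq_norm, add_sub_cancel_left, norm_smul, ← dist_eq_norm,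
        Real.norm_of_nonneg (by positivity)]
      field_simp
    have hyx : dist y x ≤ dist z x + τ := by
      have := dist_triangle y z x
      linarith
    have h2 := hmax (show y ∈ Metric.closedBall x r from Metric.mem_closedBall.2 (by linarith))
    simp only [mem_ofPred_eq] at h2
    rw [hq] at h2
    nlinarith
  obtain ⟨z, hz, hmax⟩ := hcomp.exists_isMaxOn hbne (Metric.continuous_infDist_pt K).continuousOn
  have hzK : D + r ≤ Metric.infDist z K := by
    refine le_of_forall_pos_le_add fun e' he' => ?_
    obtain ⟨e, he, he2⟩ := exists_between (lt_min one_pos (div_pos he' hr))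
    have he1 := he2.trans_le (min_le_left _ _)
    have her := he2.trans_le (min_le_right _ _)
    rw [lt_div_iff₀ hr] at her
    obtain ⟨z', hz', h'⟩ := reach e he he1
    have := hmax hz'
    simp only [mem_ofPred_eq] at this
    linarith
  have hzp : D + r ≤ dist z p := hzK.trans (Metric.infDist_le_dist_of_mem hp.1)
  have htri := dist_triangle z x p
  have hzx := Metric.mem_closedBall.1 hz
  have hzxr : dist z x = r := by linarith
  have hzpe : dist z p = D + r := by linarith
  -- Letting `e → 0` yields a point of the ball at distance `D + r` from `K`. It attains equality in
  -- the triangle inequality through `x`, so it is the end point of the ray.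
  have hray : SameRay ℝ (z - x) (x - p) := by
    rw [sameRay_iff_norm_add, sub_add_sub_cancel, ← dist_eq_norm, ← dist_eq_norm, ← dist_eq_norm,
      hzpe, hzxr]
    ring
  have hs := hray.norm_smul_eq
  rw [← dist_eq_norm, ← dist_eq_norm, hzxr] at hs
  have hz_eq : x + (r / D) • (x - p) = z := by
    have h1 : (r / D) • (x - p) = z - x := by
      rw [div_eq_inv_mul, mul_smul, hs, ← hD, smul_smul, inv_mul_cancel₀ hd.ne', one_smul]
    rw [h1]; abel
  rw [hz_eq]
  refine ⟨hp.1, le_antisymm ?_ (Metric.infDist_le_dist_of_mem hp.1)⟩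
  linarith

end Nearest

/-! ### Tube coordinates: nearest points along normals and regularity -/

theorem hasDerivAt_plane {c : ℝ → Plane} {c' : Plane} {t : ℝ}
    (h : ∀ i, HasDerivAt (fun t => c t i) (c' i) t) : HasDerivAt c c' t :=
  ((EuclideanSpace.equiv (Fin 2) ℝ).symm.toContinuousLinearMap.hasFDerivAt).comp_hasDerivAt t
    (hasDerivAt_pi.2 h)

/-- The point of tube coordinates `(t, s)`. -/
def tubePoint (γ : ℝ → Plane) (t s : ℝ) : Plane := γ t + s • normal γ t

namespace IsSmoothClosedCurve

variable {γ : ℝ → Plane} {L ρ : ℝ} (h : IsSmoothClosedCurve γ L)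
include h

/-- The normal component of `γ u - γ t` has zero derivative at `t`, so it is `O((u - t)²)`; and `|u
- t|` is controlled by the chord because the speed does not vanish. -/
theorem exists_local_normal_bound (t : ℝ) : ∃ C, ∀ᶠ u in 𝓝 t,
    |inner ℝ (normal γ t) (γ u - γ t)| ≤ C * ‖γ u - γ t‖ ^ 2 := by
  have hne : deriv γ t ≠ 0 := fun h0 => by
    have := h.unit_speed t; rw [h0, norm_zero] at this; norm_num at this
  have hf' : ∀ u, HasDerivAt (fun u => inner ℝ (normal γ t) (γ u - γ t))
      (inner ℝ (normal γ t) (deriv γ u)) u := fun u => by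
    simpa using (hasDerivAt_const u (normal γ t)).inner ℝ ((h.hasDerivAt u).sub_const (γ t))
  have hf'' : HasDerivAt (fun u => inner ℝ (normal γ t) (deriv γ u))
      (inner ℝ (normal γ t) (deriv (deriv γ) t)) t := by
    simpa using (hasDerivAt_const t (normal γ t)).inner ℝ (h.hasDerivAt_deriv t)
  obtain ⟨C, hC⟩ := hf''.isBigO_sub.bound
  obtain ⟨M, hM⟩ := ((h.hasDerivAt t).isTheta_sub hne).2.bound
  rw [prod_pure, eventually_map] at hM
  obtain ⟨δ, hδ, hball⟩ := Metric.eventually_nhds_iff.1 hC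
  refine ⟨|C| * M ^ 2, ?_⟩
  filter_upwards [hM, Metric.ball_mem_nhds t hδ] with u hu huδ
  have hconv := (convex_closedBall t |u - t|).norm_image_sub_le_of_norm_hasDerivWithin_le
    (f := fun u => inner ℝ (normal γ t) (γ u - γ t))
    (f' := fun u => inner ℝ (normal γ t) (deriv γ u)) (C := |C| * |u - t|)
    (fun x _ => (hf' x).hasDerivWithinAt)
    (fun x hx => by
      rw [Metric.mem_closedBall, Real.dist_eq] at hx
      rw [Metric.mem_ball, Real.dist_eq] at huδ
      have := hball (y := x) (by rw [Real.dist_eq]; linarith)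
      simp only [inner_normal_deriv, sub_zero] at this
      refine this.trans ?_
      rw [Real.norm_eq_abs]
      have := le_abs_self C
      gcongr)
    (Metric.mem_closedBall_self (abs_nonneg _))
    (show u ∈ Metric.closedBall t |u - t| by rw [Metric.mem_closedBall, Real.dist_eq])
  simp only [sub_self, inner_zero_right, sub_zero, Real.norm_eq_abs] at hconv
  rw [Real.norm_eq_abs] at hu
  calc _ ≤ |C| * |u - t| * |u - t| := hconv
    _ = |C| * |u - t| ^ 2 := by ring
    _ ≤ |C| * (M * ‖γ u - γ t‖) ^ 2 := by gcongr
    _ = _ := by ring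

/-- Away from `t` within one period, injectivity and compactness bound the chord below, and a linear
bound becomes a quadratic one. -/
theorem exists_normal_bound (t : ℝ) : ∃ C, 0 < C ∧ ∀ u,
    |inner ℝ (normal γ t) (γ u - γ t)| ≤ C * ‖γ u - γ t‖ ^ 2 := by
  obtain ⟨C, hC⟩ := h.exists_local_normal_bound t
  obtain ⟨δ, hδ, hball⟩ := Metric.eventually_nhds_iff.1 hC
  have hL := h.length_pos
  have hcomp : IsCompact (Icc (t - L / 2) (t - L / 2 + L) \ Metric.ball t δ) :=
    isCompact_Icc.diff Metric.isOpen_ball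
  have hcont : ContinuousOn (fun u => ‖γ u - γ t‖⁻¹)
      (Icc (t - L / 2) (t - L / 2 + L) \ Metric.ball t δ) := by
    refine ContinuousOn.inv₀ ?_ fun u hu h0 => ?_
    · have := h.smooth.continuous
      fun_prop
    · rw [norm_eq_zero, sub_eq_zero] at h0
      obtain ⟨n, hn⟩ := h.exists_eq_add_int_mul h0
      have h1 : |(n : ℝ) * L| ≤ L / 2 := by
        rw [abs_le]; constructor <;> linarith [hu.1.1, hu.1.2]
      rw [abs_mul, abs_of_pos hL] at h1
      have h2 : |(n : ℝ)| < 1 := by nlinarith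
      have h3 : n = 0 := Int.abs_lt_one_iff.1 (by exact_mod_cast h2)
      rw [h3, Int.cast_zero, zero_mul, add_zero] at hn
      exact hu.2 (hn ▸ Metric.mem_ball_self hδ)
  obtain ⟨M, hM⟩ := hcomp.exists_bound_of_continuousOn hcont
  refine ⟨|C| + |M| + 1, by positivity, fun u => ?_⟩
  obtain ⟨v, hv, huv⟩ := h.periodic.exists_mem_Ico hL u (t - L / 2)
  rw [huv]
  have hsq := sq_nonneg ‖γ v - γ t‖
  by_cases hvδ : dist v t < δ
  · refine (hball hvδ).trans ?_
    have := le_abs_self C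
    have := abs_nonneg M
    nlinarith
  · have h1 := hM v ⟨Ico_subset_Icc_self hv, hvδ⟩
    rw [norm_inv, norm_norm] at h1
    have h2 := abs_real_inner_le_norm (normal γ t) (γ v - γ t)
    rw [h.norm_normal, one_mul] at h2
    refine h2.trans ?_
    rcases eq_or_ne ‖γ v - γ t‖ 0 with h0 | h0
    · rw [h0]; simp
    have hpos : 0 < ‖γ v - γ t‖ := lt_of_le_of_ne (norm_nonneg _) (Ne.symm h0)
    have h3 : 1 ≤ |M| * ‖γ v - γ t‖ := by
      have := h1.trans (le_abs_self M)
      rwa [inv_le_iff_one_le_mul₀ hpos] at this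
    have := abs_nonneg C
    nlinarith

theorem norm_smul_normal (t s : ℝ) : ‖s • normal γ t‖ = |s| := by
  rw [norm_smul, h.norm_normal, mul_one, Real.norm_eq_abs]

theorem dist_tubePoint (t s : ℝ) : dist (tubePoint γ t s) (γ t) = |s| := by
  rw [dist_eq_norm, tubePoint, add_sub_cancel_left, h.norm_smul_normal]

omit h in
theorem isNearest_of_forall {K : Set Plane} {x p : Plane} (hp : p ∈ K)
    (hle : ∀ q ∈ K, dist x p ≤ dist x q) : IsNearest K x p :=
  ⟨hp, le_antisymm ((Metric.le_infDist ⟨p, hp⟩).2 hle) (Metric.infDist_le_dist_of_mem hp)⟩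

/-- Expanding the squared distance, the cross term is at most half of the squared chord once `|s| ≤
1/(2C)`: a ball of that radius touches the curve from either side. -/
theorem exists_isNearest_small (t : ℝ) :
    ∃ s₀, 0 < s₀ ∧ ∀ s, |s| ≤ s₀ → IsNearest (range γ) (tubePoint γ t s) (γ t) := by
  obtain ⟨C, hC, hb⟩ := h.exists_normal_bound t
  refine ⟨1 / (2 * C), by positivity, fun s hs => isNearest_of_forall (mem_range_self t) ?_⟩
  rintro _ ⟨u, rfl⟩
  rw [h.dist_tubePoint]
  refine le_of_sq_le_sq ?_ dist_nonneg
  have e : dist (tubePoint γ t s) (γ u) ^ 2 =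
      s ^ 2 - 2 * (s * inner ℝ (normal γ t) (γ u - γ t)) + ‖γ u - γ t‖ ^ 2 := by
    rw [dist_eq_norm, show tubePoint γ t s - γ u = s • normal γ t - (γ u - γ t) by
      unfold tubePoint; abel, norm_sub_sq_real, h.norm_smul_normal, sq_abs, real_inner_smul_left]
  rw [e, sq_abs]
  have h1 : s * inner ℝ (normal γ t) (γ u - γ t) ≤ 1 / (2 * C) * (C * ‖γ u - γ t‖ ^ 2) := by
    refine (le_abs_self _).trans ?_
    rw [abs_mul]
    exact mul_le_mul hs (hb u) (abs_nonneg _) (by positivity)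
  have h2 : 1 / (2 * C) * (C * ‖γ u - γ t‖ ^ 2) = ‖γ u - γ t‖ ^ 2 / 2 := by field_simp
  linarith

/-- For small `s` the touching ball decides; from there uniqueness of nearest points carries the
foot along the normal ray (`IsNearest.ray`) as long as `|s| < ρ`. -/
theorem isNearest_tubePoint (hK : ProjectionWellDefined (range γ) ρ) {t s : ℝ} (hs : |s| < ρ) :
    IsNearest (range γ) (tubePoint γ t s) (γ t) := by
  obtain ⟨s₀, hs₀, hsmall⟩ := h.exists_isNearest_small t
  rcases le_or_gt |s| s₀ with hle | hgt
  · exact hsmall s hle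
  have hspos : 0 < |s| := hs₀.trans hgt
  set s₁ := s₀ / |s| * s with hs₁
  have hs₁a : |s₁| = s₀ := by
    rw [hs₁, abs_mul, abs_div, abs_abs, abs_of_pos hs₀]; field_simp
  have hd : dist (tubePoint γ t s₁) (γ t) = s₀ := by rw [h.dist_tubePoint, hs₁a]
  have hray := (hsmall s₁ hs₁a.le).ray h.isCompact_range ⟨_, mem_range_self 0⟩ hK
    (by rw [hd]; exact hs₀) (r := |s| - s₀) (by linarith) (by rw [hd]; linarith)
  rw [hd] at hray
  convert hray using 1
  unfold tubePoint
  rw [add_sub_cancel_left, smul_smul, add_assoc, ← add_smul]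
  congr 2
  rw [hs₁]
  field_simp
  ring

theorem infDist_tubePoint (hK : ProjectionWellDefined (range γ) ρ) {t s : ℝ} (hs : |s| < ρ) :
    Metric.infDist (tubePoint γ t s) (range γ) = |s| := by
  rw [← (h.isNearest_tubePoint hK hs).2, h.dist_tubePoint]

theorem hasDerivAt_dist_sq (x : Plane) (u : ℝ) : HasDerivAt (fun u => ‖x - γ u‖ ^ 2)
    (-2 * inner ℝ (x - γ u) (deriv γ u)) u := by
  have := ((h.hasDerivAt u).const_sub x).norm_sq
  rw [inner_neg_right] at this
  simpa using this

/-- First-order condition: at a nearest point the difference is orthogonal to the tangent. -/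
theorem exists_tubePoint (x : Plane) :
    ∃ t ∈ Ico 0 L, ∃ s, |s| = Metric.infDist x (range γ) ∧ tubePoint γ t s = x := by
  obtain ⟨p, ⟨u, rfl⟩, hu⟩ := h.isCompact_range.exists_infDist_eq_dist ⟨_, mem_range_self 0⟩ x
  obtain ⟨t, ht, hut⟩ := h.periodic.exists_mem_Ico₀ h.length_pos u
  rw [hut] at hu
  have hmin : IsLocalMin (fun u => ‖x - γ u‖ ^ 2) t := Eventually.of_forall fun v => by
    have : dist x (γ t) ≤ dist x (γ v) := hu ▸ Metric.infDist_le_dist_of_mem (mem_range_self v)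
    rw [dist_eq_norm, dist_eq_norm] at this
    simp only
    gcongr
  have h0 := hmin.hasDerivAt_eq_zero (h.hasDerivAt_dist_sq x t)
  have h1 : inner ℝ (x - γ t) (deriv γ t) = 0 := by linarith
  have h2 := h.eq_smul_normal h1
  refine ⟨t, ht, inner ℝ (normal γ t) (x - γ t), ?_, ?_⟩
  · rw [hu, dist_eq_norm]
    conv_rhs => rw [h2]
    rw [h.norm_smul_normal]
  · rw [tubePoint, ← h2]; abel

/-- Second-order condition: `2 (1 + s k)` is the second derivative at `t` of the squared distance to
the point, which has a minimum there. -/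
theorem one_add_mul_nonneg (hK : ProjectionWellDefined (range γ) ρ) {t s : ℝ} (hs : |s| < ρ) :
    0 ≤ 1 + s * signedCurvature γ t := by
  set x := tubePoint γ t s with hx
  set Φ : ℝ → ℝ := fun u => ‖x - γ u‖ ^ 2 with hΦ
  have hd : deriv Φ = fun u => -2 * inner ℝ (x - γ u) (deriv γ u) :=
    funext fun u => (h.hasDerivAt_dist_sq x u).deriv
  have hxt : x - γ t = s • normal γ t := by rw [hx, tubePoint, add_sub_cancel_left]
  have hdd : deriv (deriv Φ) t = 2 * (1 + s * signedCurvature γ t) := by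
    rw [hd]
    have h1 := ((((h.hasDerivAt t).const_sub x).inner ℝ (h.hasDerivAt_deriv t)).const_mul (-2)).deriv
    rw [h1, hxt, real_inner_smul_left, h.inner_normal_deriv_deriv, inner_neg_left,
      real_inner_self_eq_norm_sq, h.unit_speed]
    ring
  have hmin : IsLocalMin Φ t := Eventually.of_forall fun v => by
    have hn := h.isNearest_tubePoint hK (t := t) hs
    have : dist x (γ t) ≤ dist x (γ v) := by
      rw [hn.2]; exact Metric.infDist_le_dist_of_mem (mem_range_self v)
    rw [dist_eq_norm, dist_eq_norm] at this
    simp only [hΦ]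
    gcongr
  by_contra! hneg
  have hcont : ContinuousAt Φ t := (h.hasDerivAt_dist_sq x t).continuousAt
  have hmax := isLocalMax_of_deriv_deriv_neg (f := Φ) (by rw [hdd]; linarith)
    (hmin.deriv_eq_zero) hcont
  -- A negative second derivative would make the minimum also a maximum, hence `Φ` locally constant
  -- with zero second derivative.
  have hconst : Φ =ᶠ[𝓝 t] fun _ => Φ t := by
    filter_upwards [hmin, hmax] with u h1 h2 using le_antisymm h2 h1
  have h3 : deriv Φ =ᶠ[𝓝 t] fun _ => 0 := by
    have := hconst.deriv
    simpa using this
  have h4 := h3.deriv_eq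
  rw [hdd] at h4
  simp at h4
  linarith

/-- Nonnegativity holds up to `ρ`, beyond `ρ'`. Stretching `s` by a factor `l` strictly between `1`
and `ρ / ρ'` gives `1 + l s k ≥ 0`, that is `1 + s k ≥ 1 - 1/l`. -/
theorem exists_regular {ρ' : ℝ} (hK : ProjectionWellDefined (range γ) ρ) (hρ'0 : 0 < ρ')
    (hρ' : ρ' < ρ) : ∃ c, 0 < c ∧ h.frame.Regular c ρ' := by
  set l := (1 + ρ / ρ') / 2 with hl
  have h1 : 1 < ρ / ρ' := by rwa [one_lt_div hρ'0]
  have hl1 : 1 < l := by rw [hl]; linarith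
  have hlρ : l * ρ' < ρ := by
    have : l < ρ / ρ' := by rw [hl]; linarith
    rwa [lt_div_iff₀ hρ'0] at this
  have hl0 : 0 < l := by linarith
  refine ⟨1 - 1 / l, ?_, fun t s hs => ?_⟩
  · rw [sub_pos, div_lt_one hl0]; exact hl1
  · have h2 := h.one_add_mul_nonneg hK (t := t) (s := l * s) (by
      rw [abs_mul, abs_of_pos hl0]
      calc l * |s| ≤ l * ρ' := by gcongr
        _ < ρ := hlρ)
    change 1 - 1 / l ≤ 1 + s * signedCurvature γ t
    have h3 : -(1 / l) ≤ s * signedCurvature γ t := by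
      rw [neg_le, ← mul_one (-_), le_div_iff₀ hl0]
      linarith
    linarith

/-! ### The integrand in tube coordinates -/

theorem hasDerivAt_normal (t : ℝ) : HasDerivAt (normal γ) (signedCurvature γ t • deriv γ t) t := by
  have h0 := hasDerivAt_coord (h.hasDerivAt_deriv t) 0
  have h1 := hasDerivAt_coord (h.hasDerivAt_deriv t) 1
  rw [h.deriv_deriv_zero] at h0
  rw [h.deriv_deriv_one] at h1
  refine hasDerivAt_plane fun i => ?_
  fin_cases i
  · simpa [normal] using h1
  · have h2 := h0.neg
    rw [neg_neg] at h2
    simpa [normal] using (show HasDerivAt (fun t => -(deriv γ t 0)) _ t from h2)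

theorem hasDerivAt_tubePoint (s t : ℝ) : HasDerivAt (fun t => tubePoint γ t s)
    ((1 + s * signedCurvature γ t) • deriv γ t) t := by
  have := (h.hasDerivAt t).add ((h.hasDerivAt_normal t).const_smul s)
  rwa [smul_smul, show deriv γ t + (s * signedCurvature γ t) • deriv γ t =
    (1 + s * signedCurvature γ t) • deriv γ t by rw [add_smul, one_smul]] at this

/-- The radius of curvature `1/k` becomes `1/k + s` on the parallel curve; the formula in this form
remains valid at inflections. -/
theorem signedCurvature_tubePoint {s t : ℝ} (hpos : 0 < 1 + s * signedCurvature γ t) :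
    signedCurvature (fun t => tubePoint γ t s) t =
      signedCurvature γ t / (1 + s * signedCurvature γ t) := by
  have hd : deriv (fun t => tubePoint γ t s) = fun t => (1 + s * signedCurvature γ t) • deriv γ t :=
    funext fun t => (h.hasDerivAt_tubePoint s t).deriv
  have hk : HasDerivAt (signedCurvature γ) (deriv (signedCurvature γ) t) t :=
    (h.frame.sk.differentiable (by simp) t).hasDerivAt
  have hdd := ((((hk.const_mul s).const_add 1)).smul (h.hasDerivAt_deriv t)).deriv
  unfold signedCurvature
  rw [hd]
  change _ / _ = signedCurvature γ t / (1 + s * signedCurvature γ t)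
  have hdd' : deriv (fun t => (1 + s * signedCurvature γ t) • deriv γ t) t =
    (1 + s * signedCurvature γ t) • deriv (deriv γ) t +
      (s * deriv (signedCurvature γ) t) • deriv γ t := hdd
  rw [hdd', norm_smul, h.unit_speed, mul_one, Real.norm_of_nonneg hpos.le]
  simp only [PiLp.smul_apply, PiLp.add_apply, smul_eq_mul, h.deriv_deriv_zero, h.deriv_deriv_one]
  rw [div_eq_div_iff (by positivity) hpos.ne']
  linear_combination ((1 + s * signedCurvature γ t) ^ 3 * signedCurvature γ t) * h.sq_add_sq t

/-- Here `J = 1 - s k / (1 + s k) = 1 / (1 + s k)`, the reciprocal of the area element. -/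
theorem tubeIntegrand_tubePoint (hK : ProjectionWellDefined (range γ) ρ) (f : Plane → ℝ)
    (θ : ℝ → ℝ) (ε : ℝ) {t s : ℝ} (hs : |s| < ρ) (hpos : 0 < 1 + s * signedCurvature γ t) :
    tubeIntegrand γ f θ ε (tubePoint γ t s) =
      f (γ t) * scaledWeight θ ε s * (1 + s * signedCurvature γ t)⁻¹ := by
  have hproj : proj (range γ) (tubePoint γ t s) = γ t :=
    (h.isNearest_tubePoint hK hs).eq_proj hK (by rw [h.infDist_tubePoint hK hs]; exact hs.le)
  have hfoot : γ (footParam γ (tubePoint γ t s)) = γ t := by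
    rw [← hproj]
    exact Classical.epsilon_spec (p := fun t' => γ t' = proj (range γ) (tubePoint γ t s))
      ⟨t, hproj.symm⟩
  obtain ⟨n, hn⟩ := h.exists_eq_add_int_mul hfoot
  have hnormal : normal γ (footParam γ (tubePoint γ t s)) = normal γ t := by
    rw [hn]; exact h.normal_periodic.int_mul n t
  have hcurv : signedCurvature γ (footParam γ (tubePoint γ t s)) = signedCurvature γ t := by
    rw [hn]; exact h.signedCurvature_periodic.int_mul n t
  have hsd : signedDist γ (tubePoint γ t s) = s := by
    unfold signedDist
    rw [hnormal, hproj, tubePoint, add_sub_cancel_left, real_inner_smul_right,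
      real_inner_self_eq_norm_sq, h.norm_normal]
    simp
  unfold tubeIntegrand jacobian
  rw [hproj, hsd]
  have hj := h.signedCurvature_tubePoint (s := s) (t := footParam γ (tubePoint γ t s))
    (by rw [hcurv]; exact hpos)
  unfold tubePoint at hj
  unfold tubePoint at hcurv ⊢
  rw [hj, hcurv]
  congr 1
  field_simp
  ring

end IsSmoothClosedCurve

/-! ### Integration in tube coordinates -/

theorem PiecewiseContDiff.measurable {n : ℕ} {θ : ℝ → ℝ} (h : PiecewiseContDiff (n + 1) θ) :
    Measurable θ := by
  obtain ⟨S, hS⟩ := h.exists_finite_hasDerivAt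
  refine measurable_of_measurable_on_compl_finite (S : Set ℝ) S.finite_toSet ?_
  refine Continuous.measurable ?_
  rw [← continuousOn_iff_continuous_domRestrict]
  exact fun x hx => (hS x hx).continuousAt.continuousWithinAt

/-- The plane as a product. -/
def planeEquiv : ℝ × ℝ ≃ᵐ Plane :=
  MeasurableEquiv.finTwoArrow.symm.trans (MeasurableEquiv.toLp 2 (Fin 2 → ℝ))

theorem planeEquiv_apply (p : ℝ × ℝ) : planeEquiv p = !₂[p.1, p.2] := rfl

theorem measurePreserving_planeEquiv : MeasurePreserving planeEquiv :=
  (volume_preserving_finTwoArrow ℝ).symm.trans (PiLp.volume_preserving_toLp (Fin 2))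

/-- The integrand of the quadrature, extended by zero off the tube. -/
def layer (γ : ℝ → Plane) (f : Plane → ℝ) (θ : ℝ → ℝ) (ε : ℝ) : Plane → ℝ :=
  (tube (range γ) ε).indicator (tubeIntegrand γ f θ ε)

namespace IsSmoothClosedCurve

variable {γ : ℝ → Plane} {L ρ c r ε : ℝ} (h : IsSmoothClosedCurve γ L)
include h

/-- Tube coordinates, as a map of the product. -/
def tubeMap (p : ℝ × ℝ) : ℝ × ℝ :=
  (h.frame.X p.2 + p.1 * h.frame.T₁ p.2, h.frame.Y p.2 - p.1 * h.frame.T₀ p.2)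

theorem planeEquiv_tubeMap (p : ℝ × ℝ) : planeEquiv (h.tubeMap p) = tubePoint γ p.2 p.1 := by
  rw [planeEquiv_apply]
  ext i
  fin_cases i
  · simp [tubeMap, tubePoint, normal, frame]
  · simp [tubeMap, tubePoint, normal, frame, sub_eq_add_neg]

/-- The derivative of the tube coordinates. -/
def tubeMapDeriv (p : ℝ × ℝ) : ℝ × ℝ →L[ℝ] ℝ × ℝ :=
  (Matrix.toLin (.finTwoProd ℝ) (.finTwoProd ℝ)
    !![h.frame.T₁ p.2, (1 + p.1 * h.frame.k p.2) * h.frame.T₀ p.2;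
      -h.frame.T₀ p.2, (1 + p.1 * h.frame.k p.2) * h.frame.T₁ p.2]).toContinuousLinearMap

theorem hasFDerivAt_tubeMap (p : ℝ × ℝ) : HasFDerivAt h.tubeMap (h.tubeMapDeriv p) p := by
  unfold tubeMapDeriv
  rw [Matrix.toLin_finTwoProd_toContinuousLinearMap]
  have hs : HasFDerivAt (Prod.snd : ℝ × ℝ → ℝ) (ContinuousLinearMap.snd ℝ ℝ ℝ) p := hasFDerivAt_snd
  have hf : HasFDerivAt (Prod.fst : ℝ × ℝ → ℝ) (ContinuousLinearMap.fst ℝ ℝ ℝ) p := hasFDerivAt_fst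
  have d0 := ((h.frame.hX p.2).comp_hasFDerivAt p hs).add
    (hf.mul ((h.frame.hT₁ p.2).comp_hasFDerivAt p hs))
  have d1 := ((h.frame.hY p.2).comp_hasFDerivAt p hs).sub
    (hf.mul ((h.frame.hT₀ p.2).comp_hasFDerivAt p hs))
  refine (d0.prodMk d1).congr_fderiv ?_
  ext <;> simp <;> ring

theorem det_tubeMapDeriv (p : ℝ × ℝ) : (h.tubeMapDeriv p).det = 1 + p.1 * h.frame.k p.2 := by
  unfold tubeMapDeriv
  simp only [LinearMap.det_toContinuousLinearMap, LinearMap.det_toLin, Matrix.det_fin_two_of]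
  linear_combination (1 + p.1 * h.frame.k p.2) * h.frame.unit p.2

/-- The parameters of the tube. -/
def tubeBox (_ : IsSmoothClosedCurve γ L) (ε : ℝ) : Set (ℝ × ℝ) := Icc (-ε) ε ×ˢ Ico 0 L

theorem measurableSet_tubeBox : MeasurableSet (h.tubeBox ε) := measurableSet_Icc.prod measurableSet_Ico

theorem injOn_tubePoint (hK : ProjectionWellDefined (range γ) ρ) (hε : ε < ρ) :
    InjOn (fun p : ℝ × ℝ => tubePoint γ p.2 p.1) (h.tubeBox ε) := by
  rintro ⟨s, t⟩ hp ⟨s', t'⟩ hp' heq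
  simp only at heq
  have hs : |s| < ρ := (abs_le.2 hp.1).trans_lt hε
  have hs' : |s'| < ρ := (abs_le.2 hp'.1).trans_lt hε
  have h1 := h.isNearest_tubePoint hK (t := t) hs
  have h2 := h.isNearest_tubePoint hK (t := t') hs'
  rw [heq] at h1
  have h3 : γ t = γ t' := (hK (tubePoint γ t' s') (by
    change Metric.infDist _ _ ≤ ρ
    rw [h.infDist_tubePoint hK hs']; exact hs'.le)).unique h1 h2
  have h4 : t = t' := h.simple hp.2 hp'.2 h3
  subst h4
  simp only [tubePoint, add_right_inj] at heq
  have h5 : normal γ t ≠ 0 := fun h0 => by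
    have := h.norm_normal t; rw [h0, norm_zero] at this; norm_num at this
  rw [smul_left_injective ℝ h5 heq]

theorem image_tubePoint (hK : ProjectionWellDefined (range γ) ρ) (hε : ε < ρ) :
    (fun p : ℝ × ℝ => tubePoint γ p.2 p.1) '' h.tubeBox ε = tube (range γ) ε := by
  ext x
  constructor
  · rintro ⟨⟨s, t⟩, hp, rfl⟩
    have hs : |s| ≤ ε := abs_le.2 hp.1
    change Metric.infDist _ _ ≤ ε
    rwa [h.infDist_tubePoint hK (hs.trans_lt hε)]
  · intro hx
    obtain ⟨t, ht, s, hs, rfl⟩ := h.exists_tubePoint x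
    exact ⟨(s, t), ⟨abs_le.1 (hs.trans_le hx), ht⟩, rfl⟩

theorem layer_tubePoint (hK : ProjectionWellDefined (range γ) ρ) (hc : 0 < c)
    (hF : h.frame.Regular c r) (hr : r < ρ) (hε : ε ≤ r) (f : Plane → ℝ) (θ : ℝ → ℝ) {t s : ℝ}
    (hs : |s| ≤ ε) : layer γ f θ ε (tubePoint γ t s) =
      f (γ t) * scaledWeight θ ε s * (1 + s * signedCurvature γ t)⁻¹ := by
  have hsρ : |s| < ρ := (hs.trans hε).trans_lt hr
  rw [layer, indicator_of_mem, h.tubeIntegrand_tubePoint hK f θ ε hsρ]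
  · exact hc.trans_le (hF t s (hs.trans hε))
  · change Metric.infDist _ _ ≤ ε
    rwa [h.infDist_tubePoint hK hsρ]

variable {f : Plane → ℝ} {θ : ℝ → ℝ}

theorem exists_bound_comp (hf : Continuous (f ∘ γ)) : ∃ C, 0 ≤ C ∧ ∀ t, |f (γ t)| ≤ C := by
  obtain ⟨C, hC⟩ := exists_bound_of_periodic h.length_pos hf (fun t => by simp [h.periodic t])
  exact ⟨C, (norm_nonneg _).trans (hC 0), hC⟩

theorem exists_bound_layer (hK : ProjectionWellDefined (range γ) ρ) (hc : 0 < c)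
    (hF : h.frame.Regular c r) (hr : r < ρ) (hε0 : 0 < ε) (hε : ε ≤ r) (hf : Continuous (f ∘ γ))
    (hθ : ∃ M, ∀ s, |θ s| ≤ M) : ∃ C, 0 ≤ C ∧ ∀ x, |layer γ f θ ε x| ≤ C := by
  obtain ⟨A, hA, hfA⟩ := h.exists_bound_comp hf
  obtain ⟨M, hM⟩ := hθ
  have hM0 : 0 ≤ M := (abs_nonneg _).trans (hM 0)
  refine ⟨A * (ε⁻¹ * M) * c⁻¹, by positivity, fun x => ?_⟩
  by_cases hx : x ∈ tube (range γ) ε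
  · obtain ⟨t, ht, s, hs, rfl⟩ := h.exists_tubePoint x
    have hs' : |s| ≤ ε := hs.trans_le hx
    rw [h.layer_tubePoint hK hc hF hr hε f θ hs', abs_mul, abs_mul, scaledWeight, abs_mul,
      abs_of_pos (inv_pos.2 hε0), abs_inv]
    have h1 : c ≤ 1 + s * signedCurvature γ t := hF t s (hs'.trans hε)
    have := hM (ε⁻¹ * s)
    have := hfA t
    rw [abs_of_pos (hc.trans_le h1)]
    have : 0 ≤ (1 + s * signedCurvature γ t)⁻¹ := inv_nonneg.2 (hc.le.trans h1)
    gcongr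
  · rw [layer, indicator_of_notMem hx, abs_zero]; positivity

theorem exists_layer_support (hε : ε ≤ r) : ∃ B, 0 ≤ B ∧ ∀ x, B < ‖x‖ → layer γ f θ ε x = 0 := by
  obtain ⟨B, hB⟩ := h.isCompact_range.isBounded.exists_norm_le
  refine ⟨|B| + |r|, by positivity, fun x hx => indicator_of_notMem (fun hmem => ?_) _⟩
  obtain ⟨p, hp, hd⟩ := h.isCompact_range.exists_infDist_eq_dist ⟨_, mem_range_self 0⟩ x
  have h1 : dist x p ≤ ε := hd ▸ hmem
  rw [dist_eq_norm] at h1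
  have h2 := hB p hp
  have h3 : ‖x‖ ≤ ‖x - p‖ + ‖p‖ := by
    have := norm_add_le (x - p) p
    rwa [sub_add_cancel] at this
  linarith [le_abs_self B, le_abs_self r]

/-- The layer is the extension by zero of an explicit function of `(s, t)` along the tube
coordinates, which are continuous and injective on a Borel box and so a measurable embedding. Only
`f ∘ γ` is known to be continuous, so measurability is not sought for `f` or for the projection
separately. -/
theorem measurable_layer (hK : ProjectionWellDefined (range γ) ρ) (hc : 0 < c)
    (hF : h.frame.Regular c r) (hr : r < ρ) (hε : ε ≤ r) (hf : Continuous (f ∘ γ))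
    (hθ : Measurable θ) : Measurable (layer γ f θ ε) := by
  have hcont : Continuous fun p : ℝ × ℝ => tubePoint γ p.2 p.1 := by
    have h1 : Continuous γ := h.smooth.continuous
    have h2 : Continuous (normal γ) :=
      continuous_iff_continuousAt.2 fun t => (h.hasDerivAt_normal t).continuousAt
    unfold tubePoint
    fun_prop
  have hemb := hcont.continuousOn.measurableEmbedding (h.measurableSet_tubeBox (ε := ε))
    (h.injOn_tubePoint hK (hε.trans_lt hr))
  set g : ℝ × ℝ → ℝ := fun p =>
    f (γ p.2) * scaledWeight θ ε p.1 * (1 + p.1 * signedCurvature γ p.2)⁻¹ with hg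
  have hgm : Measurable g := by
    have h1 : Measurable fun p : ℝ × ℝ => f (γ p.2) := hf.measurable.comp measurable_snd
    have h2 : Measurable fun p : ℝ × ℝ => signedCurvature γ p.2 :=
      h.frame.sk.continuous.measurable.comp measurable_snd
    have h3 : Measurable fun p : ℝ × ℝ => scaledWeight θ ε p.1 :=
      (hθ.comp (measurable_fst.const_mul ε⁻¹)).const_mul _
    exact (h1.mul h3).mul ((measurable_fst.mul h2).const_add 1).inv
  have key : layer γ f θ ε = Function.extend
      ((h.tubeBox ε).domRestrict fun p : ℝ × ℝ => tubePoint γ p.2 p.1)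
      (fun p => g p.1) fun _ => 0 := by
    funext x
    by_cases hx : x ∈ tube (range γ) ε
    · rw [← h.image_tubePoint hK (hε.trans_lt hr)] at hx
      obtain ⟨p, hp, rfl⟩ := hx
      have := hemb.injective.extend_apply (fun p => g p.1) (fun _ => 0) ⟨p, hp⟩
      simp only [domRestrict_apply] at this
      rw [this]
      exact h.layer_tubePoint hK hc hF hr hε f θ (abs_le.2 hp.1)
    · rw [layer, indicator_of_notMem hx, Function.extend_apply']
      rintro ⟨p, hp⟩
      refine hx ?_
      rw [← h.image_tubePoint hK (hε.trans_lt hr), ← hp]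
      exact mem_image_of_mem _ p.2
  rw [key]
  exact hemb.measurable_extend (hgm.comp measurable_subtype_coe) measurable_const

/-- Integrals against the layer in tube coordinates. -/
theorem integral_layer_mul (hK : ProjectionWellDefined (range γ) ρ) (hc : 0 < c)
    (hF : h.frame.Regular c r) (hr : r < ρ) (hε0 : 0 < ε) (hε : ε ≤ r) (hf : Continuous (f ∘ γ))
    (hθm : Measurable θ) (hθ : ∃ M, ∀ s, |θ s| ≤ M) {e : Plane → ℂ} (he : Continuous e) :
    ∫ x, (layer γ f θ ε x : ℂ) * e x =
      ∫ σ in (-1)..1, (θ σ : ℂ) * ∫ t in (0)..L, (f (γ t) : ℂ) * e (tubePoint γ t (ε * σ)) := by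
  have hL := h.length_pos
  have hcont : Continuous fun p : ℝ × ℝ => tubePoint γ p.2 p.1 := by
    have h1 : Continuous γ := h.smooth.continuous
    have h2 : Continuous (normal γ) :=
      continuous_iff_continuousAt.2 fun t => (h.hasDerivAt_normal t).continuousAt
    unfold tubePoint
    fun_prop
  have hinj : InjOn h.tubeMap (h.tubeBox ε) := fun p hp p' hp' heq =>
    h.injOn_tubePoint hK (hε.trans_lt hr) hp hp' (by
      simp only [← h.planeEquiv_tubeMap, heq])
  have himg : h.tubeMap '' h.tubeBox ε = planeEquiv ⁻¹' tube (range γ) ε := by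
    rw [← h.image_tubePoint hK (hε.trans_lt hr)]
    ext p
    constructor
    · rintro ⟨q, hq, rfl⟩
      exact ⟨q, hq, (h.planeEquiv_tubeMap q).symm⟩
    · rintro ⟨q, hq, hqp⟩
      refine ⟨q, hq, planeEquiv.injective ?_⟩
      rw [h.planeEquiv_tubeMap]; exact hqp
  have hmeas : MeasurableSet (planeEquiv ⁻¹' tube (range γ) ε) := by
    refine planeEquiv.measurable ?_
    exact measurableSet_le (Metric.continuous_infDist_pt _).measurable measurable_const
  have step1 : ∫ x, (layer γ f θ ε x : ℂ) * e x =
      ∫ p in h.tubeMap '' h.tubeBox ε, (layer γ f θ ε (planeEquiv p) : ℂ) * e (planeEquiv p) := by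
    rw [← measurePreserving_planeEquiv.integral_comp planeEquiv.measurableEmbedding, himg,
      ← integral_indicator hmeas]
    congr 1
    funext p
    by_cases hp : p ∈ planeEquiv ⁻¹' tube (range γ) ε
    · rw [indicator_of_mem hp]
    · rw [indicator_of_notMem hp, layer,
        indicator_of_notMem (show planeEquiv p ∉ tube (range γ) ε from hp), Complex.ofReal_zero,
        zero_mul]
  -- The determinant `1 + s k`, positive on the box, cancels the factor `J`.
  have step2 : ∫ p in h.tubeMap '' h.tubeBox ε,
        (layer γ f θ ε (planeEquiv p) : ℂ) * e (planeEquiv p) =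
      ∫ p in h.tubeBox ε, (scaledWeight θ ε p.1 : ℂ) *
        ((f (γ p.2) : ℂ) * e (tubePoint γ p.2 p.1)) := by
    rw [integral_image_eq_integral_abs_det_fderiv_smul _ h.measurableSet_tubeBox
      (fun p _ => (h.hasFDerivAt_tubeMap p).hasFDerivWithinAt) hinj]
    refine setIntegral_congr_fun h.measurableSet_tubeBox fun p hp => ?_
    have hs : |p.1| ≤ ε := abs_le.2 hp.1
    have h1 : c ≤ 1 + p.1 * signedCurvature γ p.2 := hF p.2 p.1 (hs.trans hε)
    have h2 : 0 < 1 + p.1 * signedCurvature γ p.2 := hc.trans_le h1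
    simp only [h.planeEquiv_tubeMap, h.det_tubeMapDeriv]
    rw [h.layer_tubePoint hK hc hF hr hε f θ hs]
    change |1 + p.1 * signedCurvature γ p.2| • _ = _
    have h3 : ((1 : ℂ) + p.1 * signedCurvature γ p.2) ≠ 0 := by exact_mod_cast h2.ne'
    rw [abs_of_pos h2, Complex.real_smul]
    push_cast
    field_simp
  obtain ⟨M, hM⟩ := hθ
  have hG : Continuous fun p : ℝ × ℝ => (f (γ p.2) : ℂ) * e (tubePoint γ p.2 p.1) :=
    (Complex.continuous_ofReal.comp (hf.comp continuous_snd)).mul (he.comp hcont)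
  have hint : IntegrableOn (fun p : ℝ × ℝ => (scaledWeight θ ε p.1 : ℂ) *
      ((f (γ p.2) : ℂ) * e (tubePoint γ p.2 p.1))) (h.tubeBox ε) (volume.prod volume) := by
    refine IntegrableOn.mono_set (t := Icc (-ε) ε ×ˢ Icc 0 L) ?_
      (prod_mono subset_rfl Ico_subset_Icc_self)
    refine IntegrableOn.mul_continuousOn ?_ hG.continuousOn (isCompact_Icc.prod isCompact_Icc)
    refine Measure.integrableOn_of_bounded (M := ε⁻¹ * M)
      (isCompact_Icc.prod isCompact_Icc).measure_lt_top.ne ?_ ?_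
    · refine Measurable.aestronglyMeasurable ?_
      exact Complex.measurable_ofReal.comp
        ((hθm.comp (measurable_fst.const_mul ε⁻¹)).const_mul _)
    · refine Eventually.of_forall fun p => ?_
      rw [Complex.norm_real, scaledWeight, norm_mul, Real.norm_of_nonneg (inv_pos.2 hε0).le]
      have := hM (ε⁻¹ * p.1)
      rw [Real.norm_eq_abs]
      gcongr
  have step3 : ∫ p in h.tubeBox ε, (scaledWeight θ ε p.1 : ℂ) *
        ((f (γ p.2) : ℂ) * e (tubePoint γ p.2 p.1)) =
      ∫ s in (-ε)..ε, (scaledWeight θ ε s : ℂ) *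
        ∫ t in (0)..L, (f (γ t) : ℂ) * e (tubePoint γ t s) := by
    rw [tubeBox, Measure.volume_eq_prod, setIntegral_prod _ hint,
      intervalIntegral.integral_of_le (by linarith), integral_Icc_eq_integral_Ioc]
    refine setIntegral_congr_fun measurableSet_Ioc fun s _ => ?_
    simp only
    rw [integral_const_mul, intervalIntegral.integral_of_le hL.le, integral_Ico_eq_integral_Ioo,
      integral_Ioc_eq_integral_Ioo]
  rw [step1, step2, step3]
  -- Substituting `s = ε σ`: the factor `ε` of the substitution cancels the `ε⁻¹` of the scaled
  -- weight.
  have hsub := intervalIntegral.integral_comp_mul_left (a := -1) (b := 1)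
    (fun s => (scaledWeight θ ε s : ℂ) *
        ∫ t in (0)..L, (f (γ t) : ℂ) * e (tubePoint γ t s)) hε0.ne'
  rw [mul_neg, mul_one] at hsub
  have hne : (ε : ℂ) ≠ 0 := by exact_mod_cast hε0.ne'
  have h4 : ∀ w : ℂ, w = ε * ((ε⁻¹ : ℝ) • w) := fun w => by
    rw [Complex.real_smul, ← mul_assoc]; push_cast; rw [mul_inv_cancel₀ hne, one_mul]
  rw [h4 (∫ s in (-ε)..ε, _), ← hsub, ← intervalIntegral.integral_const_mul]
  congr 1
  funext σ
  unfold scaledWeight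
  rw [inv_mul_cancel_left₀ hε0.ne']
  push_cast
  field_simp

/-- The mean value is exact for every width, so the mean-square error is purely the variance from
the nonzero frequencies. -/
theorem integral_layer (hK : ProjectionWellDefined (range γ) ρ) (hc : 0 < c)
    (hF : h.frame.Regular c r) (hr : r < ρ) (hε0 : 0 < ε) (hε : ε ≤ r) (hf : Continuous (f ∘ γ))
    (hθm : Measurable θ) (hθ : ∃ M, ∀ s, |θ s| ≤ M) (hθ1 : ∫ s in (-1)..1, θ s = 1) :
    ∫ x, (layer γ f θ ε x : ℂ) = boundaryIntegral γ L f := by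
  have := h.integral_layer_mul hK hc hF hr hε0 hε hf hθm hθ (e := fun _ => 1) continuous_const
  simp only [mul_one] at this
  rw [this, intervalIntegral.integral_mul_const, intervalIntegral.integral_ofReal, hθ1,
    intervalIntegral.integral_ofReal, Complex.ofReal_one, one_mul]
  rfl

theorem integral_layer_mul_osc (hK : ProjectionWellDefined (range γ) ρ) (hc : 0 < c)
    (hF : h.frame.Regular c r) (hr : r < ρ) (hε0 : 0 < ε) (hε : ε ≤ r) (hf : Continuous (f ∘ γ))
    (hθm : Measurable θ) (hθ : ∃ M, ∀ s, |θ s| ≤ M) (R φ : ℝ) :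
    ∫ x : Plane, (layer γ f θ ε x : ℂ) * osc (R * phase φ (x 0) (x 1)) =
      ∫ σ in (-1)..1, (θ σ : ℂ) * h.frame.H (fun z => f (γ z.1)) R φ (ε * σ) := by
  rw [h.integral_layer_mul hK hc hF hr hε0 hε hf hθm hθ
    (e := fun x => osc (R * phase φ (x 0) (x 1)))
    (continuous_osc.comp (by unfold phase; fun_prop))]
  congr 1
  funext σ
  congr 1
  unfold Frame.H Frame.tubePhase
  congr 1
  funext t
  congr 3
  simp [tubePoint, normal, frame, ← sub_eq_add_neg]

/-- Mean-square decay of the Fourier transform of the layer over circles. -/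
theorem exists_bound_layer_fourier (hK : ProjectionWellDefined (range γ) ρ) (hc : 0 < c)
    (hr0 : 0 < r) (hF : h.frame.Regular c r) (hr : r < ρ) (hf : ContDiff ℝ ∞ (f ∘ γ)) {q : ℕ}
    (hθ : IsWeight q θ) : ∃ C, 0 ≤ C ∧ ∀ ε R : ℝ, 0 < ε → ε ≤ r → 1 ≤ R →
      ∫ φ in (0)..(2 * Real.pi),
        ‖∫ x : Plane, (layer γ f θ ε x : ℂ) * osc (R * phase φ (x 0) (x 1))‖ ^ 2 ≤
        C / (R * (ε * R) ^ (2 * (q + 1))) := by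
  have hamp : IsAmplitude L fun z => f (γ z.1) :=
    IsAmplitude.of_fst hf (fun t => by simp [h.periodic t])
  obtain ⟨C, hC, hb⟩ := h.frame.decays_integral_profile h.length_pos hc hr0 hF q hamp hθ.isProfile
  refine ⟨C, hC, fun ε R hε0 hε hR => ?_⟩
  simp only [h.integral_layer_mul_osc hK hc hF hr hε0 hε hf.continuous
    hθ.piecewise.measurable hθ.bounded]
  exact (hb ε R hε0 hε hR).2

end IsSmoothClosedCurve

/-! ### Rotations -/

/-- The rotation by the angle `φ`. -/
def rot (φ : ℝ) : SO2 :=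
  ⟨!![Real.cos φ, -Real.sin φ; Real.sin φ, Real.cos φ], by
    rw [Matrix.mem_specialOrthogonalGroup_iff, Matrix.mem_orthogonalGroup_iff]
    constructor
    · ext i j
      have := Real.cos_sq_add_sin_sq φ
      fin_cases i <;> fin_cases j <;>
        simp [Matrix.mul_apply, Fin.sum_univ_two] <;> linarith
    · rw [Matrix.det_fin_two_of]; linarith [Real.cos_sq_add_sin_sq φ]⟩

theorem coe_rot (φ : ℝ) : (rot φ : Matrix (Fin 2) (Fin 2) ℝ) =
    !![Real.cos φ, -Real.sin φ; Real.sin φ, Real.cos φ] := rfl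

theorem rot_mul_rot (φ ψ : ℝ) : rot φ * rot ψ = rot (φ + ψ) := by
  refine Subtype.ext ?_
  change (rot φ : Matrix (Fin 2) (Fin 2) ℝ) * rot ψ = rot (φ + ψ)
  rw [coe_rot, coe_rot, coe_rot, Real.cos_add, Real.sin_add]
  ext i j
  fin_cases i <;> fin_cases j <;> simp [Matrix.mul_apply, Fin.sum_univ_two] <;> ring

theorem continuous_rot : Continuous rot := by
  refine continuous_induced_rng.2 (continuous_matrix fun i j => ?_)
  fin_cases i <;> fin_cases j <;> simp [coe_rot] <;> fun_prop

theorem rot_periodic : Function.Periodic rot (2 * Real.pi) := fun φ => by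
  refine Subtype.ext ?_
  rw [coe_rot, coe_rot, Real.cos_add_two_pi, Real.sin_add_two_pi]

theorem exists_eq_rot (η : SO2) : ∃ φ, η = rot φ := by
  obtain ⟨A, hA⟩ := η
  obtain ⟨h1, h2⟩ := Matrix.mem_specialOrthogonalGroup_iff.1 hA
  have h3 := (Matrix.mem_orthogonalGroup_iff _ _).1 h1
  have e00 := congrFun (congrFun h3 0) 0
  have e01 := congrFun (congrFun h3 0) 1
  have e11 := congrFun (congrFun h3 1) 1
  simp [Matrix.mul_apply, Fin.sum_univ_two] at e00 e01 e11
  rw [Matrix.det_fin_two] at h2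
  have ed : A 1 1 = A 0 0 := by linear_combination A 0 0 * e11 - A 1 1 * h2 - A 1 0 * e01
  have ec : A 1 0 = -A 0 1 := by linear_combination (-A 0 1) * e11 + A 1 1 * e01 - A 1 0 * h2
  obtain ⟨r, β, hr, h0, h1⟩ := exists_polar (A 0 0) (A 1 0)
  have hr1 : r = 1 := by
    have : r ^ 2 = 1 := by
      rw [← h2, ed, show A 0 1 = -A 1 0 by rw [ec, neg_neg], h0, h1]
      linear_combination (-r ^ 2) * Real.cos_sq_add_sin_sq β
    nlinarith
  rw [hr1, one_mul] at h0 h1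
  refine ⟨β, Subtype.ext ?_⟩
  rw [coe_rot]
  ext i j
  fin_cases i <;> fin_cases j
  · exact h0
  · change A 0 1 = -Real.sin β
    rw [← h1, ec, neg_neg]
  · exact h1
  · change A 1 1 = Real.cos β
    rw [ed, h0]

theorem rot_inv (φ : ℝ) : (rot φ)⁻¹ = rot (-φ) := by
  refine inv_eq_of_mul_eq_one_right ?_
  rw [rot_mul_rot, add_neg_cancel]
  refine Subtype.ext ?_
  rw [coe_rot, Real.cos_zero, Real.sin_zero, neg_zero]
  ext i j
  fin_cases i <;> fin_cases j <;> simp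

theorem rigid_rot (φ : ℝ) (v x : Plane) : rigid (rot φ) v x =
    !₂[Real.cos φ * x 0 - Real.sin φ * x 1 + v 0, Real.sin φ * x 0 + Real.cos φ * x 1 + v 1] := by
  unfold rigid
  rw [coe_rot]
  ext i
  fin_cases i <;> simp [Matrix.mulVec, dotProduct, Fin.sum_univ_two]; ring

theorem rigidInv_eq (η : SO2) (v y : Plane) : rigidInv η v y = rigid η⁻¹ 0 (y - v) := by
  simp [rigidInv, rigid]

theorem rigidInv_rigid (η : SO2) (v x : Plane) : rigidInv η v (rigid η v x) = x := by
  obtain ⟨φ, rfl⟩ := exists_eq_rot η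
  rw [rigidInv_eq, rot_inv, rigid_rot, rigid_rot]
  have := Real.cos_sq_add_sin_sq φ
  ext i
  fin_cases i <;> simp
  · linear_combination (x 0) * this
  · linear_combination (x 1) * this

theorem rigid_rigidInv (η : SO2) (v x : Plane) : rigid η v (rigidInv η v x) = x := by
  obtain ⟨φ, rfl⟩ := exists_eq_rot η
  rw [rigidInv_eq, rot_inv, rigid_rot, rigid_rot]
  have := Real.cos_sq_add_sin_sq φ
  ext i
  fin_cases i <;> simp
  · linear_combination (x 0 - v 0) * this
  · linear_combination (x 1 - v 1) * this

theorem isometry_rigid (η : SO2) (v : Plane) : Isometry (rigid η v) := by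
  obtain ⟨φ, rfl⟩ := exists_eq_rot η
  refine Isometry.of_dist_eq fun x y => ?_
  have : dist (rigid (rot φ) v x) (rigid (rot φ) v y) ^ 2 = dist x y ^ 2 := by
    rw [dist_eq_norm, dist_eq_norm, norm_sq_plane, norm_sq_plane, rigid_rot, rigid_rot]
    simp
    linear_combination ((x 0 - y 0) ^ 2 + (x 1 - y 1) ^ 2) * Real.cos_sq_add_sin_sq φ
  exact (pow_left_inj₀ dist_nonneg dist_nonneg two_ne_zero).1 this

theorem continuous_rigid : Continuous fun p : SO2 × Plane × Plane => rigid p.1 p.2.1 p.2.2 := by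
  have he : ∀ i j, Continuous fun p : SO2 × Plane × Plane =>
      (p.1 : Matrix (Fin 2) (Fin 2) ℝ) i j := fun i j =>
    (continuous_subtype_val.comp continuous_fst).matrix_elem i j
  have heq : (fun p : SO2 × Plane × Plane => rigid p.1 p.2.1 p.2.2) = fun p =>
      WithLp.toLp 2 fun i => (p.1 : Matrix (Fin 2) (Fin 2) ℝ) i 0 * p.2.2 0 +
        (p.1 : Matrix (Fin 2) (Fin 2) ℝ) i 1 * p.2.2 1 + p.2.1 i := by
    funext p
    ext i
    simp [rigid, Matrix.mulVec, dotProduct, Fin.sum_univ_two]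
  rw [heq]
  refine (PiLp.continuous_toLp 2 _).comp (continuous_pi fun i => ?_)
  have hp : ∀ j, Continuous fun x : Plane => x j := fun j =>
    (EuclideanSpace.proj (𝕜 := ℝ) j : Plane →L[ℝ] ℝ).continuous
  have h2 : ∀ j, Continuous fun p : SO2 × Plane × Plane => p.2.2 j := fun j =>
    (hp j).comp (continuous_snd.comp continuous_snd)
  have h1 : Continuous fun p : SO2 × Plane × Plane => p.2.1 i :=
    (hp i).comp (continuous_fst.comp continuous_snd)
  exact (((he i 0).mul (h2 0)).add ((he i 1).mul (h2 1))).add h1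

/-! ### The moved curve -/

section moved

variable {γ : ℝ → Plane} {L ρ c r ε : ℝ} {f : Plane → ℝ} {θ : ℝ → ℝ}

theorem _root_.HasDerivAt.rigid {c : ℝ → Plane} {c' : Plane} {t : ℝ} (h : HasDerivAt c c' t)
    (φ : ℝ) (v : Plane) :
    HasDerivAt (fun t => rigid (rot φ) v (c t)) (ImplicitBoundary.rigid (rot φ) 0 c') t := by
  have h0 := hasDerivAt_coord h 0
  have h1 := hasDerivAt_coord h 1
  refine hasDerivAt_plane fun i => ?_
  simp only [rigid_rot]
  fin_cases i
  · simpa using ((h0.const_mul (Real.cos φ)).sub (h1.const_mul (Real.sin φ))).add_const (v 0)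
  · simpa using ((h0.const_mul (Real.sin φ)).add (h1.const_mul (Real.cos φ))).add_const (v 1)

theorem range_rigid (η : SO2) (v : Plane) :
    range (fun t => rigid η v (γ t)) = rigid η v '' range γ := range_comp (rigid η v) γ

theorem infDist_rigid (η : SO2) (v x : Plane) :
    Metric.infDist (rigid η v x) (range fun t => rigid η v (γ t)) = Metric.infDist x (range γ) := by
  rw [range_rigid, Metric.infDist_image (isometry_rigid η v)]

theorem isNearest_rigid_iff (η : SO2) (v : Plane) {x y : Plane} :
    IsNearest (range fun t => rigid η v (γ t)) (rigid η v x) (rigid η v y) ↔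
      IsNearest (range γ) x y := by
  unfold IsNearest
  rw [infDist_rigid, (isometry_rigid η v).dist_eq, range_rigid,
    (isometry_rigid η v).injective.mem_set_image]

theorem ProjectionWellDefined.rigid (hK : ProjectionWellDefined (range γ) ρ) (η : SO2) (v : Plane) :
    ProjectionWellDefined (range fun t => rigid η v (γ t)) ρ := by
  intro x hx
  obtain ⟨x, rfl⟩ : ∃ x', ImplicitBoundary.rigid η v x' = x := ⟨_, rigid_rigidInv η v x⟩
  have hx' : x ∈ tube (range γ) ρ := by
    change Metric.infDist _ _ ≤ ρ
    rw [← infDist_rigid η v]; exact hx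
  obtain ⟨y, hy, hu⟩ := hK x hx'
  refine ⟨ImplicitBoundary.rigid η v y, (isNearest_rigid_iff η v).2 hy, fun z hz => ?_⟩
  obtain ⟨z, rfl⟩ : ∃ z', ImplicitBoundary.rigid η v z' = z := ⟨_, rigid_rigidInv η v z⟩
  rw [hu z ((isNearest_rigid_iff η v).1 hz)]

namespace IsSmoothClosedCurve

variable (h : IsSmoothClosedCurve γ L)
include h

theorem deriv_rigid (φ : ℝ) (v : Plane) :
    deriv (fun t => rigid (rot φ) v (γ t)) = fun t => rigid (rot φ) 0 (deriv γ t) :=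
  funext fun t => ((h.hasDerivAt t).rigid φ v).deriv

theorem deriv_deriv_rigid (φ : ℝ) (v : Plane) :
    deriv (deriv fun t => rigid (rot φ) v (γ t)) =
      fun t => rigid (rot φ) 0 (deriv (deriv γ) t) := by
  rw [h.deriv_rigid]
  exact funext fun t => ((h.hasDerivAt_deriv t).rigid φ 0).deriv

theorem rigid (η : SO2) (v : Plane) : IsSmoothClosedCurve (fun t => rigid η v (γ t)) L := by
  have hiso := isometry_rigid η v
  have hiso0 := isometry_rigid η 0
  obtain ⟨φ, rfl⟩ := exists_eq_rot η
  refine ⟨h.length_pos, ?_, fun t => ?_, fun t => ?_, fun a ha b hb hab =>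
    h.simple ha hb (hiso.injective hab)⟩
  · have h0 := contDiff_coord h.smooth 0
    have h1 := contDiff_coord h.smooth 1
    refine (contDiff_piLp 2).2 fun i => ?_
    simp only [rigid_rot]
    fin_cases i
    · simpa using (((contDiff_const (c := Real.cos φ)).mul h0).sub
        ((contDiff_const (c := Real.sin φ)).mul h1)).add contDiff_const
    · simpa using (((contDiff_const (c := Real.sin φ)).mul h0).add
        ((contDiff_const (c := Real.cos φ)).mul h1)).add contDiff_const
  · have := hiso0.dist_eq (deriv γ t) 0
    rw [show ImplicitBoundary.rigid (rot φ) 0 0 = 0 by simp [ImplicitBoundary.rigid],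
      dist_zero_right, dist_zero_right, h.unit_speed] at this
    rw [h.deriv_rigid]
    exact this
  · simp only [h.periodic t]

theorem tubePoint_rigid (η : SO2) (v : Plane) (t s : ℝ) :
    tubePoint (fun t => ImplicitBoundary.rigid η v (γ t)) t s =
      ImplicitBoundary.rigid η v (tubePoint γ t s) := by
  obtain ⟨φ, rfl⟩ := exists_eq_rot η
  unfold tubePoint normal
  rw [h.deriv_rigid]
  simp only [rigid_rot]
  ext i
  fin_cases i <;> simp <;> ring

theorem signedCurvature_rigid (η : SO2) (v : Plane) :
    signedCurvature (fun t => ImplicitBoundary.rigid η v (γ t)) = signedCurvature γ := by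
  funext t
  have h' := h.rigid η v
  obtain ⟨φ, rfl⟩ := exists_eq_rot η
  rw [h'.signedCurvature_eq, h.signedCurvature_eq, h.deriv_deriv_rigid, h.deriv_rigid]
  simp only [rigid_rot]
  simp
  linear_combination (deriv γ t 0 * deriv (deriv γ) t 1 - deriv γ t 1 * deriv (deriv γ) t 0) *
    Real.cos_sq_add_sin_sq φ

/-- Distance, foot point, normal and signed curvature are carried along by a proper rigid motion; in
tube coordinates both sides are the same expression. -/
theorem layer_rigid (hK : ProjectionWellDefined (range γ) ρ) (hc : 0 < c)
    (hF : h.frame.Regular c r) (hr : r < ρ) (hε : ε ≤ r) (η : SO2) (v x : Plane) :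
    layer (fun t => ImplicitBoundary.rigid η v (γ t)) (fun y => f (rigidInv η v y)) θ ε
      (ImplicitBoundary.rigid η v x) = layer γ f θ ε x := by
  by_cases hx : x ∈ tube (range γ) ε
  · obtain ⟨t, ht, s, hs, rfl⟩ := h.exists_tubePoint x
    have hs' : |s| ≤ ε := hs.trans_le hx
    have hF' : (h.rigid η v).frame.Regular c r := fun t s hs => by
      change c ≤ 1 + s * signedCurvature _ t
      rw [h.signedCurvature_rigid η v]
      exact hF t s hs
    rw [h.layer_tubePoint hK hc hF hr hε f θ hs', ← h.tubePoint_rigid,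
      (h.rigid η v).layer_tubePoint (hK.rigid η v) hc hF' hr hε _ θ hs',
      h.signedCurvature_rigid η v, rigidInv_rigid]
  · rw [layer, layer, indicator_of_notMem hx, indicator_of_notMem]
    change ¬ Metric.infDist _ _ ≤ ε
    rwa [infDist_rigid]

/-- The curve is held fixed and the lattice is moved by the inverse motion instead. -/
theorem movedQuadrature_eq (hK : ProjectionWellDefined (range γ) ρ) (hc : 0 < c)
    (hF : h.frame.Regular c r) (hr : r < ρ) (hε : ε ≤ r) (δ : ℝ) (η : SO2) (ξ : Plane) :
    movedQuadrature γ f θ δ ε η ξ = δ ^ 2 * ∑' w : Fin 2 → ℤ,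
      layer γ f θ ε (rigidInv η (δ • ξ) (WithLp.toLp 2 fun i => δ * (w i : ℝ))) := by
  unfold movedQuadrature quadrature
  congr 1
  refine tsum_congr fun w => ?_
  rw [← h.layer_rigid hK hc hF hr hε η (δ • ξ), rigid_rigidInv]
  rfl

end IsSmoothClosedCurve
end moved

/-! ### Parseval's identity for periodizations -/

section periodization

variable {d : Type*} [Fintype d]

/-- The half-open unit box at `a`. -/
def box (a : d → ℝ) : Set (d → ℝ) := {x | ∀ i, x i ∈ Ioc (a i) (a i + 1)}

theorem measurableSet_box (a : d → ℝ) : MeasurableSet (box a) :=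
  MeasurableSet.univ_pi' fun _ => measurableSet_Ioc

theorem volume_box (a : d → ℝ) : volume (box a) = 1 := by
  have : box a = Set.pi univ fun i => Ioc (a i) (a i + 1) := by ext; simp [box]
  rw [this, Real.volume_pi_Ioc]
  simp

/-- The integer vectors as real vectors. -/
def intVec (w : d → ℤ) : d → ℝ := fun i => (w i : ℝ)

omit [Fintype d] in
theorem iUnion_box : ⋃ w : d → ℤ, box (intVec w) = univ := by
  refine eq_univ_of_forall fun x => mem_iUnion.2 ⟨fun i => ⌈x i⌉ - 1, fun i => ?_⟩
  simp only [intVec, Int.cast_sub, Int.cast_one]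
  exact ⟨by linarith [Int.ceil_lt_add_one (x i)], by linarith [Int.le_ceil (x i)]⟩

omit [Fintype d] in
theorem pairwise_disjoint_box :
    Pairwise (Function.onFun Disjoint fun w : d → ℤ => box (intVec w)) := by
  intro w w' hne
  refine disjoint_left.2 fun x hx hx' => hne (funext fun i => ?_)
  have h1 := hx i
  have h2 := hx' i
  simp only [intVec] at h1 h2
  have h3 : w i < w' i + 1 := by
    have := h1.1.trans_le h2.2; exact_mod_cast this
  have h4 : w' i < w i + 1 := by
    have := h2.1.trans_le h1.2; exact_mod_cast this
  omega

/-- The function `K` vanishes off the box `[-N, N]^d`. -/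
def SupportedIn {E : Type*} [Zero E] (N : ℕ) (K : (d → ℝ) → E) : Prop :=
  ∀ x i, (N : ℝ) < |x i| → K x = 0

variable [DecidableEq d]

/-- The integer vectors in `[-N, N]^d`. -/
def intBox (N : ℕ) : Finset (d → ℤ) := Fintype.piFinset fun _ => Finset.Icc (-(N : ℤ)) N

/-- A point of `[-1, 1]^d` can shift an integer vector by at most one per coordinate; hence `N + 1`.
Thus every periodization below is locally a finite sum. -/
theorem SupportedIn.eq_zero {E : Type*} [Zero E] {N : ℕ} {K : (d → ℝ) → E} (hK : SupportedIn N K)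
    {x : d → ℝ} (hx : ∀ i, x i ∈ Icc (-1 : ℝ) 1) {w : d → ℤ} (hw : w ∉ intBox (N + 1)) :
    K (x + intVec w) = 0 := by
  simp only [intBox, Fintype.mem_piFinset, not_forall] at hw
  obtain ⟨i, hi⟩ := hw
  refine hK _ i ?_
  rw [Finset.mem_Icc, ← abs_le, not_le] at hi
  have h1 : ((N : ℝ) + 1) < |(w i : ℝ)| := by
    have : (((N + 1 : ℕ) : ℤ) : ℝ) < ((|w i| : ℤ) : ℝ) := by exact_mod_cast hi
    rw [Int.cast_abs] at this
    push_cast at this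
    exact this
  have h2 : |x i| ≤ 1 := abs_le.2 (hx i)
  have h3 : |(w i : ℝ)| ≤ |x i + w i| + |x i| := by
    have := abs_sub (x i + w i) (x i)
    rwa [add_sub_cancel_left] at this
  change (N : ℝ) < |x i + w i|
  linarith

theorem SupportedIn.tsum_eq {E : Type*} [AddCommGroup E] [TopologicalSpace E] {N : ℕ}
    {K : (d → ℝ) → E} (hK : SupportedIn N K) {x : d → ℝ} (hx : ∀ i, x i ∈ Icc (-1 : ℝ) 1) :
    ∑' w : d → ℤ, K (x + intVec w) = ∑ w ∈ intBox (N + 1), K (x + intVec w) :=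
  tsum_eq_sum fun _ hw => hK.eq_zero hx hw

omit [Fintype d] [DecidableEq d] in
theorem mem_Icc_of_mem_box {x : d → ℝ} (hx : x ∈ box (0 : d → ℝ)) (i : d) : x i ∈ Icc (-1 : ℝ) 1 := by
  have := hx i
  simp only [Pi.zero_apply, zero_add] at this
  exact ⟨by linarith [this.1], this.2⟩

omit [DecidableEq d] in
theorem SupportedIn.integrable {E : Type*} [NormedAddCommGroup E] [MeasurableSpace E] [BorelSpace E]
    [SecondCountableTopology E] {N : ℕ} {K : (d → ℝ) → E} (hK : SupportedIn N K)
    (hm : Measurable K) {C : ℝ} (hC : ∀ x, ‖K x‖ ≤ C) : Integrable K := by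
  refine (integrableOn_iff_integrable_of_support_subset
    (s := Set.pi univ fun _ => Icc (-(N : ℝ)) N) fun x hx i _ => ?_).1 ?_
  · by_contra hi
    rw [mem_Icc, ← abs_le, not_le] at hi
    exact hx (hK x i hi)
  · exact Measure.integrableOn_of_bounded
      (isCompact_univ_pi fun _ => isCompact_Icc).measure_lt_top.ne hm.aestronglyMeasurable
      (Eventually.of_forall hC)

omit [DecidableEq d] in
theorem setIntegral_box {E : Type*} [NormedAddCommGroup E] [NormedSpace ℝ E] (K : (d → ℝ) → E)
    (w : d → ℤ) : ∫ x in box (0 : d → ℝ), K (x + intVec w) = ∫ x in box (intVec w), K x := by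
  have h1 := (measurePreserving_add_right volume (intVec w)).setIntegral_preimage_emb
    (measurableEmbedding_addRight (intVec w)) K (box (intVec w))
  rw [← h1]
  congr 2
  ext x
  refine forall_congr' fun i => ?_
  simp only [Pi.zero_apply, zero_add, Pi.add_apply, mem_Ioc]
  constructor <;> rintro ⟨h1, h2⟩ <;> constructor <;> linarith

/-- The integral of a periodization over the unit box. -/
theorem SupportedIn.integral_tsum {E : Type*} [NormedAddCommGroup E] [NormedSpace ℝ E]
    [MeasurableSpace E] [BorelSpace E] [SecondCountableTopology E] {N : ℕ} {K : (d → ℝ) → E}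
    (hK : SupportedIn N K) (hm : Measurable K) {C : ℝ} (hC : ∀ x, ‖K x‖ ≤ C) :
    ∫ x in box (0 : d → ℝ), ∑' w : d → ℤ, K (x + intVec w) = ∫ x, K x := by
  have hi := hK.integrable hm hC
  have h1 : ∫ x in box (0 : d → ℝ), ∑' w : d → ℤ, K (x + intVec w) =
      ∑ w ∈ intBox (N + 1), ∫ x in box (0 : d → ℝ), K (x + intVec w) := by
    rw [← integral_finsetSum _ fun w _ => (hi.comp_add_right (intVec w)).integrableOn]
    exact setIntegral_congr_fun (measurableSet_box 0) fun x hx =>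
      hK.tsum_eq (mem_Icc_of_mem_box hx)
  have h2 := integral_iUnion (f := K) (μ := volume) (fun w : d → ℤ => measurableSet_box (intVec w))
    pairwise_disjoint_box hi.integrableOn
  rw [iUnion_box, setIntegral_univ] at h2
  rw [h1, h2]
  simp only [← setIntegral_box]
  refine (tsum_eq_sum fun w hw => ?_).symm
  rw [setIntegral_congr_fun (g := fun _ => 0) (measurableSet_box 0) fun x hx =>
    hK.eq_zero (mem_Icc_of_mem_box hx) hw]
  simp

local instance : MeasureSpace UnitAddCircle := ⟨AddCircle.haarAddCircle⟩

local instance : IsProbabilityMeasure (volume : Measure UnitAddCircle) :=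
  inferInstanceAs (IsProbabilityMeasure AddCircle.haarAddCircle)

theorem osc_add_two_pi_int (x : ℝ) (m : ℤ) : osc (x + 2 * Real.pi * m) = osc x := by
  rw [osc_add]
  have : osc (2 * Real.pi * m) = 1 := by
    rw [← Complex.exp_int_mul_two_pi_mul_I (-m), osc]
    congr 1
    push_cast
    ring
  rw [this, mul_one]

omit [DecidableEq d] in
theorem mFourier_coe (n : d → ℤ) (x : d → ℝ) :
    UnitAddTorus.mFourier n (fun i => (x i : UnitAddCircle)) =
      osc (-(2 * Real.pi * ∑ i, n i * x i)) := by
  simp only [UnitAddTorus.mFourier, ContinuousMap.coe_mk, fourier_coe_apply]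
  rw [← Complex.exp_sum, osc]
  congr 1
  push_cast
  rw [neg_neg, Finset.mul_sum, Finset.sum_mul]
  refine Finset.sum_congr rfl fun i _ => ?_
  ring

/-- Parseval's identity for a periodization. -/
theorem SupportedIn.hasSum_sq {N : ℕ} {K : (d → ℝ) → ℝ} (hK : SupportedIn N K) (hm : Measurable K)
    {C : ℝ} (hC : ∀ x, ‖K x‖ ≤ C) :
    HasSum (fun n : d → ℤ => ‖∫ x, (K x : ℂ) * osc (2 * Real.pi * ∑ i, n i * x i)‖ ^ 2)
      (∫ x in box (0 : d → ℝ), (∑' w : d → ℤ, K (x + intVec w)) ^ 2) := by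
  set P : (d → ℝ) → ℝ := fun x => ∑ w ∈ intBox (N + 1), K (x + intVec w) with hP
  have hPm : Measurable P := Finset.measurable_sum _ fun w _ => hm.comp (measurable_add_const _)
  have hPb : ∀ x, ‖P x‖ ≤ (intBox (d := d) (N + 1)).card * C := fun x => by
    refine (norm_sum_le_of_le _ fun w _ => hC _).trans_eq ?_
    rw [Finset.sum_const, nsmul_eq_mul]
  -- The periodization as a function on the torus, represented on the half-open box, where the
  -- finite sum is legitimate.
  set g : UnitAddTorus d → ℂ := fun y =>
    (P (UnitAddTorus.measurableEquivPiIoc (0 : d → ℝ) y).1 : ℂ) with hg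
  have hgm : Measurable g := Complex.measurable_ofReal.comp
    (hPm.comp (measurable_subtype_coe.comp (MeasurableEquiv.measurable _)))
  have hgP : ∀ x ∈ box (0 : d → ℝ), g (fun i => (x i : UnitAddCircle)) = P x := fun x hx => by
    have := (UnitAddTorus.measurableEquivPiIoc (0 : d → ℝ)).apply_symm_apply ⟨x, hx⟩
    rw [UnitAddTorus.coe_symm_measurableEquivPiIoc_apply] at this
    simp only [hg, this]
  have hmem : MemLp g 2 volume := MemLp.of_bound hgm.aestronglyMeasurable
    ((intBox (d := d) (N + 1)).card * C) (Eventually.of_forall fun y => by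
      simp only [hg, Complex.norm_real]; exact hPb _)
  have hpars := UnitAddTorus.hasSum_sq_mFourierCoeff (hmem.toLp g)
  have hint : ∫ t, ‖hmem.toLp g t‖ ^ 2 =
      ∫ x in box (0 : d → ℝ), (∑' w : d → ℤ, K (x + intVec w)) ^ 2 := by
    rw [integral_congr_ae (g := fun t => ‖g t‖ ^ 2)
      (hmem.coeFn_toLp.mono fun t ht => by beta_reduce; rw [ht]), UnitAddTorus.integral_preimage _ 0]
    refine setIntegral_congr_fun (measurableSet_box 0) fun x hx => ?_
    rw [hgP x hx, Complex.norm_real, hK.tsum_eq (mem_Icc_of_mem_box hx), Real.norm_eq_abs, sq_abs]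
  -- Unfolding: the character is invariant under integer translations, so the sum over translates of
  -- the box is an integral over the whole space.
  have hcoeff : ∀ n, UnitAddTorus.mFourierCoeff (hmem.toLp g) n =
      ∫ x, (K x : ℂ) * osc (2 * Real.pi * ∑ i, n i * x i) := fun n => by
    have h1 : UnitAddTorus.mFourierCoeff (hmem.toLp g) n = UnitAddTorus.mFourierCoeff g n :=
      integral_congr_ae (hmem.coeFn_toLp.mono fun t ht => by beta_reduce; rw [ht])
    have hK' : SupportedIn N fun x => (K x : ℂ) * osc (2 * Real.pi * ∑ i, n i * x i) :=
      fun x i hx => by simp only [hK x i hx, Complex.ofReal_zero, zero_mul]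
    have hm' : Measurable fun x => (K x : ℂ) * osc (2 * Real.pi * ∑ i, n i * x i) := by
      refine (Complex.measurable_ofReal.comp hm).mul (continuous_osc.comp ?_).measurable
      fun_prop
    rw [h1, UnitAddTorus.mFourierCoeff_eq_integral g n 0, ← hK'.integral_tsum hm' (C := C)
      fun x => by rw [norm_mul, norm_osc, mul_one, Complex.norm_real]; exact hC x]
    refine setIntegral_congr_fun (measurableSet_box 0) fun x hx => ?_
    rw [hgP x hx, hK'.tsum_eq (mem_Icc_of_mem_box hx), mFourier_coe, hP]
    push_cast
    rw [smul_eq_mul, Finset.mul_sum]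
    refine Finset.sum_congr rfl fun w _ => ?_
    rw [mul_comm]
    congr 1
    rw [← osc_add_two_pi_int _ (∑ i, n i * w i)]
    congr 1
    push_cast
    simp only [Pi.add_apply, Pi.neg_apply, intVec, mul_add, Finset.sum_add_distrib, Int.cast_neg,
      neg_mul, Finset.sum_neg_distrib, mul_neg, neg_neg]
  rw [hint] at hpars
  simpa only [hcoeff] using hpars

/-- The variance of a periodization. -/
theorem SupportedIn.hasSum_variance {N : ℕ} {K : (d → ℝ) → ℝ} (hK : SupportedIn N K)
    (hm : Measurable K) {C : ℝ} (hC : ∀ x, ‖K x‖ ≤ C) :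
    HasSum (fun n : d → ℤ =>
      if n = 0 then 0 else ‖∫ x, (K x : ℂ) * osc (2 * Real.pi * ∑ i, n i * x i)‖ ^ 2)
      (∫ x in box (0 : d → ℝ), ((∑' w : d → ℤ, K (x + intVec w)) - ∫ y, K y) ^ 2) := by
  have h1 := hasSum_ite_sub_hasSum (hK.hasSum_sq hm hC) 0
  -- The zeroth coefficient is the mean of the periodization over a box of volume one; removing it
  -- from Parseval leaves the variance.
  have h2 : (∫ x, (K x : ℂ) * osc (2 * Real.pi * ∑ i, (0 : d → ℤ) i * x i)) = (∫ x, K x : ℝ) := by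
    rw [← integral_complex_ofReal]
    simp [osc]
  rw [h2, Complex.norm_real, Real.norm_eq_abs, sq_abs] at h1
  have h3 : ∫ x in box (0 : d → ℝ), ((∑' w : d → ℤ, K (x + intVec w)) - ∫ y, K y) ^ 2 =
      (∫ x in box (0 : d → ℝ), (∑' w : d → ℤ, K (x + intVec w)) ^ 2) - (∫ x, K x) ^ 2 := by
    set c := ∫ x, K x with hc
    set P : (d → ℝ) → ℝ := fun x => ∑ w ∈ intBox (N + 1), K (x + intVec w) with hP
    have hPm : Measurable P := Finset.measurable_sum _ fun w _ => hm.comp (measurable_add_const _)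
    have hPb : ∀ x, ‖P x‖ ≤ (intBox (d := d) (N + 1)).card * C := fun x => by
      refine (norm_sum_le_of_le _ fun w _ => hC _).trans_eq ?_
      rw [Finset.sum_const, nsmul_eq_mul]
    have hfin : volume (box (0 : d → ℝ)) ≠ ⊤ := by rw [volume_box]; simp
    have i1 : IntegrableOn P (box 0) := Measure.integrableOn_of_bounded hfin
      hPm.aestronglyMeasurable (Eventually.of_forall hPb)
    have i2 : IntegrableOn (fun x => P x ^ 2) (box 0) := by
      refine Measure.integrableOn_of_bounded (M := ((intBox (d := d) (N + 1)).card * C) ^ 2) hfin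
        (hPm.pow_const 2).aestronglyMeasurable (Eventually.of_forall fun x => ?_)
      rw [norm_pow]
      exact pow_le_pow_left₀ (norm_nonneg _) (hPb x) 2
    have e1 : ∫ x in box (0 : d → ℝ), P x = c := by
      rw [hc, ← hK.integral_tsum hm hC]
      exact setIntegral_congr_fun (measurableSet_box 0) fun x hx =>
        (hK.tsum_eq (mem_Icc_of_mem_box hx)).symm
    have e2 : ∀ F : ℝ → ℝ, ∫ x in box (0 : d → ℝ), F (∑' w : d → ℤ, K (x + intVec w)) =
        ∫ x in box (0 : d → ℝ), F (P x) := fun F =>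
      setIntegral_congr_fun (measurableSet_box 0) fun x hx => by
        rw [hK.tsum_eq (mem_Icc_of_mem_box hx)]
    rw [e2 fun y => (y - c) ^ 2, e2 fun y => y ^ 2]
    have e3 : ∀ x, (P x - c) ^ 2 = P x ^ 2 - 2 * c * P x + c ^ 2 := fun x => by ring
    have i3 : IntegrableOn (fun _ => c ^ 2) (box (0 : d → ℝ)) := integrableOn_const hfin
    simp only [e3]
    have i4 : IntegrableOn (fun x => 2 * c * P x) (box 0) := i1.const_mul _
    have i5 : IntegrableOn (fun x => P x ^ 2 - 2 * c * P x) (box 0) := i2.sub i4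
    rw [integral_add i5 i3, integral_sub i2 i4,
      integral_const_mul, e1, setIntegral_const, Measure.real, volume_box]
    simp
    ring
  rw [h3]
  exact h1

end periodization

/-! ### Averages over the rotation group -/

instance : haarSO2.IsMulLeftInvariant := inferInstanceAs (Measure.haarMeasure ⊤).IsMulLeftInvariant

instance : IsProbabilityMeasure haarSO2 := ⟨by
  have := Measure.haarMeasure_self (G := SO2) (K₀ := ⊤)
  rwa [TopologicalSpace.PositiveCompacts.coe_top] at this⟩

/-- Average `E (rot φ * η)` over both `φ` and `η`. Left invariance makes the inner Haar integral
independent of `φ`; periodicity makes the inner angular integral independent of `η`; Fubini equates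
the two. -/
theorem integral_haarSO2 {E : SO2 → ℝ} (hE : Continuous E) :
    ∫ η, E η ∂haarSO2 = (2 * Real.pi)⁻¹ * ∫ φ in (0)..(2 * Real.pi), E (rot φ) := by
  have hpi : 0 < 2 * Real.pi := Real.two_pi_pos
  have h1 : ∀ φ, ∫ η, E (rot φ * η) ∂haarSO2 = ∫ η, E η ∂haarSO2 := fun φ =>
    integral_mul_left_eq_self E (rot φ)
  have h2 : ∀ η, ∫ φ in (0)..(2 * Real.pi), E (rot φ * η) =
      ∫ φ in (0)..(2 * Real.pi), E (rot φ) := fun η => by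
    obtain ⟨ψ, rfl⟩ := exists_eq_rot η
    simp only [rot_mul_rot]
    rw [intervalIntegral.integral_comp_add_right fun φ => E (rot φ)]
    have hper : Function.Periodic (fun φ => E (rot φ)) (2 * Real.pi) := fun φ => by
      simp only [rot_periodic φ]
    have := hper.intervalIntegral_add_eq ψ 0
    rw [zero_add] at this
    rw [zero_add, ← this, add_comm]
  obtain ⟨C, hC⟩ := isCompact_univ.exists_bound_of_continuousOn hE.continuousOn
  have hcont : Continuous fun p : ℝ × SO2 => E (rot p.1 * p.2) :=
    hE.comp ((continuous_rot.comp continuous_fst).mul continuous_snd)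
  have hint : Integrable (fun p : ℝ × SO2 => E (rot p.1 * p.2))
      ((volume.restrict (Ioc 0 (2 * Real.pi))).prod haarSO2) :=
    Integrable.of_bound hcont.aestronglyMeasurable C
      (Eventually.of_forall fun p => hC _ (mem_univ _))
  have h3 := integral_integral_swap (f := fun (φ : ℝ) (η : SO2) => E (rot φ * η)) hint
  simp only [h1, ← intervalIntegral.integral_of_le hpi.le, h2] at h3
  rw [intervalIntegral.integral_const, integral_const] at h3
  simp only [sub_zero, smul_eq_mul, probReal_univ, one_mul] at h3
  rw [← h3]
  field_simp

/-- A rotation as a linear isometry. -/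
def rotationEquiv (η : SO2) : Plane ≃ₗᵢ[ℝ] Plane where
  toFun := rigid η 0
  map_add' x y := by simp [rigid]
  map_smul' a x := by simp [rigid]
  invFun := rigidInv η 0
  left_inv := rigidInv_rigid η 0
  right_inv := rigid_rigidInv η 0
  norm_map' x := by
    have := (isometry_rigid η 0).dist_eq x 0
    rw [show rigid η 0 0 = 0 by simp [rigid], dist_zero_right, dist_zero_right] at this
    exact this

theorem norm_rigidInv_zero (η : SO2) (y : Plane) : ‖rigidInv η 0 y‖ = ‖y‖ :=
  (rotationEquiv η).symm.norm_map y

theorem continuous_rigidInv :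
    Continuous fun p : SO2 × Plane × Plane => rigidInv p.1 p.2.1 p.2.2 := by
  have h1 : Continuous fun p : SO2 × Plane × Plane => p.1⁻¹ := continuous_fst.inv
  have h2 : Continuous fun p : SO2 × Plane × Plane => p.2.2 - p.2.1 :=
    (continuous_snd.comp continuous_snd).sub (continuous_fst.comp continuous_snd)
  have h3 : Continuous fun p : SO2 × Plane × Plane => (p.1⁻¹, (0 : Plane), p.2.2 - p.2.1) :=
    h1.prodMk (continuous_const.prodMk h2)
  have h4 := continuous_rigid.comp h3
  have e : (fun p : SO2 × Plane × Plane => rigidInv p.1 p.2.1 p.2.2) =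
      (fun p : SO2 × Plane × Plane => rigid p.1 p.2.1 p.2.2) ∘
        fun p : SO2 × Plane × Plane => (p.1⁻¹, (0 : Plane), p.2.2 - p.2.1) :=
    funext fun p => rigidInv_eq p.1 p.2.1 p.2.2
  rw [e]
  exact h4

/-- The change of variables `y = -δ⁻¹ η x`. -/
theorem integral_rigidInv_smul {E : Type*} [NormedAddCommGroup E] [NormedSpace ℝ E]
    (F : Plane → E) {δ : ℝ} (hδ : 0 < δ) (η : SO2) :
    ∫ x : Fin 2 → ℝ, δ ^ 2 • F (rigidInv η 0 (-δ • WithLp.toLp 2 x)) = ∫ x, F x := by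
  have h1 := (PiLp.volume_preserving_toLp (Fin 2)).integral_comp
    (MeasurableEquiv.toLp 2 (Fin 2 → ℝ)).measurableEmbedding
    fun x : Plane => δ ^ 2 • F (rigidInv η 0 (-δ • x))
  have h2 := Measure.integral_comp_smul (volume : Measure Plane) (fun x => F (rigidInv η 0 x)) (-δ)
  have h3 := (rotationEquiv η).symm.measurePreserving.integral_comp
    (rotationEquiv η).symm.toHomeomorph.measurableEmbedding F
  rw [finrank_euclideanSpace_fin, even_two.neg_pow, abs_of_pos (by positivity)] at h2
  refine h1.trans ?_
  rw [integral_smul, h2, smul_smul, mul_inv_cancel₀ (by positivity), one_smul]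
  exact h3

theorem setIntegral_unitSquare {E : Type*} [NormedAddCommGroup E] [NormedSpace ℝ E]
    (F : Plane → E) : ∫ ξ in unitSquare, F ξ =
      ∫ x in box (0 : Fin 2 → ℝ), F (WithLp.toLp 2 x) := by
  have h1 := (PiLp.volume_preserving_toLp (Fin 2)).setIntegral_preimage_emb
    (MeasurableEquiv.toLp 2 (Fin 2 → ℝ)).measurableEmbedding F unitSquare
  rw [← h1]
  refine setIntegral_congr_set ?_
  have h2 := Measure.univ_pi_Ioc_ae_eq_Icc (μ := fun _ : Fin 2 => (volume : Measure ℝ))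
    (f := fun _ => 0) (g := fun _ => 1)
  have e1 : box (0 : Fin 2 → ℝ) = Set.pi univ fun _ : Fin 2 => Ioc (0 : ℝ) 1 := by
    ext; simp [box]
  have e2 : WithLp.toLp 2 ⁻¹' unitSquare = Icc (fun _ : Fin 2 => (0 : ℝ)) fun _ => 1 := by
    ext x
    exact ⟨fun h => ⟨fun i => (h i).1, fun i => (h i).2⟩, fun h i => ⟨h.1 i, h.2 i⟩⟩
  rw [e1]
  erw [e2]
  exact h2.symm

/-- The sum of a function over a moved and scaled integer lattice. -/
def latticeSum (G : Plane → ℝ) (δ : ℝ) (η : SO2) (ξ : Plane) : ℝ :=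
  δ ^ 2 * ∑' w : Fin 2 → ℤ, G (rigidInv η (δ • ξ) (WithLp.toLp 2 fun i => δ * (w i : ℝ)))

section lattice

variable {G : Plane → ℝ} {B C δ : ℝ}

/-- The function of which the lattice sum is the periodization. -/
def latticeKernel (G : Plane → ℝ) (δ : ℝ) (η : SO2) (x : Fin 2 → ℝ) : ℝ :=
  δ ^ 2 • G (rigidInv η 0 (-δ • WithLp.toLp 2 x))

/-- The sample points are `η⁻¹ (δ (w - ξ))`; replacing `w` by `-w` writes them as `-δ η⁻¹ (ξ + w)`,
a periodization in `ξ`. -/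
theorem latticeSum_eq (G : Plane → ℝ) (δ : ℝ) (η : SO2) (x : Fin 2 → ℝ) :
    latticeSum G δ η (WithLp.toLp 2 x) = ∑' w, latticeKernel G δ η (x + intVec w) := by
  unfold latticeKernel
  simp only [smul_eq_mul]
  rw [tsum_mul_left, latticeSum, ← (Equiv.neg (Fin 2 → ℤ)).tsum_eq]
  congr 1
  refine tsum_congr fun w => ?_
  congr 1
  unfold rigidInv
  congr 1
  ext i
  simp [intVec]
  ring

theorem supportedIn_latticeKernel (hδ : 0 < δ) (hB : ∀ x, B < ‖x‖ → G x = 0) (η : SO2) :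
    SupportedIn ⌈B / δ⌉₊ (latticeKernel G δ η) := by
  intro x i hx
  have h1 : B / δ < |x i| := (Nat.le_ceil _).trans_lt hx
  rw [div_lt_iff₀ hδ] at h1
  have h2 : |x i| ≤ ‖(WithLp.toLp 2 x : Plane)‖ := PiLp.norm_apply_le (WithLp.toLp 2 x : Plane) i
  rw [latticeKernel, hB, smul_zero]
  rw [norm_rigidInv_zero, norm_smul, norm_neg, Real.norm_of_nonneg hδ.le]
  nlinarith

theorem measurable_latticeKernel (hG : Measurable G) (η : SO2) :
    Measurable (latticeKernel G δ η) := by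
  have h : Continuous fun x : Fin 2 → ℝ => rigidInv η 0 (-δ • WithLp.toLp 2 x) :=
    (rotationEquiv η).symm.continuous.comp ((PiLp.continuous_toLp 2 _).const_smul (-δ))
  exact (hG.comp h.measurable).const_mul (δ ^ 2)

theorem norm_latticeKernel_le (hC : ∀ x, |G x| ≤ C) (η : SO2) (x : Fin 2 → ℝ) :
    ‖latticeKernel G δ η x‖ ≤ δ ^ 2 * C := by
  rw [latticeKernel, norm_smul, Real.norm_of_nonneg (sq_nonneg δ)]
  exact mul_le_mul_of_nonneg_left (hC _) (sq_nonneg δ)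

/-- The Fourier transform of `G` at a rotated lattice vector. -/
def latticeCoeff (G : Plane → ℝ) (δ : ℝ) (n : Fin 2 → ℤ) (η : SO2) : ℝ :=
  ‖∫ x : Plane, (G x : ℂ) *
    osc (-(2 * Real.pi / δ) * (n 0 * rigid η 0 x 0 + n 1 * rigid η 0 x 1))‖ ^ 2

/-- Parseval's identity for lattice sums. -/
theorem hasSum_latticeCoeff (hδ : 0 < δ) (hG : Measurable G) (hC : ∀ x, |G x| ≤ C)
    (hB : ∀ x, B < ‖x‖ → G x = 0) (η : SO2) :
    HasSum (fun n => if n = 0 then 0 else latticeCoeff G δ n η)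
      (∫ ξ in unitSquare, (latticeSum G δ η ξ - ∫ x, G x) ^ 2) := by
  have h1 := (supportedIn_latticeKernel hδ hB η).hasSum_variance (measurable_latticeKernel hG η)
    (norm_latticeKernel_le hC η)
  rw [setIntegral_unitSquare]
  simp only [latticeSum_eq]
  rw [show ∫ y, latticeKernel G δ η y = ∫ x, G x from integral_rigidInv_smul G hδ η] at h1
  -- The substitution that undoes scaling and rotation transfers the rotation to the frequency; the
  -- Jacobian is the factor `δ ^ 2`.
  have h2 : ∀ n : Fin 2 → ℤ, ‖∫ x, (latticeKernel G δ η x : ℂ) *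
      osc (2 * Real.pi * ∑ i, n i * x i)‖ ^ 2 = latticeCoeff G δ n η := fun n => by
    rw [latticeCoeff, ← integral_rigidInv_smul _ hδ η]
    congr 3
    funext x
    rw [rigid_rigidInv, latticeKernel]
    simp only [smul_eq_mul, Complex.ofReal_mul, Complex.real_smul, mul_assoc]
    congr 3
    simp [Fin.sum_univ_two]
    field_simp
    ring
  simpa only [h2] using h1

theorem integrable_of_bounded_support (hG : Measurable G) (hC : ∀ x, |G x| ≤ C)
    (hB : ∀ x, B < ‖x‖ → G x = 0) : Integrable G := by
  refine (integrableOn_iff_integrable_of_support_subset (s := Metric.closedBall 0 B)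
    fun x hx => ?_).1 ?_
  · by_contra hi
    rw [mem_closedBall_zero_iff, not_le] at hi
    exact hx (hB x hi)
  · exact Measure.integrableOn_of_bounded (isCompact_closedBall _ _).measure_lt_top.ne
      hG.aestronglyMeasurable (Eventually.of_forall hC)

instance : FirstCountableTopology SO2 :=
  haveI : FirstCountableTopology (Matrix (Fin 2) (Fin 2) ℝ) :=
    inferInstanceAs (FirstCountableTopology (Fin 2 → Fin 2 → ℝ))
  IsInducing.subtypeVal.firstCountableTopology

theorem continuous_integral_mul_unimodular {Φ : SO2 × Plane → ℂ} (hi : Integrable G)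
    (hΦ : Continuous Φ) (h1 : ∀ p, ‖Φ p‖ = 1) : Continuous fun η => ∫ x, (G x : ℂ) * Φ (η, x) := by
  refine continuous_of_dominated (bound := fun x => ‖G x‖) (fun η => ?_) (fun η => ?_) hi.norm ?_
  · exact (Complex.continuous_ofReal.comp_aestronglyMeasurable hi.1).mul
      (hΦ.comp (Continuous.prodMk_right η)).aestronglyMeasurable
  · exact Eventually.of_forall fun x => by rw [norm_mul, h1, mul_one, Complex.norm_real]
  · exact Eventually.of_forall fun x =>
      continuous_const.mul (hΦ.comp (Continuous.prodMk_left x))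

theorem continuous_latticeCoeff (hi : Integrable G) (n : Fin 2 → ℤ) :
    Continuous (latticeCoeff G δ n) := by
  have hr : ∀ i, Continuous fun p : SO2 × Plane => rigid p.1 0 p.2 i := fun i =>
    (EuclideanSpace.proj (𝕜 := ℝ) i : Plane →L[ℝ] ℝ).continuous.comp
      (continuous_rigid.comp (continuous_fst.prodMk (continuous_const.prodMk continuous_snd)))
  have hc : Continuous fun p : SO2 × Plane =>
      osc (-(2 * Real.pi / δ) * (n 0 * rigid p.1 0 p.2 0 + n 1 * rigid p.1 0 p.2 1)) :=
    continuous_osc.comp (continuous_const.mul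
      ((continuous_const.mul (hr 0)).add (continuous_const.mul (hr 1))))
  exact ((continuous_integral_mul_unimodular hi hc fun p => norm_osc _).norm).pow 2

/-- The mean of a Fourier coefficient over the rotations. -/
theorem integral_latticeCoeff (hi : Integrable G) (n : Fin 2 → ℤ) :
    ∫ η, latticeCoeff G δ n η ∂haarSO2 = (2 * Real.pi)⁻¹ * ∫ φ in (0)..(2 * Real.pi),
      ‖∫ x : Plane, (G x : ℂ) *
        osc (2 * Real.pi * Real.sqrt (n 0 ^ 2 + n 1 ^ 2) / δ * phase φ (x 0) (x 1))‖ ^ 2 := by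
  rw [integral_haarSO2 (continuous_latticeCoeff hi n)]
  congr 1
  -- Polar coordinates of `-n` absorb the sign of the phase. Rotation by `φ` gives the direction `β
  -- - φ`, and periodicity removes both the reversal and the shift.
  obtain ⟨r, β, hr, h0, h1⟩ := exists_polar (-(n 0 : ℝ)) (-(n 1 : ℝ))
  have hrs : Real.sqrt (n 0 ^ 2 + n 1 ^ 2) = r := by
    rw [show (n 0 : ℝ) ^ 2 + (n 1 : ℝ) ^ 2 = r ^ 2 by
      rw [← neg_sq, h0, ← neg_sq (n 1 : ℝ), h1]
      linear_combination r ^ 2 * Real.cos_sq_add_sin_sq β, Real.sqrt_sq hr]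
  rw [hrs]
  set e : ℝ → ℝ := fun φ => ‖∫ x : Plane, (G x : ℂ) *
    osc (2 * Real.pi * r / δ * phase φ (x 0) (x 1))‖ ^ 2 with he
  have hper : Function.Periodic e (2 * Real.pi) := fun φ => by
    simp only [he, phase, Real.cos_add_two_pi, Real.sin_add_two_pi]
  have h2 : ∀ φ, latticeCoeff G δ n (rot φ) = e (β - φ) := fun φ => by
    simp only [latticeCoeff, he]
    congr 3
    funext x
    congr 2
    rw [rigid_rot, phase, Real.cos_sub, Real.sin_sub]
    simp
    rw [show (n 0 : ℝ) = -(r * Real.cos β) by rw [← h0, neg_neg],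
      show (n 1 : ℝ) = -(r * Real.sin β) by rw [← h1, neg_neg]]
    ring
  simp only [h2]
  rw [intervalIntegral.integral_comp_sub_left e β]
  have h3 := hper.intervalIntegral_add_eq (β - 2 * Real.pi) 0
  rw [sub_add_cancel, zero_add] at h3
  rw [sub_zero, h3]

end lattice

/-! ### The mean-square error -/

section lattice

variable {G : Plane → ℝ} {B C δ : ℝ}

theorem measurableSet_unitSquare : MeasurableSet unitSquare := by
  have : unitSquare = ⋂ i : Fin 2, (fun ξ : Plane => ξ i) ⁻¹' Icc 0 1 := by
    ext; simp [unitSquare]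
  rw [this]
  exact MeasurableSet.iInter fun i =>
    ((EuclideanSpace.proj (𝕜 := ℝ) i : Plane →L[ℝ] ℝ).continuous.measurable measurableSet_Icc)

instance : IsFiniteMeasure ((volume : Measure Plane).restrict unitSquare) := by
  refine isFiniteMeasure_restrict.2 (ne_of_lt ?_)
  refine Bornology.IsBounded.measure_lt_top ((Metric.isBounded_iff_subset_closedBall 0).2 ⟨2, ?_⟩)
  intro ξ hξ
  rw [mem_closedBall_zero_iff]
  have h0 := hξ 0
  have h1 := hξ 1
  refine abs_le_of_sq_le_sq' ?_ zero_le_two |>.2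
  rw [norm_sq_plane]
  nlinarith [h0.1, h0.2, h1.1, h1.2]

/-- The lattice sum over the lattice points that matter for the unit square. -/
def finiteLatticeSum (G : Plane → ℝ) (δ : ℝ) (N : ℕ) (p : Plane × SO2) : ℝ :=
  ∑ w ∈ intBox (N + 1), latticeKernel G δ p.2 (WithLp.ofLp p.1 + intVec w)

theorem measurable_finiteLatticeSum (hG : Measurable G) (N : ℕ) :
    Measurable (finiteLatticeSum G δ N) := by
  refine Finset.measurable_sum _ fun w _ => ?_
  have h0 : Continuous fun p : Plane × SO2 => WithLp.ofLp p.1 + intVec w :=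
    ((PiLp.continuous_ofLp 2 _).comp continuous_fst).add continuous_const
  have h1 : Continuous fun p : Plane × SO2 =>
      (-δ • WithLp.toLp 2 (WithLp.ofLp p.1 + intVec w) : Plane) :=
    ((PiLp.continuous_toLp 2 fun _ : Fin 2 => ℝ).comp h0).const_smul (-δ)
  have h2 := continuous_rigidInv.comp
    (continuous_snd.prodMk ((continuous_const (y := (0 : Plane))).prodMk h1))
  exact (hG.comp h2.measurable).const_mul (δ ^ 2)

theorem latticeSum_eq_finiteLatticeSum (hδ : 0 < δ) (hB : ∀ x, B < ‖x‖ → G x = 0) (η : SO2)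
    {ξ : Plane} (hξ : ξ ∈ unitSquare) :
    latticeSum G δ η ξ = finiteLatticeSum G δ ⌈B / δ⌉₊ (ξ, η) := by
  have := latticeSum_eq G δ η (WithLp.ofLp ξ)
  rw [(supportedIn_latticeKernel hδ hB η).tsum_eq fun i =>
    ⟨by linarith [(hξ i).1], (hξ i).2⟩] at this
  exact this

/-- For `ξ` in the unit square the sum is over a fixed finite set of indices, so it agrees with a
bounded function that is jointly measurable. -/
theorem integrable_sq_latticeSum (hδ : 0 < δ) (hG : Measurable G) (hC : ∀ x, |G x| ≤ C)
    (hB : ∀ x, B < ‖x‖ → G x = 0) (I : ℝ) :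
    Integrable (fun p : Plane × SO2 => (latticeSum G δ p.2 p.1 - I) ^ 2)
      ((volume.restrict unitSquare).prod haarSO2) := by
  set N := ⌈B / δ⌉₊
  have h1 : Integrable (fun p : Plane × SO2 => (finiteLatticeSum G δ N p - I) ^ 2)
      ((volume.restrict unitSquare).prod haarSO2) := by
    refine Integrable.of_bound
      (((measurable_finiteLatticeSum hG N).sub_const I).pow_const 2).aestronglyMeasurable
      (((intBox (d := Fin 2) (N + 1)).card * (δ ^ 2 * C) + |I|) ^ 2)
      (Eventually.of_forall fun p => ?_)
    rw [norm_pow]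
    refine pow_le_pow_left₀ (norm_nonneg _) ((norm_sub_le _ _).trans (add_le_add ?_ le_rfl)) 2
    refine (norm_sum_le_of_le _ fun w _ => norm_latticeKernel_le hC _ _).trans_eq ?_
    rw [Finset.sum_const, nsmul_eq_mul]
  refine h1.congr ?_
  have h2 : ∀ᵐ p : Plane × SO2 ∂((volume.restrict unitSquare).prod haarSO2), p.1 ∈ unitSquare :=
    Measure.quasiMeasurePreserving_fst.ae (ae_restrict_mem measurableSet_unitSquare)
  filter_upwards [h2] with p hp
  rw [latticeSum_eq_finiteLatticeSum hδ hB p.2 hp]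

theorem one_le_and_norm_le_sqrt {n : Fin 2 → ℤ} (hn : n ≠ 0) :
    1 ≤ Real.sqrt (n 0 ^ 2 + n 1 ^ 2) ∧ ‖n‖ ≤ Real.sqrt (n 0 ^ 2 + n 1 ^ 2) := by
  have h1 : ‖n‖ ≤ Real.sqrt (n 0 ^ 2 + n 1 ^ 2) := by
    refine (pi_norm_le_iff_of_nonneg (Real.sqrt_nonneg _)).2 fun i => ?_
    rw [Int.norm_eq_abs]
    refine Real.abs_le_sqrt ?_
    fin_cases i
    · exact le_add_of_nonneg_right (sq_nonneg _)
    · exact le_add_of_nonneg_left (sq_nonneg _)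
  refine ⟨le_trans ?_ h1, h1⟩
  obtain ⟨i, hi⟩ := Function.ne_iff.1 hn
  refine le_trans ?_ (norm_le_pi_norm n i)
  rw [Int.norm_eq_abs]
  exact_mod_cast Int.one_le_abs hi

/-- The mean-square error of a lattice sum, from the decay of circular means of the Fourier
transform. -/
theorem integral_sq_latticeSum_le {ε A : ℝ} {m : ℕ} (hm : 1 ≤ m) (hδ : 0 < δ) (hδ1 : δ ≤ 1)
    (hε : 0 < ε) (hA : 0 ≤ A) (hG : Measurable G) (hC : ∀ x, |G x| ≤ C)
    (hB : ∀ x, B < ‖x‖ → G x = 0) (hdec : ∀ R, 1 ≤ R → ∫ φ in (0)..(2 * Real.pi),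
      ‖∫ x : Plane, (G x : ℂ) * osc (R * phase φ (x 0) (x 1))‖ ^ 2 ≤ A / (R * (ε * R) ^ (2 * m))) :
    ∫ ξ in unitSquare, ∫ η, (latticeSum G δ η ξ - ∫ x, G x) ^ 2 ∂haarSO2 ≤
      A * (∑' n : Fin 2 → ℤ, ‖n‖ ^ (-3 : ℝ)) * (δ * (δ / ε) ^ (2 * m)) := by
  have hi := integrable_of_bounded_support hG hC hB
  have hpi := Real.pi_gt_three
  set D := A * (δ * (δ / ε) ^ (2 * m)) with hD
  have hD0 : 0 ≤ D := by positivity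
  set F : (Fin 2 → ℤ) → SO2 → ℝ := fun n η => if n = 0 then 0 else latticeCoeff G δ n η with hF
  have hF0 : ∀ n η, 0 ≤ F n η := fun n η => by
    simp only [hF]; split_ifs
    · exact le_rfl
    · exact sq_nonneg _
  have hFi : ∀ n, Integrable (F n) haarSO2 := fun n => by
    by_cases hn : n = 0
    · simp [hF, hn]
    · simp only [hF, hn, if_false]
      obtain ⟨c, hc⟩ := isCompact_univ.exists_bound_of_continuousOn
        (continuous_latticeCoeff (δ := δ) hi n).continuousOn
      exact Integrable.of_bound (continuous_latticeCoeff hi n).aestronglyMeasurable c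
        (Eventually.of_forall fun η => hc η (mem_univ _))
  have hFle : ∀ n, ∫ η, F n η ∂haarSO2 ≤ D * ‖n‖ ^ (-3 : ℝ) := fun n => by
    by_cases hn : n = 0
    · simp only [hF, hn, if_true, integral_zero]; positivity
    · simp only [hF, hn, if_false]
      obtain ⟨hr1, hrn⟩ := one_le_and_norm_le_sqrt hn
      rw [integral_latticeCoeff hi]
      set r := Real.sqrt (n 0 ^ 2 + n 1 ^ 2)
      have hr0 : 0 < r := by linarith
      have hn0 : 0 < ‖n‖ := norm_pos_iff.2 hn
      -- The factors `2π > 1` only help and are discarded; `δ ≤ 1 ≤ r` puts the frequency in the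
      -- range `R ≥ 1` of the decay bound.
      have hRr : r / δ ≤ 2 * Real.pi * r / δ := by gcongr; nlinarith
      have hR1 : 1 ≤ r / δ := by rw [le_div_iff₀ hδ]; linarith
      have hX := hdec _ (hR1.trans hRr)
      set X := ∫ φ in (0)..(2 * Real.pi), ‖∫ x : Plane, (G x : ℂ) *
        osc (2 * Real.pi * r / δ * phase φ (x 0) (x 1))‖ ^ 2
      have h1 : (2 * Real.pi)⁻¹ * X ≤ X := by
        refine mul_le_of_le_one_left ?_ (inv_le_one_of_one_le₀ (by linarith))
        exact intervalIntegral.integral_nonneg Real.two_pi_pos.le fun _ _ => sq_nonneg _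
      refine (h1.trans hX).trans ?_
      have h2 : A / (2 * Real.pi * r / δ * (ε * (2 * Real.pi * r / δ)) ^ (2 * m)) ≤
          A / (r / δ * (ε * (r / δ)) ^ (2 * m)) := by gcongr
      have h3 : A / (r / δ * (ε * (r / δ)) ^ (2 * m)) = D * (r * r ^ (2 * m))⁻¹ := by
        rw [hD]; simp only [mul_pow, div_pow]; field_simp
      refine h2.trans (h3.le.trans (mul_le_mul_of_nonneg_left ?_ hD0))
      -- Since `m ≥ 1` and `r ≥ 1`, the power `r ^ (1 + 2m)` dominates `‖n‖ ^ 3`, and the exponent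
      -- three exceeds the dimension of the lattice.
      rw [Real.rpow_neg hn0.le, show (3 : ℝ) = ((3 : ℕ) : ℝ) by norm_num, Real.rpow_natCast]
      refine inv_anti₀ (by positivity) ?_
      calc ‖n‖ ^ 3 ≤ r ^ 3 := by gcongr
        _ = r * r ^ 2 := by ring
        _ ≤ r * r ^ (2 * m) := by gcongr; omega
  have hsum : Summable fun n : Fin 2 → ℤ => D * ‖n‖ ^ (-3 : ℝ) :=
    (EisensteinSeries.summable_one_div_norm_rpow (by norm_num)).mul_left D
  have hFsum : Summable fun n => ∫ η, F n η ∂haarSO2 :=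
    Summable.of_nonneg_of_le (fun n => integral_nonneg (hF0 n)) hFle hsum
  have hswap := integral_integral_swap
    (f := fun (ξ : Plane) (η : SO2) => (latticeSum G δ η ξ - ∫ x, G x) ^ 2)
    (integrable_sq_latticeSum hδ hG hC hB _)
  have hpars : ∀ η, ∫ ξ in unitSquare, (latticeSum G δ η ξ - ∫ x, G x) ^ 2 = ∑' n, F n η :=
    fun η => (hasSum_latticeCoeff hδ hG hC hB η).tsum_eq.symm
  have hS := hasSum_integral_of_summable_integral_norm hFi (by
    simpa only [Real.norm_of_nonneg (hF0 _ _)] using hFsum)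
  rw [hswap]
  simp only [hpars]
  rw [← hS.tsum_eq]
  refine (hFsum.tsum_le_tsum hFle hsum).trans_eq ?_
  rw [tsum_mul_left, hD]
  ring

end lattice

/-! ### Assembly: variance bound uniform in width and mesh -/

namespace IsSmoothClosedCurve

variable {γ : ℝ → Plane} {L ρ r : ℝ} (h : IsSmoothClosedCurve γ L)
include h

/-- The mean-square error of the quadrature, uniformly in the width and the mesh. -/
theorem exists_bound_variance (hK : ProjectionWellDefined (range γ) ρ) (hr0 : 0 < r) (hr : r < ρ)
    {f : Plane → ℝ} (hf : ContDiff ℝ ∞ (f ∘ γ)) {q : ℕ} {θ : ℝ → ℝ} (hθ : IsWeight q θ) :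
    ∃ C, 0 ≤ C ∧ ∀ ε δ : ℝ, 0 < ε → ε ≤ r → 0 < δ → δ ≤ 1 →
      Integrable (fun p : Plane × SO2 =>
        |movedQuadrature γ f θ δ ε p.2 p.1 - boundaryIntegral γ L f| ^ 2)
        ((volume.restrict unitSquare).prod haarSO2) ∧
      ∫ ξ in unitSquare, ∫ η,
        |movedQuadrature γ f θ δ ε η ξ - boundaryIntegral γ L f| ^ 2 ∂haarSO2 ≤
        C * (δ * (δ / ε) ^ (2 * (q + 1))) := by
  obtain ⟨c, hc, hF⟩ := h.exists_regular hK hr0 hr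
  obtain ⟨A, hA, hdec⟩ := h.exists_bound_layer_fourier hK hc hr0 hF hr hf hθ
  refine ⟨A * ∑' n : Fin 2 → ℤ, ‖n‖ ^ (-3 : ℝ), by positivity, fun ε δ hε0 hε hδ hδ1 => ?_⟩
  have hθm := hθ.piecewise.measurable
  have hG := h.measurable_layer (f := f) hK hc hF hr hε hf.continuous hθm
  obtain ⟨C, -, hC⟩ := h.exists_bound_layer (f := f) hK hc hF hr hε0 hε hf.continuous hθ.bounded
  obtain ⟨B, -, hB⟩ := h.exists_layer_support (f := f) (θ := θ) hε
  have hI : ∫ x, layer γ f θ ε x = boundaryIntegral γ L f := by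
    have := h.integral_layer hK hc hF hr hε0 hε hf.continuous hθm hθ.bounded hθ.integral_eq
    rw [integral_complex_ofReal] at this
    exact_mod_cast this
  have hQ : ∀ η ξ, movedQuadrature γ f θ δ ε η ξ = latticeSum (layer γ f θ ε) δ η ξ :=
    h.movedQuadrature_eq hK hc hF hr hε δ
  simp only [hQ, sq_abs]
  refine ⟨integrable_sq_latticeSum hδ hG hC hB _, ?_⟩
  rw [← hI]
  exact integral_sq_latticeSum_le (Nat.le_add_left 1 q) hδ hδ1 hε0 hA hG hC hB
    fun R hR => hdec ε R hε0 hε hR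

end IsSmoothClosedCurve

end ImplicitBoundary

end

/-! ### Insertion of the tube width -/

theorem mainTheorem9
    (γ : ℝ → ImplicitBoundary.Plane) (L : ℝ)
    (hγ : ImplicitBoundary.IsSmoothClosedCurve γ L)
    (κ : ℝ) (hκ : 2 < κ)
    (hflat : ImplicitBoundary.HasFinitelyManyFlatPoints γ L κ)
    (f : ImplicitBoundary.Plane → ℝ) (hf : ContDiff ℝ ∞ (f ∘ γ))
    (q : ℕ) (θ : ℝ → ℝ) (hθ : ImplicitBoundary.IsWeight q θ)
    (α : ℝ) (hα : α ∈ Icc (0 : ℝ) 1)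
    (ε : ℝ → ℝ) (hε_pos : ∀ᶠ h in 𝓝[>] (0 : ℝ), 0 < ε h)
    (hε : ε =Θ[𝓝[>] (0 : ℝ)] fun h : ℝ => h ^ α)
    (ρ ρ' : ℝ) (hρ : ImplicitBoundary.ProjectionWellDefined (range γ) ρ)
    (hρ' : ρ' < ρ) (hε_le : ∀ᶠ h in 𝓝[>] (0 : ℝ), ε h ≤ ρ') :
    (∀ᶠ h in 𝓝[>] (0 : ℝ),
      Integrable
        (fun p : ImplicitBoundary.Plane × ImplicitBoundary.SO2 =>
          |ImplicitBoundary.movedQuadrature γ f θ h (ε h) p.2 p.1 -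
            ImplicitBoundary.boundaryIntegral γ L f| ^ 2)
        ((volume.restrict ImplicitBoundary.unitSquare).prod ImplicitBoundary.haarSO2)) ∧
    (fun h : ℝ =>
      ∫ ξ in ImplicitBoundary.unitSquare, ∫ η,
        |ImplicitBoundary.movedQuadrature γ f θ h (ε h) η ξ -
          ImplicitBoundary.boundaryIntegral γ L f| ^ 2 ∂ImplicitBoundary.haarSO2)
      =O[𝓝[>] (0 : ℝ)] fun h : ℝ => h ^ (1 + 2 * ((q : ℝ) + 1) * (1 - α)) := by
  -- Some width is positive and at most `ρ'`, so `ρ'` is positive and can serve as the uniform tube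
  -- radius.
  obtain ⟨h₀, hpos₀, hle₀⟩ := (hε_pos.and hε_le).exists
  obtain ⟨C, hC, hb⟩ := hγ.exists_bound_variance hρ (hpos₀.trans_le hle₀) hρ' hf hθ
  have hone : ∀ᶠ h in 𝓝[>] (0 : ℝ), h ≤ 1 :=
    eventually_nhdsWithin_of_eventually_nhds (eventually_le_nhds one_pos)
  refine ⟨?_, ?_⟩
  · filter_upwards [hε_pos, hε_le, hone, self_mem_nhdsWithin] with h h1 h2 h3 h4
    exact (hb (ε h) h h1 h2 h4 h3).1
  · obtain ⟨K, hK, hbd⟩ := hε.2.exists_pos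
    refine IsBigO.of_bound (C * K ^ (2 * (q + 1))) ?_
    filter_upwards [hε_pos, hε_le, hone, self_mem_nhdsWithin, hbd.bound] with h h1 h2 h3 h4 h5
    have h4 : 0 < h := h4
    have hpow : 0 < h ^ α := Real.rpow_pos_of_pos h4 α
    rw [Real.norm_of_nonneg hpow.le, Real.norm_of_nonneg h1.le] at h5
    rw [Real.norm_of_nonneg (integral_nonneg fun ξ => integral_nonneg fun η => sq_nonneg _),
      Real.norm_of_nonneg (Real.rpow_nonneg h4.le _)]
    refine (hb (ε h) h h1 h2 h4 h3).2.trans ?_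
    -- From the lower half of `Θ`, namely `h ^ α ≤ K ε h`: a wider tube only improves the estimate.
    have h6 : h / ε h ≤ K * h ^ (1 - α) := by
      rw [Real.rpow_sub h4, Real.rpow_one, div_le_iff₀ h1]
      calc h = h / h ^ α * h ^ α := by field_simp
        _ ≤ h / h ^ α * (K * ε h) := by gcongr
        _ = K * (h / h ^ α) * ε h := by ring
    calc C * (h * (h / ε h) ^ (2 * (q + 1)))
        ≤ C * (h * (K * h ^ (1 - α)) ^ (2 * (q + 1))) := by gcongr
      _ = C * K ^ (2 * (q + 1)) * (h * (h ^ (1 - α)) ^ (2 * (q + 1))) := by rw [mul_pow]; ring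
      _ = C * K ^ (2 * (q + 1)) * h ^ (1 + 2 * ((q : ℝ) + 1) * (1 - α)) := by
        rw [Real.rpow_add h4, Real.rpow_one, ← Real.rpow_natCast (h ^ (1 - α)),
          ← Real.rpow_mul h4.le]
        congr 3
        push_cast
        ring
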